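/- **Conventions.** All C*-algebras are complex and need not be unital. For positive elements $a,b$ of a C*-algebra $D$ write $a\precsim b$ if $a=\lim_n r_n b r_n^*$ for some sequence $(r_n)$ in $D$. The Cuntz semigroup $\mathrm{Cu}(D)$ is $(D\otimes\mathcal K)_+/\!\sim$, where $a\sim b$ means $a\precsim b$ and $b\precsim a$, with addition induced by diagonal addition and order induced by $\precsim$. A $*$-homomorphism $\theta\colon A\to B$ induces $\mathrm{Cu}(\theta)\colon\mathrm{Cu}(A)\to\mathrm{Cu}(B)$, $[a]\mapsto[(\theta\otimes\mathrm{id}_{\mathcal K})(a)]$. Write $x\ll y$ if, for every increasing sequence $(z_n)$ that has a supremum $s\ge y$, there is $n$ with $x\le z_n$. The map $\theta$ is *pure* if $\varphi=\mathrm{Cu}(\theta)$ satisfies the following two conditions: 1. (almost unperforated) $\varphi(x)\le\varphi(y)$ whenever $(m+1)x\le my$ for some $m\in\mathbb N$; 2. (almost divisible) for all $k\in\mathbb N$ and $x'\ll x$ in $\mathrm{Cu}(A)$ there is $z\in\mathrm{Cu}(B)$ with $kz\le\varphi(x)$ and $\varphi(x')\le(k+1)z$. A C*-algebra is *pure* if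 its identity map satisfies these two conditions. The unit $1$ of a unital C*-algebra $D$ is *almost divisible* if for all $k\in\mathbb N$ and $x'\ll[1]$ in $\mathrm{Cu}(D)$ there is $z\in\mathrm{Cu}(D)$ with $kz\le[1]$ and $x'\le(k+1)z$. For a free ultrafilter $\omega$ on $\mathbb N$, let $B_\omega=\ell^\infty(\mathbb N,B)/\{(b_n)_n:\lim_{n\to\omega}\|b_n\|=0\}$, and regard $B$ as a subalgebra of $B_\omega$ through constant sequences. For a self-adjoint set $T\subseteq B_\omega$ let $B_\omega\cap T'$ be its commutant in $B_\omega$, and let $\mathrm{Ann}(T)=\{x\in B_\omega: xt=tx=0 \text{ for all } t\in T\}$, which is a closed two-sided ideal of $B_\omega\cap T'$. **Theorem.** Let $A$ be a $\sigma$-unital C*-algebra, $B$ a C*-algebra, $\theta\colon A\to B$ a $*$-homomorphism, and $\omega$ a free ultrafilter on $\mathbb N$. 1. If the unit of $(B_\omega\cap\theta(A)')/\mathrm{Ann}(\theta(A))$ is almost divisible, then $\theta$ is pure. 2. If the unit of $(B_\omega\cap(\theta(A)\cup S)')/\mathrm{Ann}(\theta(A)\cup S)$ is almost divisible for every separable C*-subalgebra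 $S\subseteq B_\omega\cap\theta(A)'$, then there is a pure C*-subalgebra $C$ of $B_\omega$ with $\theta(A)\subseteq C\subseteq B_\omega$. -/

import Mathlib

open Filter Topology
open scoped ENNReal

namespace PureCStar
noncomputable section

/-- A closed two-sided self-adjoint ideal of a C*-algebra. -/
structure ClosedIdeal (M : Type*) [NonUnitalCStarAlgebra M] extends Submodule ℂ M where
  mul_mem_left' : ∀ (x : M) {y : M}, y ∈ carrier → x * y ∈ carrier
  mul_mem_right' : ∀ (x : M) {y : M}, y ∈ carrier → y * x ∈ carrier
  star_mem' : ∀ {y : M}, y ∈ carrier → star y ∈ carrier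
  isClosed' : IsClosed carrier

namespace ClosedIdeal

variable {M : Type*} [NonUnitalCStarAlgebra M] (I : ClosedIdeal M)

/-- The quotient of a C*-algebra by a closed two-sided ideal, with the quotient norm. -/
def Quot : Type _ := M ⧸ I.toSubmodule

instance : IsClosed (I.toSubmodule : Set M) := I.isClosed'

instance : NormedAddCommGroup I.Quot :=
  inferInstanceAs (NormedAddCommGroup (M ⧸ I.toSubmodule))
instance : NormedSpace ℂ I.Quot := inferInstanceAs (NormedSpace ℂ (M ⧸ I.toSubmodule))
instance : CompleteSpace I.Quot := inferInstanceAs (CompleteSpace (M ⧸ I.toSubmodule))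

/-- The quotient map, as a linear map. -/
def mkₗ : M →ₗ[ℂ] I.Quot := I.toSubmodule.mkQ

theorem mkₗ_surjective : Function.Surjective I.mkₗ := I.toSubmodule.mkQ_surjective

theorem mkₗ_eq_iff {x y : M} : I.mkₗ x = I.mkₗ y ↔ x - y ∈ I.toSubmodule :=
  Submodule.Quotient.eq _

theorem norm_mkₗ_le (x : M) : ‖I.mkₗ x‖ ≤ ‖x‖ := Submodule.Quotient.norm_mk_le _ x

theorem exists_norm_lt (x : I.Quot) {ε : ℝ} (hε : 0 < ε) :
    ∃ m : M, I.mkₗ m = x ∧ ‖m‖ < ‖x‖ + ε := Submodule.Quotient.norm_mk_lt x hε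

instance : Mul I.Quot where
  mul := Quotient.map₂ (· * ·) fun a b hab c d hcd => by
    replace hab := (Submodule.quotientRel_def _).1 hab
    replace hcd := (Submodule.quotientRel_def _).1 hcd
    refine (Submodule.quotientRel_def _).2 ?_
    have : a * c - b * d = a * (c - d) + (a - b) * d := by noncomm_ring
    rw [this]
    exact I.toSubmodule.add_mem (I.mul_mem_left' _ hcd) (I.mul_mem_right' _ hab)

instance : Star I.Quot where
  star := Quotient.map star fun a b hab => by
    replace hab := (Submodule.quotientRel_def _).1 hab
    refine (Submodule.quotientRel_def _).2 ?_
    rw [← star_sub]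
    exact I.star_mem' hab

theorem mkₗ_mul (x y : M) : I.mkₗ (x * y) = I.mkₗ x * I.mkₗ y := rfl
theorem mkₗ_star (x : M) : I.mkₗ (star x) = star (I.mkₗ x) := rfl

instance : NonUnitalRing I.Quot where
  __ := (inferInstance : AddCommGroup I.Quot)
  left_distrib a b c := by
    obtain ⟨a, rfl⟩ := I.mkₗ_surjective a
    obtain ⟨b, rfl⟩ := I.mkₗ_surjective b
    obtain ⟨c, rfl⟩ := I.mkₗ_surjective c
    simp only [← mkₗ_mul, ← map_add, mul_add]
  right_distrib a b c := by
    obtain ⟨a, rfl⟩ := I.mkₗ_surjective a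
    obtain ⟨b, rfl⟩ := I.mkₗ_surjective b
    obtain ⟨c, rfl⟩ := I.mkₗ_surjective c
    simp only [← mkₗ_mul, ← map_add, add_mul]
  zero_mul a := by
    obtain ⟨a, rfl⟩ := I.mkₗ_surjective a
    rw [← map_zero I.mkₗ, ← mkₗ_mul, zero_mul]
  mul_zero a := by
    obtain ⟨a, rfl⟩ := I.mkₗ_surjective a
    rw [← map_zero I.mkₗ, ← mkₗ_mul, mul_zero]
  mul_assoc a b c := by
    obtain ⟨a, rfl⟩ := I.mkₗ_surjective a
    obtain ⟨b, rfl⟩ := I.mkₗ_surjective b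
    obtain ⟨c, rfl⟩ := I.mkₗ_surjective c
    simp only [← mkₗ_mul, mul_assoc]

instance : StarRing I.Quot where
  star_involutive a := by
    obtain ⟨a, rfl⟩ := I.mkₗ_surjective a
    simp only [← mkₗ_star, star_star]
  star_mul a b := by
    obtain ⟨a, rfl⟩ := I.mkₗ_surjective a
    obtain ⟨b, rfl⟩ := I.mkₗ_surjective b
    simp only [← mkₗ_star, ← mkₗ_mul, star_mul]
  star_add a b := by
    obtain ⟨a, rfl⟩ := I.mkₗ_surjective a
    obtain ⟨b, rfl⟩ := I.mkₗ_surjective b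
    simp only [← mkₗ_star, ← map_add, star_add]

instance : NonUnitalNormedRing I.Quot where
  __ := (inferInstance : NormedAddCommGroup I.Quot)
  __ := (inferInstance : NonUnitalRing I.Quot)
  norm_mul_le a b := by
    refine le_of_forall_pos_le_add fun ε hε => ?_
    have hc : Tendsto (fun δ : ℝ => (‖a‖ + δ) * (‖b‖ + δ)) (𝓝[>] 0) (𝓝 (‖a‖ * ‖b‖)) := by
      have : Tendsto (fun δ : ℝ => (‖a‖ + δ) * (‖b‖ + δ)) (𝓝 0)
          (𝓝 ((‖a‖ + 0) * (‖b‖ + 0))) := Continuous.tendsto (by fun_prop) 0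
      simpa using this.mono_left nhdsWithin_le_nhds
    obtain ⟨δ, hδ, hδ0⟩ := ((hc.eventually (gt_mem_nhds (lt_add_of_pos_right _ hε))).and
      self_mem_nhdsWithin).exists
    obtain ⟨x, rfl, hx⟩ := I.exists_norm_lt a hδ0
    obtain ⟨y, rfl, hy⟩ := I.exists_norm_lt b hδ0
    rw [← mkₗ_mul]
    refine (I.norm_mkₗ_le _).trans ((norm_mul_le x y).trans ?_)
    refine le_trans ?_ hδ.le
    gcongr

instance : IsScalarTower ℂ I.Quot I.Quot where
  smul_assoc c a b := by
    obtain ⟨a, rfl⟩ := I.mkₗ_surjective a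
    obtain ⟨b, rfl⟩ := I.mkₗ_surjective b
    simp only [smul_eq_mul, ← map_smul, ← mkₗ_mul, smul_mul_assoc]

instance : SMulCommClass ℂ I.Quot I.Quot where
  smul_comm c a b := by
    obtain ⟨a, rfl⟩ := I.mkₗ_surjective a
    obtain ⟨b, rfl⟩ := I.mkₗ_surjective b
    simp only [smul_eq_mul, ← map_smul, ← mkₗ_mul, mul_smul_comm]

instance : StarModule ℂ I.Quot where
  star_smul c a := by
    obtain ⟨a, rfl⟩ := I.mkₗ_surjective a
    simp only [← map_smul, ← mkₗ_star, star_smul]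

/-- The ideal itself, as a (closed) star subalgebra. -/
def toStarSubalgebra : NonUnitalStarSubalgebra ℂ M where
  __ := I.toSubmodule
  mul_mem' _ hb := I.mul_mem_left' _ hb
  star_mem' h := I.star_mem' h

instance : IsClosed (I.toStarSubalgebra : Set M) := I.isClosed'

/-- Small cut-downs by positive contractions of the ideal compute the quotient norm. -/
theorem exists_approx {x : M} (hx : x ∈ I.toSubmodule) {ε : ℝ} (hε : 0 < ε) :
    ∃ e ∈ I.toSubmodule, IsSelfAdjoint e ∧ (∀ m : M, ‖m - m * e‖ ≤ ‖m‖) ∧ ‖x - x * e‖ < ε := by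
  let _ : PartialOrder I.toStarSubalgebra := CStarAlgebra.spectralOrder _
  have : StarOrderedRing I.toStarSubalgebra := CStarAlgebra.spectralOrderedRing _
  have hA := CStarAlgebra.increasingApproximateUnit I.toStarSubalgebra
  have h1 := hA.eventually_nonneg
  have h2 := hA.eventually_norm
  have h3 := (hA.tendsto_mul_left ⟨x, hx⟩).eventually (Metric.ball_mem_nhds _ hε)
  obtain ⟨e, he1, he2, he3⟩ := (h1.and (h2.and h3)).exists
  refine ⟨e, e.2, ?_, ?_, ?_⟩
  · exact congrArg Subtype.val (IsSelfAdjoint.of_nonneg he1).star_eq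
  · intro m
    let _ : PartialOrder M := CStarAlgebra.spectralOrder _
    have : StarOrderedRing M := CStarAlgebra.spectralOrderedRing _
    have hpos : 0 ≤ (e : M) := by
      obtain ⟨c, hc⟩ := CStarAlgebra.nonneg_iff_eq_star_mul_self.mp he1
      rw [hc]; exact star_mul_self_nonneg (c : M)
    have hnorm : ‖(e : M)‖ ≤ 1 := he2
    have hu : ‖(1 : Unitization ℂ M) - (e : M)‖ ≤ 1 := by
      have hle : ((e : M) : Unitization ℂ M) ≤ 1 := by
        rw [← CStarAlgebra.norm_le_one_iff_of_nonneg _ (by simpa using hpos)]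
        simpa [Unitization.norm_inr] using hnorm
      rw [CStarAlgebra.norm_le_one_iff_of_nonneg _ (sub_nonneg.2 hle)]
      simpa using hpos
    have : ‖((m - m * (e : M) : M) : Unitization ℂ M)‖ ≤ ‖(m : Unitization ℂ M)‖ := by
      have h : ((m - m * (e : M) : M) : Unitization ℂ M) = m * (1 - (e : M)) := by
        simp [mul_sub]
      rw [h]
      refine (norm_mul_le _ _).trans ?_
      exact mul_le_of_le_one_right (norm_nonneg _) hu
    rwa [Unitization.norm_inr, Unitization.norm_inr] at this
  · rw [norm_sub_rev, ← dist_eq_norm]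
    exact he3

instance : CStarRing I.Quot where
  norm_mul_self_le a := by
    obtain ⟨x, rfl⟩ := I.mkₗ_surjective a
    refine le_of_forall_pos_le_add fun ε hε => ?_
    rw [← mkₗ_star, ← mkₗ_mul]
    obtain ⟨y, hy, hyn⟩ := I.exists_norm_lt (I.mkₗ (star x * x)) (half_pos hε)
    have hi := (I.mkₗ_eq_iff).1 hy
    obtain ⟨e, heI, hes, hec, hei⟩ := I.exists_approx hi (half_pos hε)
    have e1 : I.mkₗ x = I.mkₗ (x - x * e) := by
      rw [I.mkₗ_eq_iff]
      simpa using I.mul_mem_left' x heI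
    have e2 : ∀ z : M, ‖z - e * z‖ ≤ ‖z‖ := fun z => by
      have := hec (star z)
      rw [← norm_star] at this
      simpa [hes.star_eq] using this
    calc ‖I.mkₗ x‖ * ‖I.mkₗ x‖ ≤ ‖x - x * e‖ * ‖x - x * e‖ := by
          rw [e1]; gcongr <;> exact I.norm_mkₗ_le _
      _ = ‖star (x - x * e) * (x - x * e)‖ := CStarRing.norm_star_mul_self.symm
      _ = ‖(y - y * e) - e * (y - y * e) -
            (((y - star x * x) - (y - star x * x) * e) -
              e * ((y - star x * x) - (y - star x * x) * e))‖ := by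
          congr 1
          simp only [star_sub, star_mul, hes.star_eq]
          noncomm_ring
      _ ≤ ‖y‖ + ε / 2 := by
          refine (norm_sub_le _ _).trans (add_le_add ((e2 _).trans (hec _)) ((e2 _).trans hei.le))
      _ ≤ ‖I.mkₗ (star x * x)‖ + ε := by linarith

instance : NonUnitalCStarAlgebra I.Quot where

/-- The quotient map, as a *-homomorphism. -/
def quotHom : M →⋆ₙₐ[ℂ] I.Quot where
  toFun := I.mkₗ
  map_smul' := I.mkₗ.map_smul
  map_zero' := I.mkₗ.map_zero
  map_add' := I.mkₗ.map_add
  map_mul' := I.mkₗ_mul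
  map_star' := I.mkₗ_star

end ClosedIdeal
end
end PureCStar

namespace PureCStar
noncomputable section

section FinMat

attribute [local instance 50] CStarAlgebra.spectralOrder CStarAlgebra.spectralOrderedRing

/-- The infinite matrices over `A` with only finitely many nonzero entries, as a subspace. -/
def finMatSubmodule (A : Type*) [AddCommGroup A] [Module ℂ A] : Submodule ℂ (ℕ → ℕ → A) where
  carrier := {X | ∃ n, ∀ i j, n ≤ i ∨ n ≤ j → X i j = 0}
  zero_mem' := ⟨0, fun _ _ _ => rfl⟩
  add_mem' := by
    rintro X Y ⟨n, hn⟩ ⟨m, hm⟩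
    refine ⟨max n m, fun i j h => ?_⟩
    simp only [max_le_iff] at h
    simp [hn i j (by tauto), hm i j (by tauto)]
  smul_mem' := by
    rintro c X ⟨n, hn⟩
    exact ⟨n, fun i j h => by simp [hn i j h]⟩

/-- `M_∞(A)`: the *-algebra of infinite matrices over `A` with finitely many nonzero entries,
that is, the union of the matrix algebras `M_n(A)` along the upper left corner embeddings. -/
def FinMat (A : Type*) [AddCommGroup A] [Module ℂ A] : Type _ := finMatSubmodule A

namespace FinMat

section Alg

variable {A : Type*} [NonUnitalCStarAlgebra A]

instance : AddCommGroup (FinMat A) := inferInstanceAs (AddCommGroup (finMatSubmodule A))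
instance : Module ℂ (FinMat A) := inferInstanceAs (Module ℂ (finMatSubmodule A))

/-- The entries of a matrix. -/
def entry (X : FinMat A) (i j : ℕ) : A := X.1 i j

@[ext] theorem ext {X Y : FinMat A} (h : ∀ i j, X.entry i j = Y.entry i j) : X = Y :=
  Subtype.ext (funext fun i => funext fun j => h i j)

@[simp] theorem entry_zero (i j : ℕ) : (0 : FinMat A).entry i j = 0 := rfl
@[simp] theorem entry_add (X Y : FinMat A) (i j : ℕ) :
    (X + Y).entry i j = X.entry i j + Y.entry i j := rfl
@[simp] theorem entry_smul (c : ℂ) (X : FinMat A) (i j : ℕ) :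
    (c • X).entry i j = c • X.entry i j := rfl

/-- `X` is supported in the upper left `n × n` corner. -/
def SuppIn (X : FinMat A) (n : ℕ) : Prop := ∀ i j, n ≤ i ∨ n ≤ j → X.entry i j = 0

theorem exists_suppIn (X : FinMat A) : ∃ n, X.SuppIn n := X.2

theorem SuppIn.mono {X : FinMat A} {n m : ℕ} (h : X.SuppIn n) (hnm : n ≤ m) : X.SuppIn m :=
  fun i j hij => h i j (by omega)

/-- A finitely supported matrix from a function. -/
def of (X : ℕ → ℕ → A) (h : ∃ n, ∀ i j, n ≤ i ∨ n ≤ j → X i j = 0) : FinMat A := ⟨X, h⟩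

@[simp] theorem entry_of (X : ℕ → ℕ → A) (h) (i j : ℕ) : (of X h).entry i j = X i j := rfl

/-- Matrix multiplication; the sum is finite. -/
instance : Mul (FinMat A) where
  mul X Y := of (fun i j => ∑ᶠ k, X.entry i k * Y.entry k j) (by
    obtain ⟨n, hn⟩ := X.exists_suppIn
    obtain ⟨m, hm⟩ := Y.exists_suppIn
    refine ⟨max n m, fun i j h => ?_⟩
    rw [max_le_iff, max_le_iff] at h
    refine finsum_eq_zero_of_forall_eq_zero fun k => ?_
    rcases h with h | h
    · rw [hn i k (Or.inl h.1), zero_mul]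
    · rw [hm k j (Or.inr h.2), mul_zero])

theorem entry_mul (X Y : FinMat A) (i j : ℕ) :
    (X * Y).entry i j = ∑ᶠ k, X.entry i k * Y.entry k j := rfl

theorem entry_mul_eq_sum {X : FinMat A} {n : ℕ} (hX : X.SuppIn n) (Y : FinMat A) (i j : ℕ) :
    (X * Y).entry i j = ∑ k ∈ Finset.range n, X.entry i k * Y.entry k j := by
  rw [entry_mul]
  refine finsum_eq_finsetSum_of_support_subset _ fun k hk => ?_
  by_contra h
  simp only [Finset.coe_range, Set.mem_Iio, not_lt] at h
  exact hk (by simp [hX i k (Or.inr h)])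

/-- Conjugate transpose. -/
instance : Star (FinMat A) where
  star X := of (fun i j => star (X.entry j i)) (by
    obtain ⟨n, hn⟩ := X.exists_suppIn
    exact ⟨n, fun i j h => by simp [hn j i h.symm]⟩)

@[simp] theorem entry_star (X : FinMat A) (i j : ℕ) :
    (star X).entry i j = star (X.entry j i) := rfl

/-- The upper left `n × n` corner. -/
def corner (n : ℕ) (X : FinMat A) : CStarMatrix (Fin n) (Fin n) A :=
  CStarMatrix.ofMatrix fun i j => X.entry i j

/-- Extending an `n × n` matrix by zero. -/
def incl (n : ℕ) (a : CStarMatrix (Fin n) (Fin n) A) : FinMat A :=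
  of (fun i j => if h : i < n ∧ j < n then a ⟨i, h.1⟩ ⟨j, h.2⟩ else 0)
    ⟨n, fun i j h => dif_neg (by omega)⟩

theorem entry_incl (n : ℕ) (a : CStarMatrix (Fin n) (Fin n) A) (i j : ℕ) :
    (incl n a).entry i j = if h : i < n ∧ j < n then a ⟨i, h.1⟩ ⟨j, h.2⟩ else 0 := rfl

theorem suppIn_incl (n : ℕ) (a : CStarMatrix (Fin n) (Fin n) A) : (incl n a).SuppIn n :=
  fun i j h => dif_neg (by omega)

@[simp] theorem corner_incl (n : ℕ) (a : CStarMatrix (Fin n) (Fin n) A) :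
    corner n (incl n a) = a := by
  ext i j
  change (if h : (i : ℕ) < n ∧ (j : ℕ) < n then a ⟨i, h.1⟩ ⟨j, h.2⟩ else 0) = a i j
  rw [dif_pos ⟨i.2, j.2⟩]

theorem incl_corner {n : ℕ} {X : FinMat A} (h : X.SuppIn n) : incl n (corner n X) = X := by
  ext i j
  rw [entry_incl]
  split_ifs with hij
  · rfl
  · exact (h i j (by omega)).symm

theorem incl_injective (n : ℕ) : Function.Injective (incl (A := A) n) :=
  Function.LeftInverse.injective (corner_incl n)

theorem incl_zero (n : ℕ) : incl n (0 : CStarMatrix (Fin n) (Fin n) A) = 0 := by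
  ext i j; simp [entry_incl]

theorem incl_add (n : ℕ) (a b : CStarMatrix (Fin n) (Fin n) A) :
    incl n (a + b) = incl n a + incl n b := by
  ext i j; simp only [entry_incl, entry_add]; split_ifs <;> simp

theorem incl_smul (n : ℕ) (c : ℂ) (a : CStarMatrix (Fin n) (Fin n) A) :
    incl n (c • a) = c • incl n a := by
  ext i j; simp only [entry_incl, entry_smul]; split_ifs <;> simp

theorem incl_star (n : ℕ) (a : CStarMatrix (Fin n) (Fin n) A) :
    incl n (star a) = star (incl n a) := by
  ext i j
  simp only [entry_incl, entry_star]
  by_cases h : i < n ∧ j < n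
  · rw [dif_pos h, dif_pos h.symm]; rfl
  · rw [dif_neg h, dif_neg (fun h' => h h'.symm), star_zero]

theorem incl_mul (n : ℕ) (a b : CStarMatrix (Fin n) (Fin n) A) :
    incl n (a * b) = incl n a * incl n b := by
  ext i j
  rw [entry_mul_eq_sum (suppIn_incl n a)]
  simp only [entry_incl]
  by_cases h : i < n ∧ j < n
  · rw [dif_pos h, CStarMatrix.mul_apply, Finset.sum_range]
    refine Finset.sum_congr rfl fun k _ => ?_
    rw [dif_pos ⟨h.1, k.2⟩, dif_pos ⟨k.2, h.2⟩]
  · rw [dif_neg h]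
    refine (Finset.sum_eq_zero fun k hk => ?_).symm
    by_cases hi : i < n
    · rw [dif_neg (c := k < n ∧ j < n) (by omega), mul_zero]
    · rw [dif_neg (by omega), zero_mul]

/-- Every element comes from a matrix of any sufficiently large size. -/
theorem exists_incl (X : FinMat A) : ∃ n, ∀ m, n ≤ m → ∃ a, X = incl m a := by
  obtain ⟨n, hn⟩ := X.exists_suppIn
  exact ⟨n, fun m hm => ⟨corner m X, (incl_corner (hn.mono hm)).symm⟩⟩

theorem exists_incl₁ (X : FinMat A) : ∃ n, ∃ a, X = incl n a := by
  obtain ⟨n, hn⟩ := X.exists_incl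
  exact ⟨n, hn n le_rfl⟩

theorem exists_incl₂ (X Y : FinMat A) : ∃ n, ∃ a b, X = incl n a ∧ Y = incl n b := by
  obtain ⟨n, hn⟩ := X.exists_incl
  obtain ⟨m, hm⟩ := Y.exists_incl
  obtain ⟨a, ha⟩ := hn (max n m) (le_max_left _ _)
  obtain ⟨b, hb⟩ := hm (max n m) (le_max_right _ _)
  exact ⟨_, a, b, ha, hb⟩

theorem exists_incl₃ (X Y Z : FinMat A) :
    ∃ n, ∃ a b c, X = incl n a ∧ Y = incl n b ∧ Z = incl n c := by
  obtain ⟨n, hn⟩ := X.exists_incl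
  obtain ⟨m, hm⟩ := Y.exists_incl
  obtain ⟨k, hk⟩ := Z.exists_incl
  obtain ⟨a, ha⟩ := hn (max n (max m k)) (by omega)
  obtain ⟨b, hb⟩ := hm (max n (max m k)) (by omega)
  obtain ⟨c, hc⟩ := hk (max n (max m k)) (by omega)
  exact ⟨_, a, b, c, ha, hb, hc⟩

instance : NonUnitalRing (FinMat A) where
  __ := (inferInstance : AddCommGroup (FinMat A))
  left_distrib X Y Z := by
    obtain ⟨n, a, b, c, rfl, rfl, rfl⟩ := exists_incl₃ X Y Z
    simp only [← incl_mul, ← incl_add, mul_add]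
  right_distrib X Y Z := by
    obtain ⟨n, a, b, c, rfl, rfl, rfl⟩ := exists_incl₃ X Y Z
    simp only [← incl_mul, ← incl_add, add_mul]
  zero_mul X := by ext i j; simp [entry_mul]
  mul_zero X := by ext i j; simp [entry_mul]
  mul_assoc X Y Z := by
    obtain ⟨n, a, b, c, rfl, rfl, rfl⟩ := exists_incl₃ X Y Z
    simp only [← incl_mul, mul_assoc]

instance : StarRing (FinMat A) where
  star_involutive X := by ext i j; simp
  star_add X Y := by ext i j; simp
  star_mul X Y := by
    obtain ⟨n, a, b, rfl, rfl⟩ := exists_incl₂ X Y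
    simp only [← incl_mul, ← incl_star, star_mul]

instance : StarModule ℂ (FinMat A) where
  star_smul c X := by ext i j; simp

instance : IsScalarTower ℂ (FinMat A) (FinMat A) where
  smul_assoc c X Y := by
    obtain ⟨n, a, b, rfl, rfl⟩ := exists_incl₂ X Y
    simp only [smul_eq_mul, ← incl_smul, ← incl_mul, CStarMatrix.smul_mul]

instance : SMulCommClass ℂ (FinMat A) (FinMat A) where
  smul_comm c X Y := by
    obtain ⟨n, a, b, rfl, rfl⟩ := exists_incl₂ X Y
    simp only [smul_eq_mul, ← incl_smul, ← incl_mul, CStarMatrix.mul_smul]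

/-- The corner embedding `M_n(A) → M_∞(A)`, as a *-homomorphism. -/
def inclHom (n : ℕ) : CStarMatrix (Fin n) (Fin n) A →⋆ₙₐ[ℂ] FinMat A where
  toFun := incl n
  map_smul' := incl_smul n
  map_zero' := incl_zero n
  map_add' := incl_add n
  map_mul' := incl_mul n
  map_star' := incl_star n

/-- The corner embedding `M_n(A) → M_m(A)` for `n ≤ m`. -/
def pad {n m : ℕ} (h : n ≤ m) :
    CStarMatrix (Fin n) (Fin n) A →⋆ₙₐ[ℂ] CStarMatrix (Fin m) (Fin m) A where
  toFun a := corner m (incl n a)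
  map_smul' c a := by rw [incl_smul]; rfl
  map_zero' := by rw [incl_zero]; rfl
  map_add' a b := by rw [incl_add]; rfl
  map_mul' a b := by
    apply incl_injective m
    simp only [incl_mul, incl_corner ((suppIn_incl n _).mono h)]
    rw [← incl_mul, incl_corner ((suppIn_incl n _).mono h)]
  map_star' a := by
    apply incl_injective m
    simp only [incl_star, incl_corner ((suppIn_incl n _).mono h)]
    rw [← incl_star, incl_corner ((suppIn_incl n _).mono h)]

theorem incl_pad {n m : ℕ} (h : n ≤ m) (a : CStarMatrix (Fin n) (Fin n) A) :
    incl m (pad h a) = incl n a := incl_corner ((suppIn_incl n _).mono h)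

theorem norm_pad {n m : ℕ} (h : n ≤ m) (a : CStarMatrix (Fin n) (Fin n) A) :
    ‖pad h a‖ = ‖a‖ := by
  refine NonUnitalStarAlgHom.norm_map _ (fun b c hbc => ?_) a
  apply incl_injective n
  rw [← incl_pad h, hbc, incl_pad]

/-- The C*-norm on `M_∞(A)`: the norm of `M_n(A)` for any `n` such that the matrix is supported
in the upper left `n × n` corner (see `norm_incl`). -/
instance : Norm (FinMat A) where
  norm X := ‖corner X.exists_suppIn.choose X‖

theorem norm_eq {X : FinMat A} {n : ℕ} (h : X.SuppIn n) : ‖X‖ = ‖corner n X‖ := by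
  have key : ∀ {p q : ℕ}, X.SuppIn p → p ≤ q → ‖corner q X‖ = ‖corner p X‖ := by
    intro p q hp hpq
    rw [← norm_pad hpq (corner p X)]
    congr 1
    apply incl_injective q
    rw [incl_pad, incl_corner hp, incl_corner (hp.mono hpq)]
  change ‖corner X.exists_suppIn.choose X‖ = _
  rcases le_total X.exists_suppIn.choose n with hn | hn
  · exact (key X.exists_suppIn.choose_spec hn).symm
  · exact key h hn

theorem norm_incl (n : ℕ) (a : CStarMatrix (Fin n) (Fin n) A) : ‖incl n a‖ = ‖a‖ := by
  rw [norm_eq (suppIn_incl n a), corner_incl]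

theorem normCore : NormedSpace.Core ℂ (FinMat A) where
  norm_nonneg X := norm_nonneg (corner X.exists_suppIn.choose X)
  norm_smul c X := by
    obtain ⟨n, a, rfl⟩ := exists_incl₁ X
    rw [← incl_smul, norm_incl, norm_incl, norm_smul]
  norm_triangle X Y := by
    obtain ⟨n, a, b, rfl, rfl⟩ := exists_incl₂ X Y
    rw [← incl_add, norm_incl, norm_incl, norm_incl]
    exact norm_add_le a b
  norm_eq_zero_iff X := by
    obtain ⟨n, a, rfl⟩ := exists_incl₁ X
    rw [norm_incl, norm_eq_zero, ← incl_zero n, (incl_injective n).eq_iff]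

instance : NormedAddCommGroup (FinMat A) := NormedAddCommGroup.ofCore normCore
instance : NormedSpace ℂ (FinMat A) := NormedSpace.ofCore normCore

instance : NonUnitalNormedRing (FinMat A) where
  __ := (inferInstance : NormedAddCommGroup (FinMat A))
  __ := (inferInstance : NonUnitalRing (FinMat A))
  norm_mul_le X Y := by
    obtain ⟨n, a, b, rfl, rfl⟩ := exists_incl₂ X Y
    rw [← incl_mul, norm_incl, norm_incl, norm_incl]
    exact norm_mul_le a b

instance : CStarRing (FinMat A) where
  norm_mul_self_le X := by
    obtain ⟨n, a, rfl⟩ := exists_incl₁ X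
    rw [← incl_star, ← incl_mul, norm_incl, norm_incl]
    exact CStarRing.norm_mul_self_le a

/-- Every *-homomorphism from `M_∞(A)` to a C*-algebra is contractive. -/
theorem norm_hom_le {C : Type*} [NonUnitalCStarAlgebra C] (Φ : FinMat A →⋆ₙₐ[ℂ] C)
    (X : FinMat A) : ‖Φ X‖ ≤ ‖X‖ := by
  obtain ⟨n, a, rfl⟩ := exists_incl₁ X
  rw [norm_incl]
  exact NonUnitalStarAlgHom.norm_apply_le (Φ.comp (inclHom n)) a

end Alg

end FinMat
end FinMat

open UniformSpace in
/-- The stabilization `A ⊗ K` of a C*-algebra `A`: the completion of `M_∞(A)` in its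
C*-norm. -/
def Stab (A : Type*) [NonUnitalCStarAlgebra A] : Type _ := Completion (FinMat A)

namespace Stab
open UniformSpace

variable {A : Type*} [NonUnitalCStarAlgebra A]

instance : NormedAddCommGroup (Stab A) := inferInstanceAs (NormedAddCommGroup (Completion (FinMat A)))
instance : NormedSpace ℂ (Stab A) := inferInstanceAs (NormedSpace ℂ (Completion (FinMat A)))
instance : CompleteSpace (Stab A) := inferInstanceAs (CompleteSpace (Completion (FinMat A)))

theorem continuous_smul_const (c : ℂ) : Continuous fun x : Stab A => c • x :=
  continuous_const_smul c

/-- The inclusion of `M_∞(A)`, as a linear map. -/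
def coeₗ : FinMat A →ₗᵢ[ℂ] Stab A := Completion.toComplₗᵢ

theorem isDenseInducing_coeₗ : IsDenseInducing (coeₗ : FinMat A → Stab A) :=
  Completion.isDenseInducing_coe

theorem denseRange_coeₗ : DenseRange (coeₗ : FinMat A → Stab A) := isDenseInducing_coeₗ.dense

theorem induction₁ {p : Stab A → Prop} (x : Stab A) (hp : IsClosed {x | p x})
    (h : ∀ X, p (coeₗ X)) : p x := Completion.induction_on x hp h

theorem induction₂ {p : Stab A → Stab A → Prop} (x y : Stab A)
    (hp : IsClosed {x : Stab A × Stab A | p x.1 x.2})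
    (h : ∀ X Y, p (coeₗ X) (coeₗ Y)) : p x y := Completion.induction_on₂ x y hp h

theorem induction₃ {p : Stab A → Stab A → Stab A → Prop} (x y z : Stab A)
    (hp : IsClosed {x : Stab A × Stab A × Stab A | p x.1 x.2.1 x.2.2})
    (h : ∀ X Y Z, p (coeₗ X) (coeₗ Y) (coeₗ Z)) : p x y z :=
  Completion.induction_on₃ x y z hp h

/-- The multiplication of `A ⊗ K`, extended by continuity from `M_∞(A)`. -/
instance : Mul (Stab A) where
  mul x y := (isDenseInducing_coeₗ.prodMap isDenseInducing_coeₗ).extend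
    (fun p : FinMat A × FinMat A => coeₗ (p.1 * p.2)) (x, y)

theorem coeₗ_mul (X Y : FinMat A) : (coeₗ (X * Y) : Stab A) = coeₗ X * coeₗ Y :=
  ((isDenseInducing_coeₗ.prodMap isDenseInducing_coeₗ).extend_eq
    (f := fun p : FinMat A × FinMat A => (coeₗ (p.1 * p.2) : Stab A))
    (coeₗ.continuous.comp continuous_mul) (X, Y)).symm

instance : ContinuousMul (Stab A) where
  continuous_mul := by
    let m : FinMat A →+ FinMat A →+ Stab A :=
      (AddMonoidHom.mul : FinMat A →+ FinMat A →+ FinMat A).compr₂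
        (coeₗ (A := A)).toLinearMap.toAddMonoidHom
    have hm : Continuous fun p : FinMat A × FinMat A => m p.1 p.2 :=
      coeₗ.continuous.comp continuous_mul
    have di : IsDenseInducing ((coeₗ (A := A)).toLinearMap.toAddMonoidHom) :=
      isDenseInducing_coeₗ
    exact (di.extend_Z_bilin di hm :)

/-- The involution of `A ⊗ K`, extended by continuity from `M_∞(A)`. -/
instance : Star (Stab A) where
  star := Completion.map star

theorem coeₗ_star (X : FinMat A) : (coeₗ (star X) : Stab A) = star (coeₗ X) :=
  (Completion.map_coe (starAddEquiv (R := FinMat A) |>.toAddMonoidHom.uniformContinuous_of_continuousAt_zero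
    (continuous_star.continuousAt)) X).symm

instance : ContinuousStar (Stab A) where
  continuous_star := Completion.continuous_map

instance : NonUnitalNormedRing (Stab A) where
  __ := (inferInstance : NormedAddCommGroup (Stab A))
  left_distrib x y z := by
    induction x, y, z using induction₃ with
    | hp => exact isClosed_eq (by fun_prop) (by fun_prop)
    | h X Y Z =>
      simp only [← coeₗ_mul, ← map_add, mul_add]
  right_distrib x y z := by
    induction x, y, z using induction₃ with
    | hp => exact isClosed_eq (by fun_prop) (by fun_prop)
    | h X Y Z =>
      simp only [← coeₗ_mul, ← map_add, add_mul]
  zero_mul x := by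
    induction x using induction₁ with
    | hp => exact isClosed_eq (by fun_prop) (by fun_prop)
    | h X =>
      rw [← map_zero coeₗ, ← coeₗ_mul, zero_mul]
  mul_zero x := by
    induction x using induction₁ with
    | hp => exact isClosed_eq (by fun_prop) (by fun_prop)
    | h X =>
      rw [← map_zero coeₗ, ← coeₗ_mul, mul_zero]
  mul_assoc x y z := by
    induction x, y, z using induction₃ with
    | hp => exact isClosed_eq (by fun_prop) (by fun_prop)
    | h X Y Z =>
      simp only [← coeₗ_mul, mul_assoc]
  norm_mul_le x y := by
    induction x, y using induction₂ with
    | hp => exact isClosed_le (by fun_prop) (by fun_prop)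
    | h X Y =>
      simp only [← coeₗ_mul, LinearIsometry.norm_map]
      exact norm_mul_le X Y

instance : StarRing (Stab A) where
  star_involutive x := by
    induction x using induction₁ with
    | hp => exact isClosed_eq (by fun_prop) (by fun_prop)
    | h X =>
      simp only [← coeₗ_star, star_star]
  star_mul x y := by
    induction x, y using induction₂ with
    | hp => exact isClosed_eq (by fun_prop) (by fun_prop)
    | h X Y =>
      simp only [← coeₗ_star, ← coeₗ_mul, star_mul]
  star_add x y := by
    induction x, y using induction₂ with
    | hp => exact isClosed_eq (by fun_prop) (by fun_prop)
    | h X Y =>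
      simp only [← coeₗ_star, ← map_add, star_add]

instance : CStarRing (Stab A) where
  norm_mul_self_le x := by
    induction x using induction₁ with
    | hp => exact isClosed_le (by fun_prop) (by fun_prop)
    | h X =>
      simp only [← coeₗ_star, ← coeₗ_mul, LinearIsometry.norm_map]
      exact CStarRing.norm_mul_self_le X

instance : IsScalarTower ℂ (Stab A) (Stab A) where
  smul_assoc c x y := by
    simp only [smul_eq_mul]
    induction x, y using induction₂ with
    | hp =>
      exact isClosed_eq (((continuous_smul_const (A := A) c).comp continuous_fst).mul continuous_snd)
        ((continuous_smul_const (A := A) c).comp continuous_mul)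
    | h X Y =>
      simp only [← coeₗ_mul, ← map_smul, smul_mul_assoc]

instance : SMulCommClass ℂ (Stab A) (Stab A) where
  smul_comm c x y := by
    simp only [smul_eq_mul]
    induction x, y using induction₂ with
    | hp =>
      exact isClosed_eq ((continuous_smul_const (A := A) c).comp continuous_mul)
        (continuous_fst.mul ((continuous_smul_const (A := A) c).comp continuous_snd))
    | h X Y =>
      simp only [← coeₗ_mul, ← map_smul, mul_smul_comm]

instance : StarModule ℂ (Stab A) where
  star_smul c x := by
    induction x using induction₁ with
    | hp =>
      exact isClosed_eq (continuous_star.comp (continuous_smul_const (A := A) c))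
        ((continuous_smul_const (A := A) _).comp continuous_star)
    | h X =>
      simp only [← coeₗ_star, ← map_smul, star_smul]

instance : NonUnitalCStarAlgebra (Stab A) where

/-- The inclusion of `M_∞(A)` into `A ⊗ K`, as a *-homomorphism. -/
def coeHom : FinMat A →⋆ₙₐ[ℂ] Stab A where
  toFun := coeₗ
  map_smul' := coeₗ.map_smul
  map_zero' := coeₗ.map_zero
  map_add' := coeₗ.map_add
  map_mul' := coeₗ_mul
  map_star' := coeₗ_star

theorem uniformContinuous_hom {C : Type*} [NonUnitalCStarAlgebra C] (Φ : FinMat A →⋆ₙₐ[ℂ] C) :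
    UniformContinuous Φ :=
  (AddMonoidHomClass.lipschitz_of_bound Φ 1
    (fun X => by simpa using FinMat.norm_hom_le Φ X)).uniformContinuous

/-- The underlying function of `lift`. -/
def liftFun {C : Type*} [NonUnitalCStarAlgebra C] (Φ : FinMat A →⋆ₙₐ[ℂ] C) : Stab A → C :=
  Completion.extension Φ

@[fun_prop]
theorem continuous_liftFun {C : Type*} [NonUnitalCStarAlgebra C] (Φ : FinMat A →⋆ₙₐ[ℂ] C) :
    Continuous (liftFun Φ) := Completion.continuous_extension

theorem liftFun_coeₗ {C : Type*} [NonUnitalCStarAlgebra C] (Φ : FinMat A →⋆ₙₐ[ℂ] C)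
    (X : FinMat A) : liftFun Φ (coeₗ X) = Φ X :=
  Completion.extension_coe (uniformContinuous_hom Φ) X

/-- The unique extension to `A ⊗ K` of a *-homomorphism from `M_∞(A)` to a C*-algebra. -/
def lift {C : Type*} [NonUnitalCStarAlgebra C] (Φ : FinMat A →⋆ₙₐ[ℂ] C) : Stab A →⋆ₙₐ[ℂ] C where
  toFun := liftFun Φ
  map_smul' c x := by
    induction x using induction₁ with
    | hp =>
      exact isClosed_eq ((continuous_liftFun Φ).comp (continuous_smul_const (A := A) c))
        ((continuous_const_smul c).comp (continuous_liftFun Φ))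
    | h X => rw [← map_smul, liftFun_coeₗ, liftFun_coeₗ, map_smul]; rfl
  map_zero' := by rw [← map_zero coeₗ, liftFun_coeₗ, map_zero]
  map_add' x y := by
    induction x, y using induction₂ with
    | hp => exact isClosed_eq (by fun_prop) (by fun_prop)
    | h X Y => rw [← map_add, liftFun_coeₗ, liftFun_coeₗ, liftFun_coeₗ, map_add]
  map_mul' x y := by
    induction x, y using induction₂ with
    | hp => exact isClosed_eq (by fun_prop) (by fun_prop)
    | h X Y => rw [← coeₗ_mul, liftFun_coeₗ, liftFun_coeₗ, liftFun_coeₗ, map_mul]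
  map_star' x := by
    induction x using induction₁ with
    | hp => exact isClosed_eq (by fun_prop) (by fun_prop)
    | h X => rw [← coeₗ_star, liftFun_coeₗ, liftFun_coeₗ, map_star]

theorem lift_coeₗ {C : Type*} [NonUnitalCStarAlgebra C] (Φ : FinMat A →⋆ₙₐ[ℂ] C)
    (X : FinMat A) : lift Φ (coeₗ X) = Φ X := liftFun_coeₗ Φ X

@[fun_prop]
theorem continuous_lift {C : Type*} [NonUnitalCStarAlgebra C] (Φ : FinMat A →⋆ₙₐ[ℂ] C) :
    Continuous (lift Φ) := continuous_liftFun Φ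

end Stab

end
end PureCStar

namespace PureCStar
noncomputable section

section Cuntz

variable {M : Type*} [NonUnitalCStarAlgebra M]

/-- Positive elements of a C*-algebra. -/
def IsPos (a : M) : Prop := ∃ c : M, a = star c * c

theorem isPos_zero : IsPos (0 : M) := ⟨0, by simp⟩

theorem IsPos.map {N : Type*} [NonUnitalCStarAlgebra N] (φ : M →⋆ₙₐ[ℂ] N) {a : M}
    (ha : IsPos a) : IsPos (φ a) := by
  obtain ⟨c, rfl⟩ := ha
  exact ⟨φ c, by rw [map_mul, map_star]⟩

/-- Cuntz subequivalence `a ≾ b`: `a = lim rₙ b rₙ*` for some sequence `(rₙ)`. -/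
def CuntzLE (a b : M) : Prop :=
  ∃ r : ℕ → M, Tendsto (fun n => r n * b * star (r n)) atTop (𝓝 a)

theorem cuntzLE_iff {a b : M} :
    CuntzLE a b ↔ ∀ ε : ℝ, 0 < ε → ∃ r : M, ‖r * b * star r - a‖ < ε := by
  constructor
  · rintro ⟨r, hr⟩ ε hε
    obtain ⟨n, hn⟩ := (hr.eventually (Metric.ball_mem_nhds a hε)).exists
    exact ⟨r n, by rwa [← dist_eq_norm]⟩
  · intro h
    choose r hr using fun n : ℕ => h (1 / ((n : ℝ) + 1)) Nat.one_div_pos_of_nat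
    refine ⟨r, tendsto_iff_norm_sub_tendsto_zero.2 ?_⟩
    exact squeeze_zero (fun _ => norm_nonneg _) (fun n => (hr n).le)
      tendsto_one_div_add_atTop_nhds_zero_nat

theorem CuntzLE.refl (a : M) : CuntzLE a a := by
  rw [cuntzLE_iff]
  intro ε hε
  let _ : PartialOrder M := CStarAlgebra.spectralOrder _
  have : StarOrderedRing M := CStarAlgebra.spectralOrderedRing _
  have hA := CStarAlgebra.increasingApproximateUnit M
  have h1 := (hA.tendsto_mul_left a).eventually (Metric.ball_mem_nhds _ (half_pos hε))
  have h2 := (hA.tendsto_mul_right a).eventually (Metric.ball_mem_nhds _ (half_pos hε))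
  obtain ⟨e, he1, he2, he3, he4⟩ :=
    (hA.eventually_norm.and (hA.eventually_star_eq.and (h1.and h2))).exists
  refine ⟨e, ?_⟩
  rw [dist_eq_norm] at he3 he4
  have key : ∀ x : M, x * a * x - a = x * (a * x - a) + (x * a - a) := fun x => by
    noncomm_ring
  rw [he2, key e]
  have h5 : ‖e * (a * e - a)‖ ≤ ‖a * e - a‖ := by
    refine (norm_mul_le _ _).trans ?_
    exact mul_le_of_le_one_left (norm_nonneg _) he1
  have h6 := norm_add_le (e * (a * e - a)) (e * a - a)
  linarith

theorem CuntzLE.trans {a b c : M} (hab : CuntzLE a b) (hbc : CuntzLE b c) : CuntzLE a c := by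
  rw [cuntzLE_iff] at *
  intro ε hε
  obtain ⟨r, hr⟩ := hab (ε / 2) (half_pos hε)
  have hK : 0 < ‖r‖ * ‖r‖ + 1 := by positivity
  obtain ⟨s, hs⟩ := hbc (ε / 2 / (‖r‖ * ‖r‖ + 1)) (div_pos (half_pos hε) hK)
  refine ⟨r * s, ?_⟩
  have key : r * s * c * star (r * s) - a =
      r * (s * c * star s - b) * star r + (r * b * star r - a) := by
    rw [star_mul]; noncomm_ring
  have h1 : ‖r * (s * c * star s - b) * star r‖ ≤ ε / 2 := by
    calc ‖r * (s * c * star s - b) * star r‖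
        ≤ ‖r‖ * ‖s * c * star s - b‖ * ‖star r‖ :=
          (norm_mul_le _ _).trans (by gcongr; exact norm_mul_le _ _)
      _ = ‖s * c * star s - b‖ * (‖r‖ * ‖r‖) := by rw [norm_star]; ring
      _ ≤ (ε / 2 / (‖r‖ * ‖r‖ + 1)) * (‖r‖ * ‖r‖ + 1) := by
          gcongr; linarith
      _ = ε / 2 := div_mul_cancel₀ _ hK.ne'
  rw [key]
  have h2 := norm_add_le (r * (s * c * star s - b) * star r) (r * b * star r - a)
  linarith

end Cuntz

namespace FinMat

variable {A : Type*} [NonUnitalCStarAlgebra A]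

/-- Move the entry `(i, j)` to the position `(f i, g j)`. -/
def relabel₂ (f g : ℕ ↪ ℕ) (X : FinMat A) : FinMat A :=
  of (Function.extend f (fun i => Function.extend g (X.entry i) 0) 0) (by
    obtain ⟨n, hn⟩ := X.exists_suppIn
    refine ⟨(∑ k ∈ Finset.range n, (f k + 1)) + ∑ k ∈ Finset.range n, (g k + 1), ?_⟩
    intro i j hij
    by_cases hi : ∃ i', f i' = i
    · obtain ⟨i', rfl⟩ := hi
      rw [f.injective.extend_apply]
      by_cases hj : ∃ j', g j' = j
      · obtain ⟨j', rfl⟩ := hj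
        rw [g.injective.extend_apply]
        apply hn
        by_contra hlt
        push Not at hlt
        have h1 : f i' + 1 ≤ ∑ k ∈ Finset.range n, (f k + 1) := Finset.single_le_sum (f := fun k => f k + 1) (fun _ _ => Nat.zero_le _)
          (Finset.mem_range.2 hlt.1)
        have h2 : g j' + 1 ≤ ∑ k ∈ Finset.range n, (g k + 1) := Finset.single_le_sum (f := fun k => g k + 1) (fun _ _ => Nat.zero_le _)
          (Finset.mem_range.2 hlt.2)
        omega
      · rw [Function.extend_apply' _ _ _ hj]; rfl
    · rw [Function.extend_apply' _ _ _ hi]; rfl)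

theorem entry_relabel₂ (f g : ℕ ↪ ℕ) (X : FinMat A) (i j : ℕ) :
    (relabel₂ f g X).entry (f i) (g j) = X.entry i j := by
  change Function.extend f (fun i => Function.extend g (X.entry i) 0) 0 (f i) (g j) = _
  rw [f.injective.extend_apply, g.injective.extend_apply]

theorem entry_relabel₂_left (f g : ℕ ↪ ℕ) (X : FinMat A) {i : ℕ} (hi : ¬ ∃ i', f i' = i)
    (j : ℕ) : (relabel₂ f g X).entry i j = 0 := by
  change Function.extend f (fun i => Function.extend g (X.entry i) 0) 0 i j = _
  rw [Function.extend_apply' _ _ _ hi]; rfl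

theorem entry_relabel₂_right (f g : ℕ ↪ ℕ) (X : FinMat A) (i : ℕ) {j : ℕ}
    (hj : ¬ ∃ j', g j' = j) : (relabel₂ f g X).entry i j = 0 := by
  by_cases hi : ∃ i', f i' = i
  · obtain ⟨i', rfl⟩ := hi
    change Function.extend f (fun i => Function.extend g (X.entry i) 0) 0 (f i') j = _
    rw [f.injective.extend_apply, Function.extend_apply' _ _ _ hj]; rfl
  · exact entry_relabel₂_left f g X hi j

/-- A matrix with the right entries is the relabelled one. -/
theorem eq_relabel₂ (f g : ℕ ↪ ℕ) {X Y : FinMat A}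
    (h : ∀ i j, Y.entry (f i) (g j) = X.entry i j)
    (hl : ∀ i j, (¬ ∃ i', f i' = i) → Y.entry i j = 0)
    (hr : ∀ i j, (¬ ∃ j', g j' = j) → Y.entry i j = 0) : Y = relabel₂ f g X := by
  ext i j
  by_cases hi : ∃ i', f i' = i
  · by_cases hj : ∃ j', g j' = j
    · obtain ⟨i', rfl⟩ := hi
      obtain ⟨j', rfl⟩ := hj
      rw [h, entry_relabel₂]
    · rw [hr i j hj, entry_relabel₂_right f g X i hj]
  · rw [hl i j hi, entry_relabel₂_left f g X hi]

theorem relabel₂_add (f g : ℕ ↪ ℕ) (X Y : FinMat A) :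
    relabel₂ f g (X + Y) = relabel₂ f g X + relabel₂ f g Y := by
  symm
  apply eq_relabel₂
  · intro i j; simp [entry_relabel₂]
  · intro i j h; simp [entry_relabel₂_left f g _ h]
  · intro i j h; simp [entry_relabel₂_right f g _ _ h]

theorem relabel₂_smul (f g : ℕ ↪ ℕ) (c : ℂ) (X : FinMat A) :
    relabel₂ f g (c • X) = c • relabel₂ f g X := by
  symm
  apply eq_relabel₂
  · intro i j; simp [entry_relabel₂]
  · intro i j h; simp [entry_relabel₂_left f g _ h]
  · intro i j h; simp [entry_relabel₂_right f g _ _ h]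

theorem relabel₂_zero (f g : ℕ ↪ ℕ) : relabel₂ f g (0 : FinMat A) = 0 :=
  (eq_relabel₂ f g (fun _ _ => rfl) (fun _ _ _ => rfl) (fun _ _ _ => rfl)).symm

theorem relabel₂_star (f g : ℕ ↪ ℕ) (X : FinMat A) :
    relabel₂ g f (star X) = star (relabel₂ f g X) := by
  symm
  apply eq_relabel₂
  · intro i j; simp [entry_relabel₂]
  · intro i j h; simp [entry_relabel₂_right f g _ _ h]
  · intro i j h; simp [entry_relabel₂_left f g _ h]

theorem relabel₂_mul (f g h : ℕ ↪ ℕ) (X Y : FinMat A) :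
    relabel₂ f h (X * Y) = relabel₂ f g X * relabel₂ g h Y := by
  symm
  apply eq_relabel₂
  · intro i j
    rw [entry_mul, entry_mul]
    have : ∀ k, (relabel₂ f g X).entry (f i) k * (relabel₂ g h Y).entry k (h j) ≠ 0 →
        k ∈ Set.range g := fun k hk => by
      by_contra hk'
      exact hk (by rw [entry_relabel₂_left g h Y hk', mul_zero])
    rw [← finsum_mem_univ, finsum_mem_inter_support_eq _ Set.univ (Set.range g) (by
      ext k
      simp only [Set.univ_inter, Set.mem_inter_iff, Function.mem_support]
      exact ⟨fun hk => ⟨this k hk, hk⟩, fun hk => hk.2⟩), finsum_mem_range g.injective]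
    simp only [entry_relabel₂]
  · intro i j hi
    rw [entry_mul]
    exact finsum_eq_zero_of_forall_eq_zero fun k => by
      rw [entry_relabel₂_left f g X hi, zero_mul]
  · intro i j hj
    rw [entry_mul]
    exact finsum_eq_zero_of_forall_eq_zero fun k => by
      rw [entry_relabel₂_right g h Y k hj, mul_zero]

theorem relabel₂_mul_eq_zero (f g g' h : ℕ ↪ ℕ) (hg : ∀ i j, g i ≠ g' j) (X Y : FinMat A) :
    relabel₂ f g X * relabel₂ g' h Y = 0 := by
  ext i j
  rw [entry_mul]
  refine finsum_eq_zero_of_forall_eq_zero fun k => ?_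
  by_cases hk : ∃ k', g k' = k
  · obtain ⟨k', rfl⟩ := hk
    rw [entry_relabel₂_left g' h Y (by rintro ⟨l, hl⟩; exact hg k' l hl.symm), mul_zero]
  · rw [entry_relabel₂_right f g X i hk, zero_mul]

/-- Relabelling rows and columns along an injection `ℕ → ℕ`, as a *-homomorphism. -/
def relabel (f : ℕ ↪ ℕ) : FinMat A →⋆ₙₐ[ℂ] FinMat A where
  toFun := relabel₂ f f
  map_smul' := relabel₂_smul f f
  map_zero' := relabel₂_zero f f
  map_add' := relabel₂_add f f
  map_mul' := relabel₂_mul f f f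
  map_star' := relabel₂_star f f

/-- Entrywise application of a *-homomorphism. -/
def map {B : Type*} [NonUnitalCStarAlgebra B] (θ : A →⋆ₙₐ[ℂ] B) : FinMat A →⋆ₙₐ[ℂ] FinMat B where
  toFun X := of (fun i j => θ (X.entry i j)) (by
    obtain ⟨n, hn⟩ := X.exists_suppIn
    exact ⟨n, fun i j h => by rw [hn i j h, map_zero]⟩)
  map_smul' c X := by ext i j; simp
  map_zero' := by ext i j; simp
  map_add' X Y := by ext i j; simp
  map_mul' X Y := by
    obtain ⟨n, hn⟩ := X.exists_suppIn
    ext i j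
    rw [entry_mul_eq_sum (n := n) (fun i j h => by simp [hn i j h])]
    simp [entry_mul_eq_sum hn]
  map_star' X := by ext i j; simp [map_star]

end FinMat

namespace Stab

variable {A : Type*} [NonUnitalCStarAlgebra A]

/-- `θ ⊗ id : A ⊗ K → B ⊗ K` for a *-homomorphism `θ : A → B`. -/
def map {B : Type*} [NonUnitalCStarAlgebra B] (θ : A →⋆ₙₐ[ℂ] B) : Stab A →⋆ₙₐ[ℂ] Stab B :=
  lift (coeHom.comp (FinMat.map θ))

/-- The endomorphism of `A ⊗ K` that moves the entry `(i, j)` to the position `(f i, f j)`. -/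
def relabel (f : ℕ ↪ ℕ) : Stab A →⋆ₙₐ[ℂ] Stab A := lift (coeHom.comp (FinMat.relabel f))

theorem relabel_coeₗ (f : ℕ ↪ ℕ) (X : FinMat A) :
    relabel f (coeₗ X) = coeₗ (FinMat.relabel₂ f f X) := lift_coeₗ _ X

@[fun_prop]
theorem continuous_relabel (f : ℕ ↪ ℕ) : Continuous (relabel f : Stab A → Stab A) :=
  continuous_lift _

theorem relabel_refl (x : Stab A) : relabel (Function.Embedding.refl ℕ) x = x := by
  induction x using induction₁ with
  | hp => exact isClosed_eq (by fun_prop) (by fun_prop)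
  | h X =>
    rw [relabel_coeₗ]
    congr 1
    exact (FinMat.eq_relabel₂ _ _ (fun _ _ => rfl) (fun i _ h => (h ⟨i, rfl⟩).elim)
      (fun _ j h => (h ⟨j, rfl⟩).elim)).symm

theorem relabel_relabel (f g : ℕ ↪ ℕ) (x : Stab A) :
    relabel f (relabel g x) = relabel (g.trans f) x := by
  induction x using induction₁ with
  | hp => exact isClosed_eq ((continuous_relabel f).comp (continuous_relabel g)) (by fun_prop)
  | h X =>
    rw [relabel_coeₗ, relabel_coeₗ, relabel_coeₗ]
    congr 1
    refine FinMat.eq_relabel₂ _ _ (fun i j => ?_) (fun i j h => ?_) (fun i j h => ?_)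
    · simp [FinMat.entry_relabel₂]
    · by_cases hi : ∃ i', f i' = i
      · obtain ⟨i', rfl⟩ := hi
        by_cases hj : ∃ j', f j' = j
        · obtain ⟨j', rfl⟩ := hj
          rw [FinMat.entry_relabel₂, FinMat.entry_relabel₂_left]
          rintro ⟨k, rfl⟩
          exact h ⟨k, rfl⟩
        · exact FinMat.entry_relabel₂_right _ _ _ _ hj
      · exact FinMat.entry_relabel₂_left _ _ _ hi _
    · by_cases hi : ∃ i', f i' = i
      · obtain ⟨i', rfl⟩ := hi
        by_cases hj : ∃ j', f j' = j
        · obtain ⟨j', rfl⟩ := hj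
          rw [FinMat.entry_relabel₂, FinMat.entry_relabel₂_right]
          rintro ⟨k, rfl⟩
          exact h ⟨k, rfl⟩
        · exact FinMat.entry_relabel₂_right _ _ _ _ hj
      · exact FinMat.entry_relabel₂_left _ _ _ hi _

theorem coeₗ_relabel₂_mul (f g : ℕ ↪ ℕ) (R : FinMat A) (x : Stab A) :
    coeₗ (FinMat.relabel₂ f g R) * relabel g x * coeₗ (FinMat.relabel₂ g f (star R)) =
      relabel f (coeₗ R * x * star (coeₗ R)) := by
  induction x using induction₁ with
  | hp =>
    refine isClosed_eq ?_ ?_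
    · exact (continuous_const.mul (continuous_relabel g)).mul continuous_const
    · exact (continuous_relabel f).comp
        ((continuous_const.mul continuous_id).mul continuous_const)
  | h X =>
    rw [relabel_coeₗ, ← coeₗ_star, ← coeₗ_mul, ← coeₗ_mul, ← coeₗ_mul, ← coeₗ_mul,
      relabel_coeₗ, ← FinMat.relabel₂_mul, ← FinMat.relabel₂_mul]

theorem coeₗ_relabel₂_mul_eq_zero (f g g' : ℕ ↪ ℕ) (hg : ∀ i j, g i ≠ g' j) (R : FinMat A)
    (x : Stab A) : coeₗ (FinMat.relabel₂ f g R) * relabel g' x = 0 := by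
  induction x using induction₁ with
  | hp => exact isClosed_eq (continuous_const.mul (continuous_relabel g')) continuous_const
  | h X =>
    rw [relabel_coeₗ, ← coeₗ_mul, FinMat.relabel₂_mul_eq_zero _ _ _ _ hg, map_zero]

theorem relabel_mul_relabel_eq_zero (g g' : ℕ ↪ ℕ) (hg : ∀ i j, g i ≠ g' j) (x y : Stab A) :
    relabel g x * relabel g' y = 0 := by
  induction x using induction₁ with
  | hp => exact isClosed_eq ((continuous_relabel g).mul continuous_const) continuous_const
  | h X => rw [relabel_coeₗ, coeₗ_relabel₂_mul_eq_zero _ _ _ hg]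

theorem exists_coeₗ_of_cuntzLE {a b : Stab A} (h : CuntzLE a b) {ε : ℝ} (hε : 0 < ε) :
    ∃ R : FinMat A, ‖coeₗ R * b * star (coeₗ R) - a‖ < ε := by
  obtain ⟨r, hr⟩ := cuntzLE_iff.1 h ε hε
  have hc : Continuous fun r : Stab A => ‖r * b * star r - a‖ :=
    (((continuous_id.mul continuous_const).mul continuous_star).sub continuous_const).norm
  exact denseRange_coeₗ.exists_mem_open (isOpen_Iio.preimage hc) ⟨r, hr⟩

/-- Diagonal sums along families of injections with disjoint ranges respect Cuntz
subequivalence. -/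
theorem cuntzLE_sum {ι : Type*} [Fintype ι] (f g : ι → ℕ ↪ ℕ)
    (hg : ∀ i j, i ≠ j → ∀ k l, g i k ≠ g j l) {a b : ι → Stab A}
    (hab : ∀ i, CuntzLE (a i) (b i)) :
    CuntzLE (∑ i, relabel (f i) (a i)) (∑ i, relabel (g i) (b i)) := by
  classical
  rw [cuntzLE_iff]
  intro ε hε
  have hN : (0 : ℝ) < (Fintype.card ι : ℝ) + 1 := by positivity
  choose R hR using fun i => exists_coeₗ_of_cuntzLE (hab i) (div_pos hε hN)
  refine ⟨∑ i, coeₗ (FinMat.relabel₂ (f i) (g i) (R i)), ?_⟩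
  have h1 : (∑ i, coeₗ (FinMat.relabel₂ (f i) (g i) (R i))) * (∑ i, relabel (g i) (b i)) *
      star (∑ i, coeₗ (FinMat.relabel₂ (f i) (g i) (R i)) : Stab A) =
      ∑ i, relabel (f i) (coeₗ (R i) * b i * star (coeₗ (R i))) := by
    rw [Finset.sum_mul, star_sum, Finset.sum_mul]
    refine Finset.sum_congr rfl fun i _ => ?_
    have hL : coeₗ (FinMat.relabel₂ (f i) (g i) (R i)) * (∑ i, relabel (g i) (b i)) =
        coeₗ (FinMat.relabel₂ (f i) (g i) (R i)) * relabel (g i) (b i) := by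
      rw [Finset.mul_sum, Finset.sum_eq_single i]
      · intro j _ hj
        exact coeₗ_relabel₂_mul_eq_zero _ _ _ (hg i j hj.symm) _ _
      · simp
    rw [hL, Finset.mul_sum, Finset.sum_eq_single i]
    · rw [← coeₗ_star, ← FinMat.relabel₂_star, coeₗ_relabel₂_mul]
    · intro j _ hj
      rw [← coeₗ_star, ← FinMat.relabel₂_star, mul_assoc]
      have : star (coeₗ (FinMat.relabel₂ (f j) (g j) (R j)) * relabel (g i) (star (b i))) =
          (0 : Stab A) := by
        rw [coeₗ_relabel₂_mul_eq_zero _ _ _ (hg j i hj), star_zero]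
      rw [star_mul, ← map_star, star_star, ← coeₗ_star, ← FinMat.relabel₂_star] at this
      rw [this, mul_zero]
    · simp
  rw [h1, ← Finset.sum_sub_distrib]
  calc ‖∑ i, (relabel (f i) (coeₗ (R i) * b i * star (coeₗ (R i))) - relabel (f i) (a i))‖
      ≤ ∑ i : ι, ε / ((Fintype.card ι : ℝ) + 1) := by
        refine norm_sum_le_of_le _ fun i _ => ?_
        rw [← map_sub]
        exact (NonUnitalStarAlgHom.norm_apply_le _ _).trans (hR i).le
    _ = Fintype.card ι * (ε / ((Fintype.card ι : ℝ) + 1)) := by simp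
    _ < ((Fintype.card ι : ℝ) + 1) * (ε / ((Fintype.card ι : ℝ) + 1)) := by
        have := div_pos hε hN
        gcongr
        linarith
    _ = ε := mul_div_cancel₀ _ hN.ne'

/-- The injection `n ↦ 2 n`. -/
def evenEmb : ℕ ↪ ℕ := ⟨fun n => 2 * n, fun a b h => by simpa using h⟩
/-- The injection `n ↦ 2 n + 1`. -/
def oddEmb : ℕ ↪ ℕ := ⟨fun n => 2 * n + 1, fun a b h => by simpa using h⟩

theorem evenEmb_apply (n : ℕ) : evenEmb n = 2 * n := rfl
theorem oddEmb_apply (n : ℕ) : oddEmb n = 2 * n + 1 := rfl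

theorem evenEmb_ne_oddEmb (i j : ℕ) : evenEmb i ≠ oddEmb j := by
  change 2 * i ≠ 2 * j + 1
  omega

/-- Diagonal addition `a ⊕ b` in `A ⊗ K`, through the isomorphism `M_2(K) ≅ K` that places the
two diagonal blocks on the even and on the odd coordinates. -/
def diagAdd (a b : Stab A) : Stab A := relabel evenEmb a + relabel oddEmb b

theorem isPos_diagAdd {a b : Stab A} (ha : IsPos a) (hb : IsPos b) : IsPos (diagAdd a b) := by
  obtain ⟨c, rfl⟩ := ha
  obtain ⟨d, rfl⟩ := hb
  refine ⟨relabel evenEmb c + relabel oddEmb d, ?_⟩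
  rw [diagAdd, star_add, mul_add, add_mul, add_mul, ← map_star, ← map_star,
    relabel_mul_relabel_eq_zero _ _ evenEmb_ne_oddEmb,
    relabel_mul_relabel_eq_zero _ _ (fun i j => (evenEmb_ne_oddEmb j i).symm),
    map_mul, map_mul, zero_add, add_zero]

theorem cuntzLE_diagAdd {a b a' b' : Stab A} (ha : CuntzLE a a') (hb : CuntzLE b b') :
    CuntzLE (diagAdd a b) (diagAdd a' b') := by
  have := cuntzLE_sum (a := ![a, b]) (b := ![a', b']) ![evenEmb, oddEmb] ![evenEmb, oddEmb]
    (by simp [Fin.forall_fin_two, evenEmb_ne_oddEmb, fun i j => (evenEmb_ne_oddEmb j i).symm])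
    (by simp [Fin.forall_fin_two, ha, hb])
  simpa [Fin.sum_univ_two, diagAdd] using this

theorem cuntzLE_relabel (f g : ℕ ↪ ℕ) (a : Stab A) : CuntzLE (relabel f a) (relabel g a) := by
  have := cuntzLE_sum (ι := Unit) (a := fun _ => a) (b := fun _ => a) (fun _ => f) (fun _ => g)
    (fun i j h => (h rfl).elim) (fun _ => .refl a)
  simpa using this

theorem diagAdd_comm_le (a b : Stab A) : CuntzLE (diagAdd a b) (diagAdd b a) := by
  have := cuntzLE_sum (a := ![a, b]) (b := ![a, b]) ![evenEmb, oddEmb] ![oddEmb, evenEmb]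
    (by simp [Fin.forall_fin_two, evenEmb_ne_oddEmb, fun i j => (evenEmb_ne_oddEmb j i).symm])
    (fun i => .refl _)
  simpa [Fin.sum_univ_two, diagAdd, add_comm] using this

theorem zero_diagAdd_le (a : Stab A) : CuntzLE (diagAdd 0 a) a := by
  have := cuntzLE_relabel oddEmb (Function.Embedding.refl ℕ) a
  rwa [relabel_refl, ← zero_add (relabel oddEmb a), ← map_zero (relabel evenEmb)] at this

theorem le_zero_diagAdd (a : Stab A) : CuntzLE a (diagAdd 0 a) := by
  have := cuntzLE_relabel (Function.Embedding.refl ℕ) oddEmb a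
  rwa [relabel_refl, ← zero_add (relabel oddEmb a), ← map_zero (relabel evenEmb)] at this

theorem diagAdd_assoc (a b c : Stab A) :
    CuntzLE (diagAdd (diagAdd a b) c) (diagAdd a (diagAdd b c)) ∧
      CuntzLE (diagAdd a (diagAdd b c)) (diagAdd (diagAdd a b) c) := by
  let f : Fin 3 → ℕ ↪ ℕ := ![evenEmb.trans evenEmb, oddEmb.trans evenEmb, oddEmb]
  let g : Fin 3 → ℕ ↪ ℕ := ![evenEmb, evenEmb.trans oddEmb, oddEmb.trans oddEmb]
  have hf : ∀ i j, i ≠ j → ∀ k l, f i k ≠ f j l := by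
    intro i j hij k l
    fin_cases i <;> fin_cases j <;> simp [f, evenEmb_apply, oddEmb_apply] at hij ⊢ <;> omega
  have hg : ∀ i j, i ≠ j → ∀ k l, g i k ≠ g j l := by
    intro i j hij k l
    fin_cases i <;> fin_cases j <;> simp [g, evenEmb_apply, oddEmb_apply] at hij ⊢ <;> omega
  have h1 := cuntzLE_sum (a := ![a, b, c]) (b := ![a, b, c]) f g hg (fun i => .refl _)
  have h2 := cuntzLE_sum (a := ![a, b, c]) (b := ![a, b, c]) g f hf (fun i => .refl _)
  simp only [Fin.sum_univ_three, f, g, Matrix.cons_val] at h1 h2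
  simp only [diagAdd, map_add, relabel_relabel]
  rw [← add_assoc]
  exact ⟨h1, h2⟩

end Stab

/-- The positive cone `(A ⊗ K)₊`. -/
def PosStab (A : Type*) [NonUnitalCStarAlgebra A] : Type _ := {a : Stab A // IsPos a}

/-- `(A ⊗ K)₊`, preordered by Cuntz subequivalence. -/
instance (A : Type*) [NonUnitalCStarAlgebra A] : Preorder (PosStab A) where
  le a b := CuntzLE a.1 b.1
  le_refl a := .refl a.1
  le_trans _ _ _ := .trans

/-- The Cuntz semigroup `Cu(A) = (A ⊗ K)₊ / ∼`, where `a ∼ b` means `a ≾ b` and `b ≾ a`. -/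
def Cu (A : Type*) [NonUnitalCStarAlgebra A] : Type _ := Antisymmetrization (PosStab A) (· ≤ ·)

namespace Cu

variable {A : Type*} [NonUnitalCStarAlgebra A]

/-- The order of the Cuntz semigroup, induced by Cuntz subequivalence. -/
instance : PartialOrder (Cu A) :=
  inferInstanceAs (PartialOrder (Antisymmetrization (PosStab A) (· ≤ ·)))

/-- The Cuntz class `[a]` of a positive element `a` of `A ⊗ K`. -/
def mk (a : Stab A) (ha : IsPos a) : Cu A := toAntisymmetrization (· ≤ ·) ⟨a, ha⟩

theorem mk_le_mk {a b : Stab A} {ha : IsPos a} {hb : IsPos b} :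
    mk a ha ≤ mk b hb ↔ CuntzLE a b := Iff.rfl

theorem ind {p : Cu A → Prop} (h : ∀ a ha, p (mk a ha)) (x : Cu A) : p x :=
  Quotient.inductionOn' x fun a => h a.1 a.2

instance : Zero (Cu A) := ⟨mk 0 isPos_zero⟩

/-- Addition in the Cuntz semigroup, induced by diagonal addition: `[a] + [b] = [a ⊕ b]`. -/
instance : Add (Cu A) where
  add := Quotient.map₂ (fun a b => ⟨Stab.diagAdd a.1 b.1, Stab.isPos_diagAdd a.2 b.2⟩)
    fun _ _ h _ _ h' => ⟨Stab.cuntzLE_diagAdd h.1 h'.1, Stab.cuntzLE_diagAdd h.2 h'.2⟩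

theorem mk_add_mk {a b : Stab A} (ha : IsPos a) (hb : IsPos b) :
    mk a ha + mk b hb = mk (Stab.diagAdd a b) (Stab.isPos_diagAdd ha hb) := rfl

instance : AddCommMonoid (Cu A) where
  add_assoc x y z := by
    induction x using ind with | h a ha
    induction y using ind with | h b hb
    induction z using ind with | h c hc
    exact le_antisymm (Stab.diagAdd_assoc a b c).1 (Stab.diagAdd_assoc a b c).2
  zero_add x := by
    induction x using ind with | h a ha
    exact le_antisymm (Stab.zero_diagAdd_le a) (Stab.le_zero_diagAdd a)
  add_zero x := by
    induction x using ind with | h a ha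
    exact le_antisymm ((Stab.diagAdd_comm_le a 0).trans (Stab.zero_diagAdd_le a))
      ((Stab.le_zero_diagAdd a).trans (Stab.diagAdd_comm_le 0 a))
  add_comm x y := by
    induction x using ind with | h a ha
    induction y using ind with | h b hb
    exact le_antisymm (Stab.diagAdd_comm_le a b) (Stab.diagAdd_comm_le b a)
  nsmul := nsmulRec

theorem cuntzLE_map {M N : Type*} [NonUnitalCStarAlgebra M] [NonUnitalCStarAlgebra N]
    (φ : M →⋆ₙₐ[ℂ] N) {a b : M} (h : CuntzLE a b) : CuntzLE (φ a) (φ b) := by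
  rw [cuntzLE_iff] at *
  intro ε hε
  obtain ⟨r, hr⟩ := h ε hε
  refine ⟨φ r, ?_⟩
  rw [← map_star, ← map_mul, ← map_mul, ← map_sub]
  exact (NonUnitalStarAlgHom.norm_apply_le φ _).trans_lt hr

/-- The map `Cu(θ) : Cu(A) → Cu(B)`, `[a] ↦ [θ(a)]`, induced by a *-homomorphism `θ : A → B`. -/
def map {B : Type*} [NonUnitalCStarAlgebra B] (θ : A →⋆ₙₐ[ℂ] B) : Cu A → Cu B :=
  Quotient.map (fun a => ⟨Stab.map θ a.1, a.2.map _⟩)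
    fun _ _ h => ⟨cuntzLE_map _ h.1, cuntzLE_map _ h.2⟩

end Cu
end
end PureCStar

namespace PureCStar
noncomputable section

namespace Stab

/-- The embedding `a ↦ a ⊗ e₀₀` of `A` as the upper left corner of `A ⊗ K`. -/
def cornerHom {A : Type*} [NonUnitalCStarAlgebra A] : A →⋆ₙₐ[ℂ] Stab A where
  toFun a := coeHom (FinMat.inclHom 1 (CStarMatrix.ofMatrix fun _ _ => a))
  map_smul' c a := by
    rw [MonoidHom.id_apply, ← map_smul, ← map_smul]; rfl
  map_zero' := by
    rw [← map_zero coeHom, ← map_zero (FinMat.inclHom 1)]; rfl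
  map_add' a b := by
    rw [← map_add, ← map_add]; rfl
  map_mul' a b := by
    rw [← map_mul, ← map_mul]
    congr 2
    ext i j
    simp only [CStarMatrix.mul_apply, Finset.univ_unique, Finset.sum_singleton]
    rfl
  map_star' a := by
    rw [← map_star, ← map_star]; rfl

end Stab

namespace Cu

variable {A : Type*} [NonUnitalCStarAlgebra A]

/-- The class in `Cu(A)` of a positive element `a` of `A`, with `A` identified with the upper left
corner of `A ⊗ K`. -/
def cls (a : A) (ha : IsPos a) : Cu A := mk (Stab.cornerHom a) (ha.map _)

end Cu

section Order

variable {S T : Type*} [AddCommMonoid S] [PartialOrder S] [AddCommMonoid T] [PartialOrder T]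

/-- The (sequential) compact containment relation `x ≪ y`. -/
def WayBelow (x y : S) : Prop :=
  ∀ z : ℕ → S, Monotone z → ∀ s, IsLUB (Set.range z) s → y ≤ s → ∃ n, x ≤ z n

/-- An element `x` is almost divisible if for all `k` and `x' ≪ x` there is `z` with `k z ≤ x`
and `x' ≤ (k + 1) z`. -/
def AlmostDivisibleElt (x : S) : Prop :=
  ∀ (k : ℕ) (x' : S), WayBelow x' x → ∃ z : S, k • z ≤ x ∧ x' ≤ (k + 1) • z

variable (S) in
/-- Almost divisible semigroups. -/
def AlmostDivisible : Prop := ∀ x : S, AlmostDivisibleElt x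

variable (S) in
/-- Almost unperforated semigroups. -/
def AlmostUnperforated : Prop :=
  ∀ x y : S, (∃ m : ℕ, (m + 1) • x ≤ m • y) → x ≤ y

/-- Almost divisible maps. -/
def AlmostDivisibleMap (φ : S → T) : Prop :=
  ∀ (k : ℕ) (x' x : S), WayBelow x' x → ∃ z : T, k • z ≤ φ x ∧ φ x' ≤ (k + 1) • z

/-- Almost unperforated maps. -/
def AlmostUnperforatedMap (φ : S → T) : Prop :=
  ∀ x y : S, (∃ m : ℕ, (m + 1) • x ≤ m • y) → φ x ≤ φ y

end Order

/-- A C*-algebra is pure if its Cuntz semigroup is almost unperforated and almost divisible. -/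
def IsPure (A : Type*) [NonUnitalCStarAlgebra A] : Prop :=
  AlmostUnperforated (Cu A) ∧ AlmostDivisible (Cu A)

/-- A *-homomorphism `θ` is pure if `Cu(θ)` is almost unperforated and almost divisible. -/
def IsPureHom {A B : Type*} [NonUnitalCStarAlgebra A] [NonUnitalCStarAlgebra B]
    (θ : A →⋆ₙₐ[ℂ] B) : Prop :=
  AlmostUnperforatedMap (Cu.map θ) ∧ AlmostDivisibleMap (Cu.map θ)

/-- A C*-algebra is σ-unital if it has a countable approximate unit of positive contractions. -/
def IsSigmaUnital (A : Type*) [NonUnitalCStarAlgebra A] : Prop :=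
  ∃ e : ℕ → A, (∀ n, IsPos (e n) ∧ ‖e n‖ ≤ 1) ∧
    ∀ a : A, Tendsto (fun n => e n * a) atTop (𝓝 a) ∧ Tendsto (fun n => a * e n) atTop (𝓝 a)

section Ultrapower

variable (B : Type*) [NonUnitalCStarAlgebra B]

/-- The bounded sequences that converge to zero along `ω`. -/
def nullIdeal (ω : Ultrafilter ℕ) : ClosedIdeal (lp (fun _ : ℕ => B) ∞) where
  carrier := {x | Tendsto (fun n => ‖x n‖) ω (𝓝 0)}
  zero_mem' := by simp
  add_mem' {x y} hx hy := by
    have := Tendsto.add hx hy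
    rw [add_zero] at this
    exact squeeze_zero (fun _ => norm_nonneg _) (fun n => norm_add_le (x n) (y n)) this
  smul_mem' c x hx := by
    have := Tendsto.const_mul ‖c‖ hx
    rw [mul_zero] at this
    exact squeeze_zero (fun _ => norm_nonneg _) (fun n => (norm_smul c (x n)).le) this
  mul_mem_left' x y hy := by
    have := Tendsto.const_mul ‖x‖ hy
    rw [mul_zero] at this
    refine squeeze_zero (fun _ => norm_nonneg _) (fun n => ?_) this
    refine (norm_mul_le (x n) (y n)).trans ?_
    gcongr
    exact lp.norm_apply_le_norm ENNReal.top_ne_zero x n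
  mul_mem_right' x y hy := by
    have := Tendsto.mul_const ‖x‖ hy
    rw [zero_mul] at this
    refine squeeze_zero (fun _ => norm_nonneg _) (fun n => ?_) this
    refine (norm_mul_le (y n) (x n)).trans ?_
    gcongr
    exact lp.norm_apply_le_norm ENNReal.top_ne_zero x n
  star_mem' {y} hy := by
    refine Tendsto.congr (fun n => ?_) hy
    exact (norm_star (y n)).symm
  isClosed' := by
    refine isClosed_of_closure_subset fun x hx => ?_
    refine Metric.tendsto_nhds.2 fun ε hε => ?_
    obtain ⟨y, hy, hxy⟩ := Metric.mem_closure_iff.1 hx (ε / 2) (half_pos hε)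
    filter_upwards [Metric.tendsto_nhds.1 hy (ε / 2) (half_pos hε)] with n hn
    rw [dist_eq_norm, sub_zero, norm_norm] at hn ⊢
    rw [dist_eq_norm] at hxy
    have h1 : ‖x n - y n‖ ≤ ‖x - y‖ := lp.norm_apply_le_norm ENNReal.top_ne_zero (x - y) n
    have h2 := norm_add_le (x n - y n) (y n)
    rw [sub_add_cancel] at h2
    linarith

/-- The ultrapower `B_ω = ℓ^∞(B) / {x | lim_{n → ω} ‖xₙ‖ = 0}`. -/
abbrev Ultrapower (ω : Ultrafilter ℕ) : Type _ := (nullIdeal B ω).Quot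

variable {B}

/-- Constant sequences. -/
def constHom : B →⋆ₙₐ[ℂ] lp (fun _ : ℕ => B) ∞ where
  toFun b := ⟨fun _ => b, memℓp_infty ⟨‖b‖, by rintro _ ⟨n, rfl⟩; rfl⟩⟩
  map_smul' _ _ := rfl
  map_zero' := rfl
  map_add' _ _ := rfl
  map_mul' _ _ := rfl
  map_star' _ := rfl

/-- The canonical embedding `B → B_ω` as classes of constant sequences. -/
def diagEmb (ω : Ultrafilter ℕ) : B →⋆ₙₐ[ℂ] Ultrapower B ω :=
  (nullIdeal B ω).quotHom.comp constHom

end Ultrapower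

section RelativeCommutant

variable {M : Type*} [NonUnitalCStarAlgebra M]

/-- The relative commutant `M ∩ T'` of a self-adjoint subset `T` of `M` (for general `T`, of
`T ∪ T*`). -/
def relComm (T : Set M) : NonUnitalStarSubalgebra ℂ M := NonUnitalStarSubalgebra.centralizer ℂ T

instance isClosed_relComm (T : Set M) : IsClosed (relComm T : Set M) := by
  rw [relComm, NonUnitalStarSubalgebra.coe_centralizer]
  exact Set.isClosed_centralizer _

theorem mem_relComm_iff {T : Set M} {x : M} :
    x ∈ relComm T ↔ ∀ t ∈ T ∪ star T, t * x = x * t := by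
  rw [relComm, ← SetLike.mem_coe, NonUnitalStarSubalgebra.coe_centralizer]
  rfl

/-- The annihilator `Ann(T) = {x | x T = T x = 0}` of a self-adjoint subset `T` of `M` (for general
`T`, of `T ∪ T*`). It is contained in `M ∩ T'`, and is an ideal of `M ∩ T'`. -/
def ann (T : Set M) : ClosedIdeal (relComm T) where
  carrier := {x | ∀ t ∈ T ∪ star T, (x : M) * t = 0 ∧ t * (x : M) = 0}
  zero_mem' t _ := by simp
  add_mem' {x y} hx hy t ht := by simp [add_mul, mul_add, hx t ht, hy t ht]
  smul_mem' c x hx t ht := by simp [smul_mul_assoc, mul_smul_comm, hx t ht]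
  mul_mem_left' x y hy t ht := by
    have hc : t * (x : M) = x * t := by
      exact (mem_relComm_iff.1 x.2) t ht
    refine ⟨?_, ?_⟩
    · change (x : M) * y * t = 0
      rw [mul_assoc, (hy t ht).1, mul_zero]
    · change t * ((x : M) * y) = 0
      rw [← mul_assoc, hc, mul_assoc, (hy t ht).2, mul_zero]
  mul_mem_right' x y hy t ht := by
    have hc : t * (x : M) = x * t := by
      exact (mem_relComm_iff.1 x.2) t ht
    refine ⟨?_, ?_⟩
    · change (y : M) * x * t = 0
      rw [mul_assoc, ← hc, ← mul_assoc, (hy t ht).1, zero_mul]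
    · change t * ((y : M) * x) = 0
      rw [← mul_assoc, (hy t ht).2, zero_mul]
  star_mem' {y} hy t ht := by
    have hs : star t ∈ T ∪ star T := by
      rcases ht with ht | ht
      · exact Or.inr (by simpa using ht)
      · exact Or.inl ht
    obtain ⟨h1, h2⟩ := hy (star t) hs
    refine ⟨?_, ?_⟩
    · change star (y : M) * t = 0
      rw [← star_star t, ← star_mul, h2, star_zero]
    · change t * star (y : M) = 0
      rw [← star_star t, ← star_mul, h1, star_zero]
  isClosed' := by
    simp only [Set.ofPred_forall]
    refine isClosed_iInter fun t => isClosed_iInter fun _ => ?_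
    exact (isClosed_eq (by fun_prop) (by fun_prop)).inter
      (isClosed_eq (by fun_prop) (by fun_prop))

/-- Every annihilating element commutes with `T`. -/
theorem mem_relComm_of_ann {T : Set M} {x : M}
    (hx : ∀ t ∈ T ∪ star T, x * t = 0 ∧ t * x = 0) : x ∈ relComm T := by
  rw [mem_relComm_iff]
  intro t ht
  rw [(hx t ht).1, (hx t ht).2]

/-- The quotient `(M ∩ T') / Ann(T)`. -/
abbrev RelCommQuot (T : Set M) : Type _ := (ann T).Quot

/-- `u` is the unit of `M`. -/
def IsUnitElt (u : M) : Prop := ∀ x : M, u * x = x ∧ x * u = x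

theorem IsUnitElt.isPos {u : M} (hu : IsUnitElt u) : IsPos u := by
  have h1 : star u * u = star u := (hu _).2
  have h2 : star u = u := by
    have := congrArg star h1
    rwa [star_mul, star_star, h1] at this
  exact ⟨u, by rw [h2, (hu u).1]⟩

variable (M) in
/-- `M` is unital and the class of its unit in `Cu(M)` is almost divisible. -/
def UnitAlmostDivisible : Prop :=
  ∃ (u : M) (hu : IsUnitElt u), AlmostDivisibleElt (Cu.cls u hu.isPos)

end RelativeCommutant

end
end PureCStar

open PureCStar

open scoped MultiplierAlgebra

/-! A positive element `h = v* v` that commutes with the image of a homomorphism `φ : A → C` and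
almost divides the unit by `k` divides all Cuntz classes coming from `A` simultaneously, through `x
↦ φ(x) h`. Suppose that, approximately on `φ(A)`, `∑ rᵢ h rᵢ* = 1` with `k + 1` terms and `sᵢ sⱼ* =
δᵢⱼ h` for `k` elements, all commuting with `φ(A)`. Conjugating by the row `(rᵢ)` and by the column
`(sᵢ)` gives `k [φ(x) h] ≤ [φ(x)] ≤ (k + 1) [φ(x) h]`. The map `x ↦ φ(x) h` also preserves Cuntz
comparison and diagonal sums. Hence `(m + 1) x ≤ m y` with `m ≠ 0` yields `[φ(x)] ≤ (m + 1) [φ(x) h]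
= [φ((m + 1) x) h] ≤ [φ(m y) h] = m [φ(y) h] ≤ [φ(y)]`, and `[φ(x) h]` itself witnesses
divisibility. This is the content of `HasDivisor`, `map_cuntzLE_amp_mulDiv`,
`amp_mulDiv_cuntzLE_map`, `almostUnperforatedMap_of_hasDivisor` and `exists_cu_divisor`. The
witnesses are allowed to be multipliers, since they need not lie in `C`.

Such an `h` comes from the hypothesis. The class of a unit is compact, being the class of a
projection (`Cu.wayBelow_of_proj`), so almost divisibility gives `k z ≤ [1] ≤ (k + 1) z`. For `k ≠
0` this makes `z ≤ [1]`, so up to a small cut-down `z` is represented inside the algebra itself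
rather than its stabilization (`exists_divisor`). Lifting from `(B_ω ∩ U') / Ann(U)` to `B_ω ∩ U'`
turns the relations into identities that hold after multiplication by elements killed by `Ann(U)`
and fixed by a local unit `e` (`exists_relComm_divisor`). σ-unitality supplies `e` as the class of
the sequence `θ(eₙ)`.

For the first statement this makes the composite `A → B → B_ω` pure. Cuntz comparison in `B_ω` holds
up to a cut-down in some coordinate (`Stab.eventually_cut_cuntzLE`), so both conditions descend to
`θ` (`cuntzLE_of_map_diagEmb`, `exists_divisor_descent`).

For the second statement the witnesses are adjoined repeatedly: countable sets `G n` grow so that `G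
(n + 1)` contains divisors, for every `k`, that commute with `θ(A)` and with `G n`. With `E n` the
part of `C*(θ(A) ∪ G n)` on which `e` acts as a unit and `C` the closure of the union, these
divisors are multipliers of `C` commuting with `E n`. So each inclusion `E n → C` has divisors, and
a limit argument (`isPure_of_limit`) makes `C` pure. -/

namespace PureCStar
noncomputable section

/-! ### Cuntz comparison: cut-downs, order and perturbation -/

section CuntzBasics

attribute [local instance 50] CStarAlgebra.spectralOrder CStarAlgebra.spectralOrderedRing

variable {M N : Type*} [NonUnitalCStarAlgebra M] [NonUnitalCStarAlgebra N]

theorem isPos_iff_nonneg {a : M} : IsPos a ↔ 0 ≤ a :=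
  CStarAlgebra.nonneg_iff_eq_star_mul_self.symm

theorem IsPos.star_eq {a : M} (ha : IsPos a) : star a = a :=
  (IsSelfAdjoint.of_nonneg (isPos_iff_nonneg.1 ha)).star_eq

theorem IsPos.conj {a : M} (ha : IsPos a) (r : M) : IsPos (r * a * star r) := by
  obtain ⟨c, rfl⟩ := ha
  exact ⟨c * star r, by rw [star_mul, star_star]; simp only [mul_assoc]⟩

theorem isPos_mul_star_self (x : M) : IsPos (x * star x) := ⟨star x, by rw [star_star]⟩

theorem norm_conj_le (r x s : M) : ‖r * x * s‖ ≤ ‖r‖ * ‖x‖ * ‖s‖ :=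
  (norm_mul_le _ _).trans (by gcongr; exact norm_mul_le _ _)

/-- The cut-down `(a - ε)₊`. -/
def cut (ε : ℝ) (a : M) : M := cfcₙ (fun t : ℝ => max (t - ε) 0) a

theorem continuous_cutFun (ε : ℝ) : Continuous fun t : ℝ => max (t - ε) 0 := by fun_prop

theorem cutFun_zero {ε : ℝ} (hε : 0 ≤ ε) : (fun t : ℝ => max (t - ε) 0) 0 = 0 := by simpa

theorem isPos_cut (ε : ℝ) (a : M) : IsPos (cut ε a) :=
  isPos_iff_nonneg.2 (cfcₙ_nonneg fun _ _ => le_max_right _ _)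

theorem map_cut (φ : M →⋆ₙₐ[ℂ] N) {ε : ℝ} (hε : 0 ≤ ε) {a : M} (ha : IsPos a) :
    φ (cut ε a) = cut ε (φ a) := by
  have h1 := isPos_iff_nonneg.1 ha
  have h2 := isPos_iff_nonneg.1 (ha.map φ)
  exact NonUnitalStarAlgHomClass.map_cfcₙ (R := ℝ) (S := ℂ) φ _ a (continuous_cutFun ε).continuousOn
    (cutFun_zero hε) (map_continuous φ) h1.isSelfAdjoint h2.isSelfAdjoint

theorem norm_cut_sub_le {ε : ℝ} (hε : 0 ≤ ε) {a : M} (ha : IsPos a) : ‖cut ε a - a‖ ≤ ε := by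
  have h1 := isPos_iff_nonneg.1 ha
  have h2 : cut ε a - a = cfcₙ (fun t : ℝ => max (t - ε) 0 - t) a := by
    rw [cfcₙ_sub (fun t : ℝ => max (t - ε) 0) (fun t => t) a (by fun_prop) (cutFun_zero hε),
      cfcₙ_id' ℝ a]
    rfl
  rw [h2]
  refine norm_cfcₙ_le fun t ht => ?_
  have ht0 : 0 ≤ t := quasispectrum_nonneg_of_nonneg a h1 t ht
  rw [Real.norm_eq_abs, abs_le]
  constructor <;> rcases max_cases (t - ε) 0 with h | h <;> linarith [h.1]

theorem tendsto_cut {a : M} (ha : IsPos a) : Tendsto (fun ε => cut ε a) (𝓝[>] (0 : ℝ)) (𝓝 a) := by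
  refine tendsto_iff_norm_sub_tendsto_zero.2 (squeeze_zero' (.of_forall fun _ => norm_nonneg _)
    ?_ (tendsto_id.mono_left nhdsWithin_le_nhds))
  filter_upwards [self_mem_nhdsWithin] with ε hε
  exact norm_cut_sub_le (le_of_lt hε) ha

theorem cut_le_cut {ε δ : ℝ} (hδ : 0 ≤ δ) (h : δ ≤ ε) (a : M) : cut ε a ≤ cut δ a :=
  cfcₙ_mono (fun t _ => max_le_max (by linarith) le_rfl)
    (hf0 := cutFun_zero (hδ.trans h)) (hg0 := cutFun_zero hδ)

/-- Closedness of Cuntz subequivalence in the left variable. -/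
theorem cuntzLE_of_forall_exists {a b : M}
    (h : ∀ ε : ℝ, 0 < ε → ∃ c, ‖c - a‖ ≤ ε ∧ CuntzLE c b) : CuntzLE a b := by
  rw [cuntzLE_iff]
  intro ε hε
  obtain ⟨c, hc, hcb⟩ := h (ε / 2) (half_pos hε)
  obtain ⟨r, hr⟩ := cuntzLE_iff.1 hcb (ε / 2) (half_pos hε)
  refine ⟨r, ?_⟩
  have := norm_add_le (r * b * star r - c) (c - a)
  rw [sub_add_sub_cancel] at this
  linarith

theorem cuntzLE_of_forall_cut {a b : M} (ha : IsPos a)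
    (h : ∀ ε : ℝ, 0 < ε → CuntzLE (cut ε a) b) : CuntzLE a b :=
  cuntzLE_of_forall_exists fun ε hε => ⟨cut ε a, norm_cut_sub_le hε.le ha, h ε hε⟩

theorem cuntzLE_zero (b : M) : CuntzLE 0 b := ⟨fun _ => 0, by simp⟩

theorem conj_cuntzLE (r b : M) : CuntzLE (r * b * star r) b := ⟨fun _ => r, tendsto_const_nhds⟩

/-- The elements `k = d (d + η)⁻¹` act as an approximate unit on `s = c^{1/2}`, because `‖s - s k‖²
= ‖(1 - k) c (1 - k)‖ ≤ ‖(1 - k) d (1 - k)‖ ≤ η`. Since `k² = g d g` with `g = d^{1/2} (d + η)⁻¹`,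
the conjugates of `d` by `s g` tend to `s s = c`. -/
theorem cuntzLE_of_le {c d : M} (hc : 0 ≤ c) (hcd : c ≤ d) : CuntzLE c d := by
  have hd : 0 ≤ d := hc.trans hcd
  set s := CFC.sqrt c
  have hs : s * s = c := CFC.sqrt_mul_sqrt_self c hc
  have hss : star s = s := (IsSelfAdjoint.of_nonneg (CFC.sqrt_nonneg c)).star_eq
  -- The absolute values only serve to make the functions continuous on all of `ℝ`; the spectrum of
  -- `d` is nonnegative.
  let F : ℝ → ℝ → ℝ := fun η t => |t| / (|t| + η)
  let h : ℝ → ℝ → ℝ := fun η t => √|t| / (|t| + η)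
  have hFc : ∀ η : ℝ, 0 < η → Continuous (F η) := fun η hη => by
    refine Continuous.div (by fun_prop) (by fun_prop) fun t => ?_
    positivity
  have hhc : ∀ η : ℝ, 0 < η → Continuous (h η) := fun η hη => by
    refine Continuous.div (by fun_prop) (by fun_prop) fun t => ?_
    positivity
  have hF0 : ∀ η, F η 0 = 0 := fun η => by simp [F]
  have hh0 : ∀ η, h η 0 = 0 := fun η => by simp [h]
  have hFs : ∀ η, star (cfcₙ (F η) d) = cfcₙ (F η) d := fun η =>
    (cfcₙ_predicate (F η) d : IsSelfAdjoint _).star_eq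
  have hhs : ∀ η, star (cfcₙ (h η) d) = cfcₙ (h η) d := fun η =>
    (cfcₙ_predicate (h η) d : IsSelfAdjoint _).star_eq
  have hhd : ∀ η : ℝ, 0 < η → cfcₙ (h η) d * d * cfcₙ (h η) d = cfcₙ (F η) d * cfcₙ (F η) d := by
    intro η hη
    have e1 : cfcₙ (h η) d * d = cfcₙ (fun t => h η t * t) d := by
      rw [cfcₙ_mul (h η) (fun t => t) d (hhc η hη).continuousOn (hh0 η), cfcₙ_id' ℝ d]
    rw [e1, ← cfcₙ_mul (fun t => h η t * t) (h η) d
      ((hhc η hη).mul continuous_id).continuousOn (by simp) (hhc η hη).continuousOn (hh0 η),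
      ← cfcₙ_mul (F η) (F η) d (hFc η hη).continuousOn (hF0 η) (hFc η hη).continuousOn (hF0 η)]
    refine cfcₙ_congr fun t ht => ?_
    have ht0 : 0 ≤ t := quasispectrum_nonneg_of_nonneg d hd t ht
    simp only [h, F, abs_of_nonneg ht0]
    rw [div_mul_eq_mul_div, div_mul_div_comm, div_mul_div_comm]
    congr 1
    calc √t * t * √t = √t * √t * t := by ring
      _ = t * t := by rw [Real.mul_self_sqrt ht0]
  have hsF : ∀ η : ℝ, 0 < η → ‖s - s * cfcₙ (F η) d‖ * ‖s - s * cfcₙ (F η) d‖ ≤ η := by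
    intro η hη
    set k := cfcₙ (F η) d
    rw [← CStarRing.norm_star_mul_self]
    have e1 : star (s - s * k) * (s - s * k) = c - c * k - k * c + k * c * k := by
      rw [star_sub, star_mul, hss, hFs η, ← hs]; noncomm_ring
    have hle : c - c * k - k * c + k * c * k ≤ d - d * k - k * d + k * d * k := by
      obtain ⟨w, hw⟩ := CStarAlgebra.nonneg_iff_eq_star_mul_self.1 (sub_nonneg.2 hcd)
      have : d - d * k - k * d + k * d * k - (c - c * k - k * c + k * c * k) =
          star (w - w * k) * (w - w * k) := by
        calc _ = (d - c) - (d - c) * k - k * (d - c) + k * (d - c) * k := by noncomm_ring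
          _ = _ := by rw [hw, star_sub, star_mul, hFs η]; noncomm_ring
      rw [← sub_nonneg, this]
      exact star_mul_self_nonneg _
    rw [e1]
    refine (CStarAlgebra.norm_le_norm_of_nonneg_of_le
      (by rw [← e1]; exact star_mul_self_nonneg _) hle).trans ?_
    have e2 : d - d * k - k * d + k * d * k = cfcₙ (fun t => t - t * F η t - F η t * t
        + F η t * t * F η t) d := by
      have c1 := hFc η hη
      have z1 := hF0 η
      rw [cfcₙ_add (fun t => t - t * F η t - F η t * t) (fun t => F η t * t * F η t) d
          (by fun_prop) (by simp) (by fun_prop) (by simp),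
        cfcₙ_sub (fun t => t - t * F η t) (fun t => F η t * t) d
          (by fun_prop) (by simp) (by fun_prop) (by simp),
        cfcₙ_sub (fun t => t) (fun t => t * F η t) d (by fun_prop) (by simp) (by fun_prop) (by simp),
        cfcₙ_mul (fun t => F η t * t) (F η) d (by fun_prop) (by simp) (by fun_prop) z1,
        cfcₙ_mul (F η) (fun t => t) d (by fun_prop) z1 (by fun_prop) (by simp),
        cfcₙ_mul (fun t => t) (F η) d (by fun_prop) (by simp) (by fun_prop) z1, cfcₙ_id' ℝ d]
    rw [e2]
    refine norm_cfcₙ_le fun t ht => ?_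
    have ht0 : 0 ≤ t := quasispectrum_nonneg_of_nonneg d hd t ht
    have hp : 0 < t + η := by positivity
    have : t - t * F η t - F η t * t + F η t * t * F η t = t * η * η / (t + η) ^ 2 := by
      simp only [F, abs_of_nonneg ht0]
      field_simp
      ring
    rw [this, Real.norm_of_nonneg (by positivity), div_le_iff₀ (by positivity)]
    nlinarith [mul_nonneg ht0 hη.le, mul_nonneg (mul_nonneg ht0 ht0) hη.le, pow_pos hη 3,
      mul_nonneg ht0 (mul_nonneg hη.le hη.le)]
  have hη0 : Tendsto (fun n : ℕ => 1 / ((n : ℝ) + 1)) atTop (𝓝 0) :=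
    tendsto_one_div_add_atTop_nhds_zero_nat
  have hlim : Tendsto (fun n : ℕ => s * cfcₙ (F (1 / ((n : ℝ) + 1))) d) atTop (𝓝 s) := by
    rw [tendsto_iff_norm_sub_tendsto_zero]
    have h1 : Tendsto (fun n : ℕ => √(1 / ((n : ℝ) + 1))) atTop (𝓝 0) := by
      have h2 := (Real.continuous_sqrt.tendsto 0).comp hη0
      rwa [Real.sqrt_zero] at h2
    refine squeeze_zero (fun _ => norm_nonneg _) (fun n => ?_) h1
    rw [norm_sub_rev]
    refine Real.le_sqrt_of_sq_le ?_
    rw [sq]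
    exact hsF _ Nat.one_div_pos_of_nat
  refine ⟨fun n => s * cfcₙ (h (1 / ((n : ℝ) + 1))) d, ?_⟩
  have := hlim.mul hlim.star
  rw [hss, hs] at this
  refine this.congr fun n => ?_
  have e := hhd (1 / ((n : ℝ) + 1)) Nat.one_div_pos_of_nat
  rw [star_mul, star_mul, hss, hFs, hhs]
  calc _ = s * (cfcₙ (F (1 / ((n : ℝ) + 1))) d * cfcₙ (F (1 / ((n : ℝ) + 1))) d) * s := by
        noncomm_ring
    _ = _ := by rw [← e]; noncomm_ring

theorem cuntzLE_smul {c : ℝ} (hc : 0 ≤ c) (a : M) : CuntzLE (c • a) a := by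
  obtain ⟨r, hr⟩ := CuntzLE.refl a
  refine ⟨fun n => ((√c : ℝ) : ℂ) • r n, (hr.const_smul c).congr fun n => ?_⟩
  rw [star_smul, smul_mul_assoc, smul_mul_assoc, mul_smul_comm, smul_smul]
  simp only [RCLike.star_def, Complex.conj_ofReal]
  rw [← Complex.ofReal_mul, Real.mul_self_sqrt hc, Complex.coe_smul]

theorem cuntzLE_of_le_smul {a b : M} {c : ℝ} (ha : 0 ≤ a) (hc : 0 ≤ c) (h : a ≤ c • b) :
    CuntzLE a b :=
  (cuntzLE_of_le ha h).trans (cuntzLE_smul hc b)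

theorem cuntzLE_cut_of_le {ε δ : ℝ} (hδ : 0 ≤ δ) (h : δ ≤ ε) (a : M) :
    CuntzLE (cut ε a) (cut δ a) :=
  cuntzLE_of_le (isPos_iff_nonneg.1 (isPos_cut _ _)) (cut_le_cut hδ h a)

theorem cut_cuntzLE {ε : ℝ} (hε : 0 ≤ ε) {a : M} (ha : IsPos a) : CuntzLE (cut ε a) a := by
  have h0 := isPos_iff_nonneg.1 ha
  refine cuntzLE_of_le (isPos_iff_nonneg.1 (isPos_cut _ _)) ?_
  conv_rhs => rw [← cfcₙ_id' ℝ a]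
  refine cfcₙ_mono (fun t ht => ?_) (hf0 := cutFun_zero hε)
  have ht0 : 0 ≤ t := quasispectrum_nonneg_of_nonneg a h0 t ht
  exact max_le (by linarith) ht0

theorem cfc_pow_three {a : M} (ha : 0 ≤ a) : cfcₙ (fun t : ℝ => t * t * t) a = a * a * a := by
  rw [cfcₙ_mul (fun t : ℝ => t * t) (fun t => t) a, cfcₙ_mul (fun t : ℝ => t) (fun t => t) a,
    cfcₙ_id' ℝ a]

/-- On the spectrum, `(t - δ)₊ ≤ δ⁻² t³`, so every cut-down of `a` lies below a multiple of `a³`. -/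
theorem cuntzLE_pow_three {a : M} (ha : IsPos a) : CuntzLE a (a * a * a) := by
  have h1 := isPos_iff_nonneg.1 ha
  refine cuntzLE_of_forall_cut ha fun δ hδ => ?_
  refine cuntzLE_of_le_smul (c := (δ * δ)⁻¹) (isPos_iff_nonneg.1 (isPos_cut _ _)) (by positivity) ?_
  rw [← cfc_pow_three h1, ← cfcₙ_smul (δ * δ)⁻¹ (fun t : ℝ => t * t * t) a]
  refine cfcₙ_mono (fun t ht => ?_) (hf0 := cutFun_zero hδ.le)
  have ht0 : 0 ≤ t := quasispectrum_nonneg_of_nonneg a h1 t ht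
  rw [smul_eq_mul]
  refine max_le ?_ (by positivity)
  rw [inv_mul_eq_div, le_div_iff₀ (by positivity)]
  rcases le_total t δ with h | h
  · exact (mul_nonpos_of_nonpos_of_nonneg (by linarith) (by positivity)).trans (by positivity)
  · calc (t - δ) * (δ * δ) ≤ t * (t * t) := by gcongr; linarith
      _ = t * t * t := by ring

/-- If `‖a - b‖ ≤ ε` then `(a - ε)₊ ≾ b`. -/
theorem cut_cuntzLE_of_norm_sub_le {ε : ℝ} {a b : M} (ha : IsPos a) (hb : IsPos b)
    (h : ‖a - b‖ ≤ ε) : CuntzLE (cut ε a) b := by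
  have hε : 0 ≤ ε := (norm_nonneg _).trans h
  have h1 := isPos_iff_nonneg.1 ha
  have h2 := isPos_iff_nonneg.1 hb
  set f := cut ε a with hf
  have hf1 : 0 ≤ f := isPos_iff_nonneg.1 (isPos_cut ε a)
  have hfs : star f = f := hf1.isSelfAdjoint.star_eq
  have hle : f * (a - b) * f ≤ ε • (f * f) := by
    have h3 := CStarAlgebra.star_left_conjugate_le_norm_smul (a := f) (b := a - b)
      (h1.isSelfAdjoint.sub h2.isSelfAdjoint)
    rw [hfs] at h3
    refine h3.trans (smul_le_smul_of_nonneg_right h ?_)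
    simpa [hfs] using star_mul_self_nonneg f
  -- Here `f` is supported where `t > ε`, so `f (a - ε) f = f³`. Together with `f (a - b) f ≤ ε f²`
  -- this gives `f³ ≤ f b f`, and `f ≾ f³`.
  have key : f * f * f = f * a * f - ε • (f * f) := by
    have z := cutFun_zero hε
    rw [← cfc_pow_three hf1]
    have e0 : f * a = cfcₙ (fun t : ℝ => max (t - ε) 0 * t) a := by
      rw [cfcₙ_mul (fun t : ℝ => max (t - ε) 0) (fun t => t) a (by fun_prop) z, cfcₙ_id' ℝ a]; rfl
    have e1 : f * a * f = cfcₙ (fun t : ℝ => max (t - ε) 0 * t * max (t - ε) 0) a := by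
      rw [cfcₙ_mul (fun t : ℝ => max (t - ε) 0 * t) (fun t : ℝ => max (t - ε) 0) a (by fun_prop)
        (by simp) (by fun_prop) z, e0]; rfl
    have e2 : f * f = cfcₙ (fun t : ℝ => max (t - ε) 0 * max (t - ε) 0) a := by
      rw [cfcₙ_mul (fun t : ℝ => max (t - ε) 0) (fun t : ℝ => max (t - ε) 0) a (by fun_prop)
        z (by fun_prop) z]; rfl
    rw [cfc_pow_three hf1, e1, e2]
    have e3 : cfcₙ (fun t : ℝ => max (t - ε) 0 * max (t - ε) 0) a * f =
        cfcₙ (fun t : ℝ => max (t - ε) 0 * max (t - ε) 0 * max (t - ε) 0) a := by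
      rw [cfcₙ_mul (fun t : ℝ => max (t - ε) 0 * max (t - ε) 0) (fun t : ℝ => max (t - ε) 0) a
        (by fun_prop) (by simp [hε]) (by fun_prop) z]; rfl
    have z2 : max ((0 : ℝ) - ε) 0 * max (0 - ε) 0 = 0 := by simp [hε]
    rw [e3, ← cfcₙ_smul ε (fun t : ℝ => max (t - ε) 0 * max (t - ε) 0) a (by fun_prop) z2,
      ← cfcₙ_sub (fun t : ℝ => max (t - ε) 0 * t * max (t - ε) 0)
        (fun t : ℝ => ε • (max (t - ε) 0 * max (t - ε) 0)) a (by fun_prop) (by simp) (by fun_prop)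
        (by simp only [z2, smul_zero])]
    refine cfcₙ_congr fun t _ => ?_
    simp only [smul_eq_mul]
    rcases max_cases (t - ε) 0 with h | h <;> rw [h.1] <;> ring
  have hle2 : f * f * f ≤ f * b * f := by
    rw [key, sub_le_iff_le_add, ← sub_le_iff_le_add']
    calc f * a * f - f * b * f = f * (a - b) * f := by noncomm_ring
      _ ≤ _ := hle
  have h3 : 0 ≤ f * f * f := by
    simpa [hfs] using star_left_conjugate_nonneg hf1 f
  have h4 := conj_cuntzLE f b
  rw [hfs] at h4
  exact ((cuntzLE_pow_three (isPos_cut ε a)).trans (cuntzLE_of_le h3 hle2)).trans h4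

/-- If `r b r*` is within `ε` of `a`, then so is `r (b - δ)₊ r*` for all small `δ`, by continuity;
the perturbation bound does the rest. -/
theorem CuntzLE.exists_cut {a b : M} (ha : IsPos a) (hb : IsPos b) (h : CuntzLE a b) {ε : ℝ}
    (hε : 0 < ε) : ∀ᶠ δ in 𝓝[>] (0 : ℝ), CuntzLE (cut ε a) (cut δ b) := by
  obtain ⟨r, hr⟩ := cuntzLE_iff.1 h ε hε
  have hc : Continuous fun x : M => ‖a - r * x * star r‖ := by fun_prop
  have := (hc.tendsto b).comp (tendsto_cut hb)
  rw [norm_sub_rev] at hr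
  filter_upwards [this.eventually (gt_mem_nhds hr)] with δ hδ
  exact (cut_cuntzLE_of_norm_sub_le ha ((isPos_cut δ b).conj r) (le_of_lt hδ)).trans
    (conj_cuntzLE _ _)

theorem cut_cuntzLE_cut {ε δ : ℝ} (hδ : 0 ≤ δ) {a b : M} (ha : IsPos a) (hb : IsPos b)
    (h : ‖a - b‖ + δ ≤ ε) : CuntzLE (cut ε a) (cut δ b) := by
  refine cut_cuntzLE_of_norm_sub_le ha (isPos_cut δ b) (le_trans ?_ h)
  have h1 := norm_sub_le_norm_sub_add_norm_sub a b (cut δ b)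
  have h2 := norm_cut_sub_le hδ hb
  rw [norm_sub_rev] at h2
  linarith

/-- `x* x ≾ x x*`. -/
theorem star_mul_self_cuntzLE (x : M) : CuntzLE (star x * x) (x * star x) := by
  have h0 : IsPos (star x * x) := ⟨x, rfl⟩
  have h2 := conj_cuntzLE (star x * x * star x) (x * star x)
  have h3 := conj_cuntzLE (star x) (x * star x)
  -- The cube of `x* x` is at most `‖x* x‖` times its square, and the square is the conjugate `x* (x
  -- x*) x`.
  refine (cuntzLE_pow_three h0).trans (.trans ?_ h3)
  have h1 := isPos_iff_nonneg.1 h0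
  have e : star x * (x * star x) * star (star x) = star x * x * (star x * x) := by
    rw [star_star]; noncomm_ring
  rw [e]
  have hs := h1.isSelfAdjoint.star_eq
  refine cuntzLE_of_le_smul (c := ‖star x * x‖) ?_ (norm_nonneg _) ?_
  · simpa [hs] using star_left_conjugate_nonneg h1 (star x * x)
  · have := CStarAlgebra.star_left_conjugate_le_norm_smul (a := star x * x) (b := star x * x)
      h1.isSelfAdjoint
    rwa [hs] at this

theorem mul_star_self_cuntzLE (x : M) : CuntzLE (x * star x) (star x * x) := by
  have := star_mul_self_cuntzLE (star x)
  rwa [star_star] at this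

/-- A projection is Cuntz below every positive element close to it. -/
theorem proj_cuntzLE_of_norm_sub_le {p b : M} (hp : star p = p) (hpp : p * p = p) (hb : IsPos b)
    (h : ‖p - b‖ ≤ 1 / 2) : CuntzLE p b := by
  have hp0 : 0 ≤ p := isPos_iff_nonneg.1 ⟨p, by rw [hp, hpp]⟩
  have h2 := isPos_iff_nonneg.1 hb
  have h3 := CStarAlgebra.star_left_conjugate_le_norm_smul (a := p) (b := p - b)
    (hp0.isSelfAdjoint.sub h2.isSelfAdjoint)
  rw [hp, hpp] at h3
  have h4 : p - p * b * p ≤ (1 / 2 : ℝ) • p := by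
    calc p - p * b * p = p * (p - b) * p := by rw [mul_sub, sub_mul, hpp, hpp]
      _ ≤ ‖p - b‖ • p := h3
      _ ≤ _ := smul_le_smul_of_nonneg_right h hp0
  -- Compressing `‖p - b‖ ≤ 1/2` by `p` leaves `p b p ≥ p / 2`.
  have h5 : p ≤ (2 : ℝ) • (p * b * p) := by
    have h6 : (1 / 2 : ℝ) • p ≤ p * b * p := by
      calc (1 / 2 : ℝ) • p = p - (1 / 2 : ℝ) • p := by module
        _ ≤ p * b * p := by rw [sub_le_comm]; exact h4
    calc p = (2 : ℝ) • ((1 / 2 : ℝ) • p) := by module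
      _ ≤ _ := smul_le_smul_of_nonneg_left h6 (by norm_num)
  refine (cuntzLE_of_le_smul hp0 (by norm_num) h5).trans ?_
  have := conj_cuntzLE p b
  rwa [hp] at this

end CuntzBasics
end
end PureCStar

namespace PureCStar
noncomputable section

attribute [local instance 50] CStarAlgebra.spectralOrder CStarAlgebra.spectralOrderedRing

/-! ### Multipliers of a C*-algebra and of its stabilization -/

section Multipliers

variable {J : Type*} [NonUnitalCStarAlgebra J]

theorem eq_of_forall_mul_left_eq {a b : J} (h : ∀ w, w * a = w * b) : a = b := by
  rw [← sub_eq_zero, ← CStarRing.star_mul_self_eq_zero_iff, mul_sub, h, sub_self]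

theorem eq_of_forall_mul_right_eq {a b : J} (h : ∀ w, a * w = b * w) : a = b := by
  rw [← sub_eq_zero, ← CStarRing.mul_star_self_eq_zero_iff, sub_mul, h, sub_self]

/-- The inclusion of a C*-algebra into its multiplier algebra. -/
def toMult : J →⋆ₙₐ[ℂ] 𝓜(ℂ, J) := DoubleCentralizer.coeHom

theorem mul_toMult (m : 𝓜(ℂ, J)) (x : J) : m * toMult x = toMult (m.fst x) := by
  refine DoubleCentralizer.ext _ _ _ _ (Prod.ext (ContinuousLinearMap.ext fun y => ?_)
    (ContinuousLinearMap.ext fun y => ?_))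
  · change m.fst (x * y) = m.fst x * y
    refine eq_of_forall_mul_left_eq fun w => ?_
    rw [← m.central, ← mul_assoc, m.central, mul_assoc]
  · change m.snd y * x = y * m.fst x
    exact m.central y x

theorem toMult_mul (m : 𝓜(ℂ, J)) (x : J) : toMult x * m = toMult (m.snd x) := by
  have h := congrArg star (mul_toMult (star m) (star x))
  rw [star_mul, star_star, map_star, star_star] at h
  rw [h, DoubleCentralizer.star_fst, star_star, map_star, star_star]

theorem norm_toMult (x : J) : ‖toMult x‖ = ‖x‖ := by
  refine NonUnitalStarAlgHom.norm_map _ (fun a b hab => ?_) x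
  exact eq_of_forall_mul_right_eq fun y => congrArg (fun m : 𝓜(ℂ, J) => m.fst y) hab

theorem toMult_injective : Function.Injective (toMult : J → 𝓜(ℂ, J)) := fun a b h => by
  rw [← sub_eq_zero, ← norm_eq_zero, ← norm_toMult, map_sub, h, sub_self, norm_zero]

theorem mult_ext {m n : 𝓜(ℂ, J)} (h : ∀ x, m * toMult x = n * toMult x) : m = n := by
  have h1 : ∀ x, m.fst x = n.fst x := fun x =>
    toMult_injective (by rw [← mul_toMult, ← mul_toMult, h])
  refine DoubleCentralizer.ext _ _ _ _ (Prod.ext (ContinuousLinearMap.ext h1)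
    (ContinuousLinearMap.ext fun y => eq_of_forall_mul_right_eq fun w => ?_))
  rw [m.central, n.central, h1]

/-- Cuntz subequivalence may be implemented by multipliers. -/
theorem cuntzLE_of_mult {a b : J}
    (h : ∀ ε : ℝ, 0 < ε → ∃ m : 𝓜(ℂ, J), ‖m * toMult b * star m - toMult a‖ ≤ ε) :
    CuntzLE a b := by
  refine cuntzLE_of_forall_exists fun ε hε => ?_
  obtain ⟨m, hm⟩ := h ε hε
  -- This is `m b m*`, written with left actions only.
  refine ⟨m.fst (star (m.fst (star b))), ?_, ?_⟩
  · rw [← norm_toMult, map_sub, ← mul_toMult, map_star, ← mul_toMult, star_mul, ← map_star,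
      star_star, ← mul_assoc]
    exact hm
  -- The multiplier `m` is not in `J`, but the elements `m rₙ` are, and `rₙ b rₙ* → b`.
  · obtain ⟨r, hr⟩ := CuntzLE.refl b
    refine ⟨fun n => m.fst (r n), ?_⟩
    have hiso : Isometry (toMult : J → 𝓜(ℂ, J)) := AddMonoidHomClass.isometry_of_norm _ norm_toMult
    have h1 : Tendsto (fun n => m * toMult (r n * b * star (r n)) * star m) atTop
        (𝓝 (m * toMult b * star m)) :=
      ((hiso.continuous.tendsto b).comp hr).const_mul m |>.mul_const (star m)
    rw [hiso.isUniformInducing.isInducing.tendsto_nhds_iff]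
    convert h1 using 1
    · funext n
      simp only [Function.comp, map_mul, map_star, ← mul_toMult, star_mul]
      noncomm_ring
    · congr 1
      rw [← mul_toMult, map_star, ← mul_toMult, star_mul, ← map_star, star_star, ← mul_assoc]

end Multipliers

namespace FinMat

variable {A B : Type*} [NonUnitalCStarAlgebra A] [NonUnitalCStarAlgebra B]

theorem norm_map (φ : A →⋆ₙₐ[ℂ] B) (hφ : Function.Injective φ) (X : FinMat A) :
    ‖map φ X‖ = ‖X‖ := by
  obtain ⟨n, a, rfl⟩ := exists_incl₁ X
  rw [norm_incl, ← Stab.coeₗ.norm_map]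
  -- Isometry of injective homomorphisms is applied from `M_n(A)` into `B ⊗ K`, because `M_∞(B)` is
  -- not complete.
  refine NonUnitalStarAlgHom.norm_map (Stab.coeHom.comp ((map φ).comp (inclHom n))) ?_ a
  intro x y hxy
  have h2 : map φ (incl n x) = map φ (incl n y) := Stab.coeₗ.injective hxy
  apply incl_injective n
  ext i j
  exact hφ (congrArg (fun X : FinMat B => X.entry i j) h2)

end FinMat

namespace Stab

variable {A B C : Type*} [NonUnitalCStarAlgebra A] [NonUnitalCStarAlgebra B]
  [NonUnitalCStarAlgebra C]

theorem map_coeₗ (φ : A →⋆ₙₐ[ℂ] B) (X : FinMat A) : map φ (coeₗ X) = coeₗ (FinMat.map φ X) :=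
  lift_coeₗ _ _

@[fun_prop]
theorem continuous_map (φ : A →⋆ₙₐ[ℂ] B) : Continuous (map φ : Stab A → Stab B) :=
  continuous_lift _

theorem norm_map (φ : A →⋆ₙₐ[ℂ] B) (hφ : Function.Injective φ) (x : Stab A) :
    ‖map φ x‖ = ‖x‖ := by
  induction x using induction₁ with
  | hp => exact isClosed_eq (by fun_prop) (by fun_prop)
  | h X => rw [map_coeₗ, LinearIsometry.norm_map, LinearIsometry.norm_map, FinMat.norm_map φ hφ]

theorem map_comp (ψ : B →⋆ₙₐ[ℂ] C) (φ : A →⋆ₙₐ[ℂ] B) (x : Stab A) :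
    map (ψ.comp φ) x = map ψ (map φ x) := by
  induction x using induction₁ with
  | hp => exact isClosed_eq (by fun_prop) ((continuous_map ψ).comp (continuous_map φ))
  | h X => rw [map_coeₗ, map_coeₗ, map_coeₗ]; rfl

theorem map_relabel (φ : A →⋆ₙₐ[ℂ] B) (f : ℕ ↪ ℕ) (x : Stab A) :
    map φ (relabel f x) = relabel f (map φ x) := by
  induction x using induction₁ with
  | hp =>
    exact isClosed_eq ((continuous_map φ).comp (continuous_relabel f))
      ((continuous_relabel f).comp (continuous_map φ))
  | h X =>
    rw [relabel_coeₗ, map_coeₗ, map_coeₗ, relabel_coeₗ]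
    congr 1
    refine FinMat.eq_relabel₂ _ _ (fun i j => ?_) (fun i j h => ?_) (fun i j h => ?_)
    · change φ ((FinMat.relabel₂ f f X).entry _ _) = φ _
      rw [FinMat.entry_relabel₂]
    · change φ ((FinMat.relabel₂ f f X).entry _ _) = _
      rw [FinMat.entry_relabel₂_left _ _ _ h, map_zero]
    · change φ ((FinMat.relabel₂ f f X).entry _ _) = _
      rw [FinMat.entry_relabel₂_right _ _ _ _ h, map_zero]

theorem stab_mult_ext {m n : 𝓜(ℂ, Stab A)} (h : ∀ X, m.fst (coeₗ X) = n.fst (coeₗ X)) :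
    m = n := by
  refine mult_ext fun x => ?_
  rw [mul_toMult, mul_toMult]
  congr 1
  induction x using induction₁ with
  | hp => exact isClosed_eq m.fst.continuous n.fst.continuous
  | h X => exact h X

/-- A bounded linear self-map of `M_∞(A)`, extended to `A ⊗ K`. -/
def extendL (l : FinMat A →ₗ[ℂ] FinMat A) (K : ℝ) (hl : ∀ X, ‖l X‖ ≤ K * ‖X‖) :
    Stab A →L[ℂ] Stab A :=
  ((coeₗ (A := A)).toContinuousLinearMap.comp (l.mkContinuous K hl)).extend
    (coeₗ (A := A)).toContinuousLinearMap

theorem extendL_coeₗ (l : FinMat A →ₗ[ℂ] FinMat A) (K : ℝ) (hl : ∀ X, ‖l X‖ ≤ K * ‖X‖)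
    (X : FinMat A) : extendL l K hl (coeₗ X) = coeₗ (l X) :=
  ContinuousLinearMap.extend_eq _ (e := (coeₗ (A := A)).toContinuousLinearMap) denseRange_coeₗ
    (coeₗ (A := A)).isometry.isUniformInducing X

/-- A bound on the left action bounds the right action: `‖r X‖² = ‖r X (r X)*‖ = ‖X l((r X)*)‖ ≤ ‖X‖
K ‖r X‖`. -/
theorem norm_right_le {l r : FinMat A →ₗ[ℂ] FinMat A} {K : ℝ} (hl : ∀ X, ‖l X‖ ≤ K * ‖X‖)
    (h : ∀ X Y, r X * Y = X * l Y) (X : FinMat A) : ‖r X‖ ≤ K * ‖X‖ := by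
  rcases (norm_nonneg (r X)).eq_or_lt with h0 | h0
  · rw [← h0]
    exact (norm_nonneg _).trans (hl X)
  · refine le_of_mul_le_mul_right ?_ h0
    calc ‖r X‖ * ‖r X‖ = ‖X * l (star (r X))‖ := by rw [← h, CStarRing.norm_self_mul_star]
      _ ≤ ‖X‖ * (K * ‖star (r X)‖) := (norm_mul_le _ _).trans (by gcongr; exact hl _)
      _ = K * ‖X‖ * ‖r X‖ := by rw [norm_star]; ring

/-- The multiplier of `A ⊗ K` given by a double centralizer of `M_∞(A)`. -/
def ofFinMat (l r : FinMat A →ₗ[ℂ] FinMat A) (K : ℝ) (hl : ∀ X, ‖l X‖ ≤ K * ‖X‖)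
    (h : ∀ X Y, r X * Y = X * l Y) : 𝓜(ℂ, Stab A) where
  fst := extendL l K hl
  snd := extendL r K (norm_right_le hl h)
  central x y := by
    induction x, y using induction₂ with
    | hp => exact isClosed_eq (by fun_prop) (by fun_prop)
    | h X Y => rw [extendL_coeₗ, extendL_coeₗ, ← coeₗ_mul, ← coeₗ_mul, h]

end Stab

namespace FinMat

variable {A B : Type*} [NonUnitalCStarAlgebra A] [NonUnitalCStarAlgebra B]

/-- Moving the rows along an injection. -/
def moveRows (f : ℕ ↪ ℕ) : FinMat A →ₗ[ℂ] FinMat A where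
  toFun := relabel₂ f (.refl ℕ)
  map_add' := relabel₂_add _ _
  map_smul' := relabel₂_smul _ _

/-- An injection of `ℕ` tends to infinity, so pulling columns back along it keeps the support
finite. -/
theorem exists_bound_of_embedding (f : ℕ ↪ ℕ) (n : ℕ) : ∃ m, ∀ j, m ≤ j → n ≤ f j := by
  have : Tendsto f atTop atTop := by
    rw [← Nat.cofinite_eq_atTop]; exact f.injective.tendsto_cofinite
  exact eventually_atTop.1 (this.eventually_ge_atTop n)

/-- Pulling the columns back along an injection. -/
def pullCols (f : ℕ ↪ ℕ) : FinMat A →ₗ[ℂ] FinMat A where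
  toFun X := of (fun i j => X.entry i (f j)) (by
    obtain ⟨n, hn⟩ := X.exists_suppIn
    obtain ⟨m, hm⟩ := exists_bound_of_embedding f n
    refine ⟨max n m, fun i j h => hn _ _ ?_⟩
    rw [max_le_iff, max_le_iff] at h
    exact h.imp (fun h => h.1) (fun h => hm j h.2))
  map_add' X Y := by ext i j; rfl
  map_smul' c X := by ext i j; rfl

theorem entry_moveRows (f : ℕ ↪ ℕ) (X : FinMat A) (i j : ℕ) :
    (moveRows f X).entry (f i) j = X.entry i j := entry_relabel₂ f (.refl ℕ) X i j

theorem entry_moveRows_of_notMem (f : ℕ ↪ ℕ) (X : FinMat A) {i : ℕ} (hi : ¬ ∃ i', f i' = i)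
    (j : ℕ) : (moveRows f X).entry i j = 0 := entry_relabel₂_left f _ X hi j

theorem entry_pullCols (f : ℕ ↪ ℕ) (X : FinMat A) (i j : ℕ) :
    (pullCols f X).entry i j = X.entry i (f j) := rfl

theorem norm_moveRows (f : ℕ ↪ ℕ) (X : FinMat A) : ‖moveRows f X‖ = ‖X‖ := by
  have h : star (moveRows f X) * moveRows f X = star X * X := by
    change star (relabel₂ f (.refl ℕ) X) * relabel₂ f (.refl ℕ) X = _
    rw [← relabel₂_star, ← relabel₂_mul]
    exact (eq_relabel₂ _ _ (fun _ _ => rfl) (fun i _ h => (h ⟨i, rfl⟩).elim)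
      (fun _ j h => (h ⟨j, rfl⟩).elim)).symm
  have h2 : ‖moveRows f X‖ * ‖moveRows f X‖ = ‖X‖ * ‖X‖ := by
    rw [← CStarRing.norm_star_mul_self, ← CStarRing.norm_star_mul_self, h]
  exact (mul_self_inj (norm_nonneg _) (norm_nonneg _)).1 h2

theorem pullCols_mul (f : ℕ ↪ ℕ) (X Y : FinMat A) : pullCols f X * Y = X * moveRows f Y := by
  ext i j
  rw [entry_mul, entry_mul]
  have : ∀ k, X.entry i k * (moveRows f Y).entry k j ≠ 0 → k ∈ Set.range f := fun k hk => by
    by_contra hk'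
    exact hk (by rw [entry_moveRows_of_notMem f Y hk', mul_zero])
  rw [← finsum_mem_univ (f := fun k => X.entry i k * _),
    finsum_mem_inter_support_eq _ Set.univ (Set.range f) (by
      ext k
      simp only [Set.univ_inter, Set.mem_inter_iff, Function.mem_support]
      exact ⟨fun hk => ⟨this k hk, hk⟩, fun hk => hk.2⟩), finsum_mem_range f.injective]
  simp only [entry_moveRows, entry_pullCols]

/-- Entrywise application of a linear map. -/
def mapₗ (l : A →ₗ[ℂ] B) : FinMat A →ₗ[ℂ] FinMat B where
  toFun X := of (fun i j => l (X.entry i j)) (by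
    obtain ⟨n, hn⟩ := X.exists_suppIn
    exact ⟨n, fun i j h => by rw [hn i j h, map_zero]⟩)
  map_add' X Y := by ext i j; simp
  map_smul' c X := by ext i j; simp

@[simp] theorem entry_mapₗ (l : A →ₗ[ℂ] B) (X : FinMat A) (i j : ℕ) :
    (mapₗ l X).entry i j = l (X.entry i j) := rfl

theorem suppIn_of_scalar (n : ℕ) (a : A) : (of (fun i j => if i = j ∧ i < n then a else 0)
    ⟨n, fun i j h => if_neg (by omega)⟩).SuppIn n := fun i j h => if_neg (by omega)

/-- The truncated scalar matrices. -/
def scalar (n : ℕ) : A →⋆ₙₐ[ℂ] FinMat A where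
  toFun a := of (fun i j => if i = j ∧ i < n then a else 0) ⟨n, fun i j h => if_neg (by omega)⟩
  map_smul' c a := by ext i j; simp
  map_zero' := by ext i j; simp
  map_add' a b := by ext i j; simp only [entry_of, entry_add]; split_ifs <;> simp
  map_mul' a b := by
    ext i j
    rw [entry_mul_eq_sum (suppIn_of_scalar n a)]
    simp only [entry_of]
    by_cases h : i = j ∧ i < n
    · rw [if_pos h, Finset.sum_eq_single j]
      · rw [if_pos h, if_pos ⟨rfl, h.1 ▸ h.2⟩]
      · intro k _ hk
        rw [if_neg (fun h' => hk (h'.1.symm.trans h.1)), zero_mul]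
      · intro hj
        exact (hj (Finset.mem_range.2 (h.1 ▸ h.2))).elim
    · rw [if_neg h]
      refine (Finset.sum_eq_zero fun k _ => ?_).symm
      by_cases hk : i = k ∧ i < n
      · rw [if_neg (c := k = j ∧ k < n) (by omega), mul_zero]
      · rw [if_neg hk, zero_mul]
  map_star' a := by
    ext i j
    simp only [entry_of, entry_star]
    by_cases h : i = j ∧ i < n
    · rw [if_pos h, if_pos ⟨h.1.symm, h.1 ▸ h.2⟩]
    · rw [if_neg h, if_neg (by omega), star_zero]

theorem norm_scalar_le (n : ℕ) (a : A) : ‖scalar n a‖ ≤ ‖a‖ := by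
  rw [← Stab.coeₗ.norm_map]
  exact NonUnitalStarAlgHom.norm_apply_le (Stab.coeHom.comp (scalar n)) a

/-- Over the multiplier algebra, into which `M_∞(A)` embeds isometrically, applying `m` entrywise is
left multiplication by `m ⊗ 1_n`, whose norm is at most `‖m‖`. This is what lets `m ⊗ 1` extend to
the completion. -/
theorem norm_mapₗ_fst_le (m : 𝓜(ℂ, A)) (X : FinMat A) :
    ‖mapₗ m.fst.toLinearMap X‖ ≤ ‖m‖ * ‖X‖ := by
  obtain ⟨n, hn⟩ := X.exists_suppIn
  have h : map toMult (mapₗ m.fst.toLinearMap X) = scalar n m * map toMult X := by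
    refine FinMat.ext fun i j => ?_
    refine Eq.trans ?_ (entry_mul_eq_sum (X := scalar n m) (suppIn_of_scalar n m) _ i j).symm
    change toMult (m.fst (X.entry i j)) =
      ∑ k ∈ Finset.range n, (if i = k ∧ i < n then m else 0) * toMult (X.entry k j)
    by_cases hi : i < n
    · rw [Finset.sum_eq_single i]
      · rw [if_pos ⟨rfl, hi⟩, mul_toMult]
      · intro k _ hk
        rw [if_neg (fun h => hk h.1.symm), zero_mul]
      · intro h
        exact (h (Finset.mem_range.2 hi)).elim
    · rw [hn i j (Or.inl (not_lt.1 hi)), map_zero, map_zero]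
      refine (Finset.sum_eq_zero fun k _ => ?_).symm
      rw [if_neg (fun h => hi h.2), zero_mul]
  have hinj := toMult_injective (J := A)
  rw [← norm_map toMult hinj, h, ← norm_map toMult hinj X]
  exact (norm_mul_le _ _).trans (by gcongr; exact norm_scalar_le n m)

theorem mapₗ_snd_mul (m : 𝓜(ℂ, A)) (X Y : FinMat A) :
    mapₗ m.snd.toLinearMap X * Y = X * mapₗ m.fst.toLinearMap Y := by
  ext i j
  rw [entry_mul, entry_mul]
  exact finsum_congr fun k => m.central _ _

end FinMat

namespace Stab

variable {A B : Type*} [NonUnitalCStarAlgebra A] [NonUnitalCStarAlgebra B]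

/-- The isometry in the multiplier algebra of `A ⊗ K` that moves the basis along `f`. -/
def iso (f : ℕ ↪ ℕ) : 𝓜(ℂ, Stab A) :=
  ofFinMat (FinMat.moveRows f) (FinMat.pullCols f) 1
    (fun X => by rw [one_mul, FinMat.norm_moveRows]) (FinMat.pullCols_mul f)

theorem iso_fst (f : ℕ ↪ ℕ) (X : FinMat A) :
    (iso f).fst (coeₗ X) = coeₗ (FinMat.moveRows f X) := extendL_coeₗ _ _ _ _

theorem star_iso_fst (f : ℕ ↪ ℕ) (X : FinMat A) :
    (star (iso f)).fst (coeₗ X) = coeₗ (star (FinMat.pullCols f (star X))) := by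
  rw [DoubleCentralizer.star_fst, ← coeₗ_star, coeₗ_star (FinMat.pullCols f (star X))]
  congr 1
  exact extendL_coeₗ _ _ _ _

theorem star_iso_mul_iso (f : ℕ ↪ ℕ) : star (iso f) * iso f = (1 : 𝓜(ℂ, Stab A)) := by
  refine stab_mult_ext fun X => ?_
  change (star (iso f)).fst ((iso f).fst (coeₗ X)) = coeₗ X
  rw [iso_fst, star_iso_fst]
  congr 1
  ext i j
  simp [FinMat.entry_pullCols, FinMat.entry_moveRows]

theorem star_iso_mul_iso_of_disjoint {f g : ℕ ↪ ℕ} (h : ∀ i j, f i ≠ g j) :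
    star (iso f) * iso g = (0 : 𝓜(ℂ, Stab A)) := by
  refine stab_mult_ext fun X => ?_
  change (star (iso f)).fst ((iso g).fst (coeₗ X)) = 0
  rw [iso_fst, star_iso_fst, ← map_zero coeₗ]
  congr 1
  ext i j
  simp only [FinMat.entry_star, FinMat.entry_pullCols, star_star, FinMat.entry_zero]
  exact FinMat.entry_moveRows_of_notMem g X (fun ⟨k, hk⟩ => h i k hk.symm) j

theorem toMult_relabel (f : ℕ ↪ ℕ) (x : Stab A) :
    toMult (relabel f x) = iso f * toMult x * star (iso f) := by
  have h : ∀ x : Stab A, relabel f x = (iso f).fst (star ((iso f).fst (star x))) := by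
    intro x
    induction x using induction₁ with
    | hp =>
      exact isClosed_eq (by fun_prop) (by fun_prop)
    | h X =>
      rw [relabel_coeₗ, ← coeₗ_star, iso_fst, ← coeₗ_star, iso_fst]
      congr 1
      symm
      refine FinMat.eq_relabel₂ _ _ (fun i j => ?_) (fun i j h => ?_) (fun i j h => ?_)
      · simp [FinMat.entry_moveRows]
      · exact FinMat.entry_moveRows_of_notMem f _ h j
      · by_cases hi : ∃ i', f i' = i
        · obtain ⟨i', rfl⟩ := hi
          rw [FinMat.entry_moveRows, FinMat.entry_star, FinMat.entry_moveRows_of_notMem f _ h,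
            star_zero]
        · exact FinMat.entry_moveRows_of_notMem f _ hi j
  rw [h, ← mul_toMult, map_star, ← mul_toMult, star_mul, ← map_star, star_star, ← mul_assoc]

/-- The diagonal amplification `m ↦ m ⊗ 1` of multipliers. -/
def diag : 𝓜(ℂ, A) →⋆ₙₐ[ℂ] 𝓜(ℂ, Stab A) where
  toFun m := ofFinMat (FinMat.mapₗ m.fst.toLinearMap) (FinMat.mapₗ m.snd.toLinearMap) ‖m‖
    (FinMat.norm_mapₗ_fst_le m) (FinMat.mapₗ_snd_mul m)
  map_smul' c m := by
    refine stab_mult_ext fun X => ?_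
    change extendL _ _ _ (coeₗ X) = c • extendL _ _ _ (coeₗ X)
    rw [extendL_coeₗ, extendL_coeₗ, ← map_smul]; rfl
  map_zero' := by
    refine stab_mult_ext fun X => ?_
    change extendL _ _ _ (coeₗ X) = 0
    rw [extendL_coeₗ, ← map_zero coeₗ]; rfl
  map_add' m n := by
    refine stab_mult_ext fun X => ?_
    change extendL _ _ _ (coeₗ X) = extendL _ _ _ (coeₗ X) + extendL _ _ _ (coeₗ X)
    rw [extendL_coeₗ, extendL_coeₗ, extendL_coeₗ, ← map_add]; rfl
  map_mul' m n := by
    refine stab_mult_ext fun X => ?_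
    change extendL _ _ _ (coeₗ X) = extendL _ _ _ (extendL _ _ _ (coeₗ X))
    rw [extendL_coeₗ, extendL_coeₗ, extendL_coeₗ]; rfl
  map_star' m := by
    refine stab_mult_ext fun X => ?_
    rw [DoubleCentralizer.star_fst, ← coeₗ_star]
    change extendL _ _ _ (coeₗ X) = star (extendL _ _ _ (coeₗ (star X)))
    rw [extendL_coeₗ, extendL_coeₗ, ← coeₗ_star]
    rfl

theorem diag_fst (m : 𝓜(ℂ, A)) (X : FinMat A) :
    (diag m).fst (coeₗ X) = coeₗ (FinMat.mapₗ m.fst.toLinearMap X) := extendL_coeₗ _ _ _ _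

theorem diag_snd (m : 𝓜(ℂ, A)) (X : FinMat A) :
    (diag m).snd (coeₗ X) = coeₗ (FinMat.mapₗ m.snd.toLinearMap X) := extendL_coeₗ _ _ _ _

theorem diag_one : diag (1 : 𝓜(ℂ, A)) = 1 := by
  refine stab_mult_ext fun X => ?_
  rw [diag_fst]; rfl

theorem norm_diag_le (m : 𝓜(ℂ, A)) : ‖diag m‖ ≤ ‖m‖ := NonUnitalStarAlgHom.norm_apply_le _ _

theorem diag_mul_iso (m : 𝓜(ℂ, A)) (f : ℕ ↪ ℕ) : diag m * iso f = iso f * diag m := by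
  refine stab_mult_ext fun X => ?_
  change (diag m).fst ((iso f).fst (coeₗ X)) = (iso f).fst ((diag m).fst (coeₗ X))
  rw [iso_fst, diag_fst, diag_fst, iso_fst]
  congr 1
  ext i j
  rw [FinMat.entry_mapₗ]
  by_cases hi : ∃ i', f i' = i
  · obtain ⟨i', rfl⟩ := hi
    rw [FinMat.entry_moveRows, FinMat.entry_moveRows, FinMat.entry_mapₗ]
  · rw [FinMat.entry_moveRows_of_notMem f _ hi, FinMat.entry_moveRows_of_notMem f _ hi, map_zero]

end Stab
end
end PureCStar

namespace PureCStar
noncomputable section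

attribute [local instance 50] CStarAlgebra.spectralOrder CStarAlgebra.spectralOrderedRing

/-! ### Orthogonal isometries, multiples and suprema in the Cuntz semigroup -/

section Multipliers

variable {J : Type*} [NonUnitalCStarAlgebra J]

/-- The conjugate `m a m*` of an element by a multiplier. -/
def multConj (m : 𝓜(ℂ, J)) (a : J) : J := m.fst (star (m.fst (star a)))

theorem toMult_multConj (m : 𝓜(ℂ, J)) (a : J) :
    toMult (multConj m a) = m * toMult a * star m := by
  rw [multConj, ← mul_toMult, map_star, ← mul_toMult, star_mul, ← map_star, star_star, ← mul_assoc]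

theorem IsPos.multConj {a : J} (ha : IsPos a) (m : 𝓜(ℂ, J)) : IsPos (multConj m a) := by
  obtain ⟨c, rfl⟩ := ha
  refine ⟨star (m.fst (star c)), toMult_injective ?_⟩
  rw [toMult_multConj, map_mul, map_mul, star_star, map_star toMult (m.fst (star c)), ← mul_toMult,
    star_mul, ← map_star, star_star]
  simp only [mul_assoc]

theorem multConj_cuntzLE (m : 𝓜(ℂ, J)) (a : J) : CuntzLE (multConj m a) a :=
  cuntzLE_of_mult fun ε hε => ⟨m, by rw [toMult_multConj, sub_self, norm_zero]; exact hε.le⟩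

theorem multConj_multConj (m n : 𝓜(ℂ, J)) (a : J) :
    multConj m (multConj n a) = multConj (m * n) a := by
  apply toMult_injective
  simp only [toMult_multConj, star_mul, mul_assoc]

theorem multConj_one (a : J) : multConj 1 a = a := by
  apply toMult_injective
  rw [toMult_multConj, star_one, one_mul, mul_one]

theorem norm_le_one_of_star_mul_self {m : 𝓜(ℂ, J)} (h : star m * m = 1) : ‖m‖ ≤ 1 := by
  rcases subsingleton_or_nontrivial 𝓜(ℂ, J) with h0 | h0
  · rw [Subsingleton.elim m 0, norm_zero]; exact zero_le_one
  · have := CStarRing.norm_star_mul_self (x := m)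
    rw [h, CStarRing.norm_one] at this
    nlinarith [norm_nonneg m]

end Multipliers

section

variable {M : Type*} [NonUnitalCStarAlgebra M]

theorem isPos_of_tendsto {a : ℕ → M} {b : M} (h : Tendsto a atTop (𝓝 b)) (ha : ∀ n, IsPos (a n)) :
    IsPos b :=
  isPos_iff_nonneg.2 (CStarAlgebra.isClosed_nonneg.mem_of_tendsto h
    (.of_forall fun n => isPos_iff_nonneg.1 (ha n)))

/-- Injective *-homomorphisms reflect positivity. -/
theorem isPos_of_map {N : Type*} [NonUnitalCStarAlgebra N] (φ : M →⋆ₙₐ[ℂ] N)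
    (hφ : Function.Injective φ) {a : M} (h : IsPos (φ a)) : IsPos a := by
  have ha : IsSelfAdjoint a := hφ (by rw [map_star, h.star_eq])
  have h0 := isPos_iff_nonneg.1 h
  have h1 : φ (cfcₙ (fun t : ℝ => max (-t) 0) a) = cfcₙ (fun t : ℝ => max (-t) 0) (φ a) :=
    NonUnitalStarAlgHomClass.map_cfcₙ (R := ℝ) (S := ℂ) φ _ a (by fun_prop) (by simp)
      (map_continuous φ) ha h0.isSelfAdjoint
  have h2 : cfcₙ (fun t : ℝ => max (-t) 0) (φ a) = 0 := by
    rw [← cfcₙ_const_zero ℝ (φ a)]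
    exact cfcₙ_congr fun t ht =>
      max_eq_right (by linarith [quasispectrum_nonneg_of_nonneg (φ a) h0 t ht])
  have h3 : cfcₙ (fun t : ℝ => max (-t) 0) a = 0 := hφ (by rw [h1, h2, map_zero])
  have h4 : a = cfcₙ (fun t : ℝ => max t 0) a - cfcₙ (fun t : ℝ => max (-t) 0) a := by
    rw [← cfcₙ_sub (fun t : ℝ => max t 0) (fun t : ℝ => max (-t) 0) a]
    conv_lhs => rw [← cfcₙ_id' ℝ a]
    refine cfcₙ_congr fun t _ => ?_
    rcases le_total t 0 with h | h
    · simp [max_eq_right h, max_eq_left (neg_nonneg.2 h)]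
    · simp [max_eq_left h, max_eq_right (neg_nonpos.2 h)]
  rw [h4, h3, sub_zero]
  exact isPos_iff_nonneg.2 (cfcₙ_nonneg fun _ _ => le_max_right _ _)

/-- `h² = h^{1/2} h h^{1/2}`. -/
theorem mul_self_cuntzLE {h : M} (hh : IsPos h) : CuntzLE (h * h) h := by
  have h0 := isPos_iff_nonneg.1 hh
  set s := CFC.sqrt h
  have hs : s * s = h := CFC.sqrt_mul_sqrt_self h h0
  have hss : star s = s := (IsSelfAdjoint.of_nonneg (CFC.sqrt_nonneg h)).star_eq
  have := conj_cuntzLE s h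
  rwa [hss, ← hs, show s * (s * s) * s = s * s * (s * s) by noncomm_ring, hs] at this

end

namespace Stab

variable {A B : Type*} [NonUnitalCStarAlgebra A] [NonUnitalCStarAlgebra B]

/-- The injection onto the `i`-th part of a partition of `ℕ` into infinitely many infinite
parts. -/
def pairEmb (i : ℕ) : ℕ ↪ ℕ := ⟨fun j => Nat.pair i j, fun _ _ h => (Nat.pair_eq_pair.1 h).2⟩

theorem pairEmb_ne {i j : ℕ} (h : i ≠ j) (k l : ℕ) : pairEmb i k ≠ pairEmb j l :=
  fun e => h (Nat.pair_eq_pair.1 e).1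

/-- The isometries with orthogonal ranges in the multiplier algebra of `A ⊗ K`. -/
def ran (i : ℕ) : 𝓜(ℂ, Stab A) := iso (pairEmb i)

theorem star_ran_mul_ran (i j : ℕ) :
    star (ran i) * ran j = (if i = j then 1 else 0 : 𝓜(ℂ, Stab A)) := by
  split_ifs with h
  · rw [h]; exact star_iso_mul_iso _
  · exact star_iso_mul_iso_of_disjoint (pairEmb_ne h)

theorem norm_ran_le (i : ℕ) : ‖(ran i : 𝓜(ℂ, Stab A))‖ ≤ 1 :=
  norm_le_one_of_star_mul_self (star_iso_mul_iso _)

/-- The diagonal sum of `n` copies, as a *-homomorphism. -/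
def amp (n : ℕ) : Stab A →⋆ₙₐ[ℂ] Stab A where
  toFun a := ∑ i : Fin n, relabel (pairEmb i) a
  map_smul' c a := by simp only [map_smul, Finset.smul_sum, MonoidHom.id_apply]
  map_zero' := by simp only [map_zero, Finset.sum_const_zero]
  map_add' a b := by simp only [map_add, Finset.sum_add_distrib]
  map_mul' a b := by
    rw [Finset.sum_mul_sum]
    refine Finset.sum_congr rfl fun i _ => ?_
    rw [Finset.sum_eq_single i, map_mul]
    · intro j _ hj
      exact relabel_mul_relabel_eq_zero _ _ (pairEmb_ne fun h => hj (Fin.ext h.symm)) _ _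
    · simp
  map_star' a := by simp only [map_star, star_sum]

theorem amp_apply (n : ℕ) (a : Stab A) : amp n a = ∑ i : Fin n, relabel (pairEmb i) a := rfl

theorem toMult_amp (n : ℕ) (a : Stab A) :
    toMult (amp n a) = ∑ i : Fin n, ran i * toMult a * star (ran i) := by
  rw [amp_apply, map_sum]
  exact Finset.sum_congr rfl fun i _ => toMult_relabel _ _

theorem map_amp (φ : A →⋆ₙₐ[ℂ] B) (n : ℕ) (a : Stab A) : map φ (amp n a) = amp n (map φ a) := by
  rw [amp_apply, amp_apply, map_sum]
  exact Finset.sum_congr rfl fun i _ => map_relabel _ _ _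

theorem star_ran_mul_toMult_amp {n : ℕ} (i : Fin n) (a : Stab A) :
    star (ran i) * toMult (amp n a) = toMult a * star (ran i) := by
  rw [toMult_amp, Finset.mul_sum, Finset.sum_eq_single i]
  · rw [← mul_assoc, ← mul_assoc, star_ran_mul_ran, if_pos rfl, one_mul]
  · intro j _ hj
    rw [← mul_assoc, ← mul_assoc, star_ran_mul_ran, if_neg (fun h => hj (Fin.ext h.symm)), zero_mul,
      zero_mul]
  · simp

theorem cuntzLE_amp {n : ℕ} (hn : n ≠ 0) (a : Stab A) : CuntzLE a (amp n a) := by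
  refine cuntzLE_of_mult fun ε hε => ⟨star (ran 0), ?_⟩
  have := star_ran_mul_toMult_amp (⟨0, Nat.pos_of_ne_zero hn⟩ : Fin n) a
  simp only at this
  rw [this, star_star, mul_assoc, star_ran_mul_ran, if_pos rfl, mul_one, sub_self, norm_zero]
  exact hε.le

theorem amp_cuntzLE_amp (n : ℕ) {a b : Stab A} (h : CuntzLE a b) : CuntzLE (amp n a) (amp n b) :=
  cuntzLE_sum (fun i : Fin n => pairEmb i) (fun i : Fin n => pairEmb i)
    (fun _ _ hij => pairEmb_ne fun h => hij (Fin.ext h)) fun _ => h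

/-- The shift of the basis by `n`. -/
def shiftEmb (n : ℕ) : ℕ ↪ ℕ := ⟨fun i => i + n, fun a b h => by simpa using h⟩

/-- The adjoint of the shift by `n` deletes the first `n` rows, hence kills a matrix supported in
the upper left `n × n` corner; such matrices are dense. It provides room far out in `K` that is
almost orthogonal to a given element. -/
theorem exists_norm_star_shift_mul_le (x : Stab A) {ε : ℝ} (hε : 0 < ε) :
    ∃ n, ‖star (iso (shiftEmb n)) * toMult x‖ ≤ ε := by
  obtain ⟨X, hX⟩ := Metric.denseRange_iff.1 denseRange_coeₗ x ε hε
  rw [dist_eq_norm] at hX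
  obtain ⟨n, hn⟩ := X.exists_suppIn
  refine ⟨n, ?_⟩
  have h0 : star (iso (shiftEmb n)) * toMult (coeₗ X) = 0 := by
    rw [mul_toMult, star_iso_fst, ← map_zero toMult, ← map_zero coeₗ]
    congr 2
    ext i j
    simp only [FinMat.entry_star, FinMat.entry_pullCols, star_star, FinMat.entry_zero]
    exact hn (i + n) j (Or.inl (Nat.le_add_left n i))
  have h1 : star (iso (shiftEmb n)) * toMult x =
      star (iso (shiftEmb n)) * toMult (x - coeₗ X) := by
    rw [map_sub, mul_sub, h0, sub_zero]
  rw [h1]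
  refine (norm_mul_le _ _).trans ?_
  rw [norm_star, norm_toMult]
  exact (mul_le_of_le_one_left (norm_nonneg _)
    (norm_le_one_of_star_mul_self (star_iso_mul_iso _))).trans hX.le

/-- If `c ≾ a` then `c` is close to elements Cuntz equivalent to `a`. -/
theorem exists_cuntz_equiv_near {a c : Stab A} (ha : IsPos a) (h : CuntzLE c a) {η : ℝ}
    (hη : 0 < η) : ∃ c', IsPos c' ∧ ‖c' - c‖ ≤ η ∧ CuntzLE c' a ∧ CuntzLE a c' := by
  obtain ⟨r, hr⟩ := cuntzLE_iff.1 h η hη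
  have hc : Continuous fun Y : 𝓜(ℂ, Stab A) => ‖Y * toMult a * star Y - toMult c‖ := by fun_prop
  have h1 : ‖toMult r * toMult a * star (toMult r) - toMult c‖ < η := by
    rwa [← map_star, ← map_mul, ← map_mul, ← map_sub, norm_toMult]
  obtain ⟨ρ, hρ, hball⟩ := Metric.eventually_nhds_iff.1
    ((hc.tendsto (toMult r)).eventually (gt_mem_nhds h1))
  obtain ⟨n, hn⟩ := exists_norm_star_shift_mul_le r (show (0 : ℝ) < ρ / 3 by positivity)
  set V : 𝓜(ℂ, Stab A) := iso (shiftEmb n)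
  have hV : star V * V = 1 := star_iso_mul_iso _
  have hV1 : ‖V‖ ≤ 1 := norm_le_one_of_star_mul_self hV
  set τ : ℂ := ((ρ / 3 : ℝ) : ℂ)
  have hτ0 : τ ≠ 0 := by
    simp only [τ, ne_eq, Complex.ofReal_eq_zero]; positivity
  have hτn : ‖τ‖ = ρ / 3 := by
    simp only [τ, Complex.norm_real, Real.norm_eq_abs]; exact abs_of_pos (by positivity)
  -- `Y` is close to `r`, since `V* r` and `τ` are small, but unlike `r` it has the left inverse
  -- `τ⁻¹ V*`. Hence `Y a Y*` is Cuntz equivalent to `a` while staying near `r a r*`.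
  set Y : 𝓜(ℂ, Stab A) := (1 - V * star V) * toMult r + τ • V
  have hY : τ⁻¹ • star V * Y = 1 := by
    have : star V * (1 - V * star V) = 0 := by
      rw [mul_sub, mul_one, ← mul_assoc, hV, one_mul, sub_self]
    rw [mul_add, smul_mul_assoc, ← mul_assoc, this, zero_mul, smul_zero, zero_add, mul_smul_comm,
      smul_mul_assoc, hV, smul_smul, mul_inv_cancel₀ hτ0, one_smul]
  have hYr : dist Y (toMult r) < ρ := by
    have e : Y - toMult r = τ • V - V * (star V * toMult r) := by
      simp only [Y]; noncomm_ring
    rw [dist_eq_norm, e]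
    have h2 : ‖V * (star V * toMult r)‖ ≤ 1 * (ρ / 3) :=
      (norm_mul_le _ _).trans (by gcongr)
    have h3 : ‖τ • V‖ ≤ ρ / 3 * 1 := by
      rw [norm_smul, hτn]; gcongr
    have := norm_sub_le (τ • V) (V * (star V * toMult r))
    linarith
  refine ⟨multConj Y a, ha.multConj Y, ?_, multConj_cuntzLE Y a, ?_⟩
  · rw [← norm_toMult, map_sub, toMult_multConj]
    exact (hball hYr).le
  · have := multConj_cuntzLE (τ⁻¹ • star V) (multConj Y a)
    rwa [multConj_multConj, hY, multConj_one] at this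

/-- Every increasing sequence in the Cuntz semigroup has an upper bound whose cut-downs are
dominated by members of the sequence. -/
theorem exists_sup {a : ℕ → Stab A} (ha : ∀ n, IsPos (a n)) (hmono : ∀ n, CuntzLE (a n) (a (n + 1))) :
    ∃ c, IsPos c ∧ (∀ n, CuntzLE (a n) c) ∧ ∀ ε : ℝ, 0 < ε → ∃ n, CuntzLE (cut ε c) (a n) := by
  have hmono' : ∀ m n, m ≤ n → CuntzLE (a m) (a n) := fun m n hmn => by
    induction n, hmn using Nat.le_induction with
    | base => exact .refl _
    | succ n _ ih => exact ih.trans (hmono n)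
  -- A pair consists of an approximation to the upper bound and a tolerance: later approximations
  -- will move by no more than the tolerance, and cutting down by it still leaves the element above
  -- the `1 / (n + 1)`-cut-downs of `a 0, …, a n`.
  let P : ℕ → Stab A × ℝ → Prop := fun n p => IsPos p.1 ∧ CuntzLE p.1 (a n) ∧ 0 < p.2 ∧
    p.2 ≤ 1 / ((n : ℝ) + 1) ∧ ∀ m ≤ n, CuntzLE (cut (1 / ((n : ℝ) + 1)) (a m)) (cut p.2 p.1)
  have key : ∀ n c (τ : ℝ), 0 < τ → CuntzLE c (a n) →
      ∃ q, P n q ∧ ‖q.1 - c‖ ≤ τ / 2 ∧ q.2 ≤ τ / 2 := by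
    intro n c τ hτ hc
    obtain ⟨c', h1, h2, h3, h4⟩ := exists_cuntz_equiv_near (ha n) hc (half_pos hτ)
    have e1 : ∀ᶠ δ in 𝓝[>] (0 : ℝ), ∀ m ∈ Set.Iic n,
        CuntzLE (cut (1 / ((n : ℝ) + 1)) (a m)) (cut δ c') :=
      (Set.finite_Iic n).eventually_all.2 fun m hm =>
        ((hmono' m n hm).trans h4).exists_cut (ha m) h1 Nat.one_div_pos_of_nat
    have e2 : ∀ᶠ δ in 𝓝[>] (0 : ℝ), δ < τ / 2 :=
      nhdsWithin_le_nhds (gt_mem_nhds (half_pos hτ))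
    have e3 : ∀ᶠ δ in 𝓝[>] (0 : ℝ), δ < 1 / ((n : ℝ) + 1) :=
      nhdsWithin_le_nhds (gt_mem_nhds Nat.one_div_pos_of_nat)
    obtain ⟨δ, h5, h6, h7, h8⟩ := (e1.and (e2.and (e3.and self_mem_nhdsWithin))).exists
    exact ⟨(c', δ), ⟨h1, h3, h8, h7.le, h5⟩, h2, h6.le⟩
  obtain ⟨q0, hq0, -⟩ := key 0 (a 0) 1 one_pos (.refl _)
  choose! nxt hnxt using fun (n : ℕ) (p : Stab A × ℝ) (hp : P n p) =>
    key (n + 1) p.1 p.2 hp.2.2.1 (hp.2.1.trans (hmono n))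
  let seq : ℕ → Stab A × ℝ := fun n => Nat.rec q0 nxt n
  have hseq : ∀ n, P n (seq n) := fun n => by
    induction n with
    | zero => exact hq0
    | succ n ih => exact (hnxt n _ ih).1
  -- Each move is at most half the current tolerance and the tolerance at least halves, so a move is
  -- bounded by the drop in tolerance and the estimate telescopes.
  have hdist : ∀ n k, ‖(seq (n + k)).1 - (seq n).1‖ ≤ (seq n).2 - (seq (n + k)).2 := by
    intro n k
    induction k with
    | zero => simp
    | succ k ih =>
      have h1 := hnxt (n + k) _ (hseq _)
      have h2 := norm_sub_le_norm_sub_add_norm_sub (seq (n + (k + 1))).1 (seq (n + k)).1 (seq n).1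
      have h3 : ‖(seq (n + (k + 1))).1 - (seq (n + k)).1‖ ≤ (seq (n + k)).2 / 2 := h1.2.1
      have h4 : (seq (n + (k + 1))).2 ≤ (seq (n + k)).2 / 2 := h1.2.2
      linarith
  have hdist' : ∀ n m, n ≤ m → ‖(seq m).1 - (seq n).1‖ ≤ (seq n).2 := fun n m hnm => by
    obtain ⟨k, rfl⟩ := Nat.exists_eq_add_of_le hnm
    have := hdist n k
    have := (hseq (n + k)).2.2.1
    linarith
  have hτ : Tendsto (fun n => (seq n).2) atTop (𝓝 0) :=
    squeeze_zero (fun n => (hseq n).2.2.1.le) (fun n => (hseq n).2.2.2.1)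
      tendsto_one_div_add_atTop_nhds_zero_nat
  have hcau : CauchySeq fun n => (seq n).1 := by
    refine cauchySeq_of_le_tendsto_0' _ (fun n m hnm => ?_) hτ
    rw [dist_comm, dist_eq_norm]
    exact hdist' n m hnm
  obtain ⟨c, hc⟩ := cauchySeq_tendsto_of_complete hcau
  have hcpos : IsPos c := isPos_of_tendsto hc fun n => (hseq n).1
  have hcn : ∀ n, ‖c - (seq n).1‖ ≤ (seq n).2 := fun n =>
    le_of_tendsto ((hc.sub_const _).norm) (eventually_atTop.2 ⟨n, fun m hm => hdist' n m hm⟩)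
  refine ⟨c, hcpos, fun m => ?_, fun ε hε => ?_⟩
  · refine cuntzLE_of_forall_cut (ha m) fun ε hε => ?_
    have h1 : ∀ᶠ n : ℕ in atTop, 1 / ((n : ℝ) + 1) < ε :=
      tendsto_one_div_add_atTop_nhds_zero_nat.eventually (gt_mem_nhds hε)
    obtain ⟨n, hn, hmn⟩ := (h1.and (eventually_ge_atTop m)).exists
    refine (cuntzLE_cut_of_le Nat.one_div_pos_of_nat.le hn.le _).trans
      (((hseq n).2.2.2.2 m hmn).trans ?_)
    refine cut_cuntzLE_of_norm_sub_le (hseq n).1 hcpos ?_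
    rw [norm_sub_rev]
    exact hcn n
  · obtain ⟨n, hn⟩ := (hτ.eventually (gt_mem_nhds hε)).exists
    exact ⟨n, (cut_cuntzLE_of_norm_sub_le hcpos (hseq n).1 ((hcn n).trans hn.le)).trans
      (hseq n).2.1⟩

end Stab

namespace Cu

variable {A B : Type*} [NonUnitalCStarAlgebra A] [NonUnitalCStarAlgebra B]

/-- Iterated diagonal addition nests even and odd coordinates, whereas `amp` uses the pairing
function. Both are diagonal sums of copies of `a` along injections with disjoint ranges, and all
such sums are Cuntz equivalent. -/
theorem nsmul_mk (n : ℕ) (a : Stab A) (ha : IsPos a) :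
    n • mk a ha = mk (Stab.amp n a) (ha.map _) := by
  induction n with
  | zero =>
    rw [zero_nsmul]
    refine le_antisymm (cuntzLE_zero _) ?_
    change CuntzLE (Stab.amp 0 a) 0
    rw [Stab.amp_apply, Fin.sum_univ_zero]
    exact .refl _
  | succ n ih =>
    rw [succ_nsmul, ih, mk_add_mk]
    -- The injections that occur in `amp n a ⊕ a`: the first `n` copies sit on even coordinates, the
    -- last one on odd coordinates.
    let F : Fin (n + 1) → ℕ ↪ ℕ :=
      Fin.snoc (α := fun _ => ℕ ↪ ℕ) (fun i : Fin n => (Stab.pairEmb i).trans Stab.evenEmb)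
        Stab.oddEmb
    have hF : ∀ i j, i ≠ j → ∀ k l, F i k ≠ F j l := by
      intro i j hij k l
      induction i using Fin.lastCases with
      | last =>
        induction j using Fin.lastCases with
        | last => exact (hij rfl).elim
        | cast j =>
          simp only [F, Fin.snoc_last, Fin.snoc_castSucc]
          exact (Stab.evenEmb_ne_oddEmb _ _).symm
      | cast i =>
        induction j using Fin.lastCases with
        | last =>
          simp only [F, Fin.snoc_last, Fin.snoc_castSucc]
          exact Stab.evenEmb_ne_oddEmb _ _
        | cast j =>
          simp only [F, Fin.snoc_castSucc, Function.Embedding.trans_apply]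
          intro h
          exact Stab.pairEmb_ne (fun h' => hij (by rw [Fin.ext h'])) k l
            (Stab.evenEmb.injective h)
    have hsum : Stab.diagAdd (Stab.amp n a) a = ∑ i, Stab.relabel (F i) a := by
      rw [Fin.sum_univ_castSucc]
      simp only [F, Fin.snoc_last, Fin.snoc_castSucc]
      rw [Stab.diagAdd, Stab.amp_apply, map_sum]
      congr 1
      exact Finset.sum_congr rfl fun i _ => Stab.relabel_relabel _ _ _
    have hG : ∀ i j : Fin (n + 1), i ≠ j → ∀ k l, Stab.pairEmb i k ≠ Stab.pairEmb j l :=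
      fun _ _ hij => Stab.pairEmb_ne fun h => hij (Fin.ext h)
    refine le_antisymm ?_ ?_
    · rw [mk_le_mk, hsum, Stab.amp_apply]
      exact Stab.cuntzLE_sum F (fun i : Fin (n + 1) => Stab.pairEmb i) hG fun _ => .refl a
    · rw [mk_le_mk, hsum, Stab.amp_apply]
      exact Stab.cuntzLE_sum (fun i : Fin (n + 1) => Stab.pairEmb i) F hF fun _ => .refl a

theorem map_mk (φ : A →⋆ₙₐ[ℂ] B) (a : Stab A) (ha : IsPos a) :
    map φ (mk a ha) = mk (Stab.map φ a) (ha.map _) := rfl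

/-- The class of a projection is compact. -/
theorem wayBelow_of_proj {p : Stab A} (hp : star p = p) (hpp : p * p = p) (hp0 : IsPos p) :
    WayBelow (mk p hp0) (mk p hp0) := by
  intro z hz s hs hps
  have hrep : ∀ x : Cu A, ∃ a : Stab A, ∃ ha : IsPos a, x = mk a ha :=
    ind fun a ha => ⟨a, ha, rfl⟩
  choose a ha hza using fun n => hrep (z n)
  obtain ⟨c, hc, hac, hca⟩ := Stab.exists_sup ha fun n => by
    have := hz (Nat.le_succ n)
    rwa [hza, hza] at this
  -- As `s` is the least upper bound, `p ≾ c`. A cut-down of `c` that still dominates `(p - 1/2)₊`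
  -- lies below some `a n`, and a projection is dominated by its own cut-down at `1/2`.
  have h1 : s ≤ mk c hc := hs.2 (by
    rintro _ ⟨n, rfl⟩
    rw [hza n]
    exact hac n)
  have h2 : CuntzLE p c := hps.trans h1
  obtain ⟨δ, h3, hδ⟩ :=
    ((h2.exists_cut hp0 hc one_half_pos).and self_mem_nhdsWithin).exists
  obtain ⟨n, hn⟩ := hca δ hδ
  refine ⟨n, ?_⟩
  rw [hza n]
  refine CuntzLE.trans ?_ (h3.trans hn)
  refine proj_cuntzLE_of_norm_sub_le hp hpp (isPos_cut _ _) ?_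
  rw [norm_sub_rev]
  exact norm_cut_sub_le one_half_pos.le hp0

end Cu
end
end PureCStar

namespace PureCStar
noncomputable section

attribute [local instance 50] CStarAlgebra.spectralOrder CStarAlgebra.spectralOrderedRing

/-! ### Algebraic witnesses for almost divisibility of the unit -/

section UnitDivisors

variable {M : Type*} [NonUnitalCStarAlgebra M]

namespace Stab

theorem cornerHom_injective : Function.Injective (cornerHom : M → Stab M) := by
  intro a b h
  have h1 : FinMat.incl 1 (CStarMatrix.ofMatrix fun _ _ => a) =
    FinMat.incl 1 (CStarMatrix.ofMatrix fun _ _ => b) := coeₗ.injective h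
  exact congrArg (fun X : FinMat M => X.entry 0 0) h1

theorem norm_cornerHom (a : M) : ‖cornerHom a‖ = ‖a‖ :=
  NonUnitalStarAlgHom.norm_map _ cornerHom_injective a

theorem cornerHom_eq (a : M) :
    cornerHom a = coeₗ (FinMat.incl 1 (CStarMatrix.ofMatrix fun _ _ => a)) := rfl

/-- Compressions to the upper left corner. -/
theorem exists_cornerHom_eq {u : M} (hu : IsUnitElt u) (x : Stab M) :
    ∃ m : M, cornerHom u * x * cornerHom u = cornerHom m := by
  -- The corner embedding is isometric, so its range is closed and finite matrices suffice.
  have hclosed : IsClosed (Set.range (cornerHom : M → Stab M)) :=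
    (AddMonoidHomClass.isometry_of_norm (cornerHom : M →⋆ₙₐ[ℂ] Stab M)
      norm_cornerHom).isClosedEmbedding.isClosed_range
  suffices h : cornerHom u * x * cornerHom u ∈ Set.range (cornerHom : M → Stab M) by
    obtain ⟨m, hm⟩ := h
    exact ⟨m, hm.symm⟩
  induction x using induction₁ with
  | hp => exact hclosed.preimage (by fun_prop)
  | h X =>
    refine ⟨X.entry 0 0, ?_⟩
    rw [cornerHom_eq, cornerHom_eq, ← coeₗ_mul, ← coeₗ_mul]
    congr 1
    set U := FinMat.incl 1 (CStarMatrix.ofMatrix fun _ _ => u)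
    have hU : U.SuppIn 1 := FinMat.suppIn_incl 1 _
    have hUe : U.entry 0 0 = u := rfl
    ext i j
    rw [mul_assoc, FinMat.entry_mul_eq_sum hU, Finset.sum_range_one, FinMat.entry_mul,
      finsum_eq_single _ 0 (fun k hk => by
        rw [hU k j (Or.inl (Nat.one_le_iff_ne_zero.2 hk)), mul_zero])]
    by_cases hi : i = 0
    · by_cases hj : j = 0
      · rw [hi, hj, hUe, (hu _).2, (hu _).1]; rfl
      · rw [hU 0 j (Or.inr (Nat.one_le_iff_ne_zero.2 hj)), mul_zero, mul_zero]
        exact FinMat.suppIn_incl 1 _ i j (Or.inr (Nat.one_le_iff_ne_zero.2 hj))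
    · rw [hU i 0 (Or.inl (Nat.one_le_iff_ne_zero.2 hi)), zero_mul]
      exact FinMat.suppIn_incl 1 _ i j (Or.inl (Nat.one_le_iff_ne_zero.2 hi))

end Stab

/-- For `h = (g - η)₊` one has `h ≤ g`, so `h³ ≤ h g h ≤ ‖g‖ h²`, and both ends are Cuntz equivalent
to `h`. -/
theorem cut_conj_cuntz_equiv {g : M} (hg : IsPos g) {η : ℝ} (hη : 0 ≤ η) :
    CuntzLE (cut η g) (cut η g * g * cut η g) ∧ CuntzLE (cut η g * g * cut η g) (cut η g) := by
  have hg0 := isPos_iff_nonneg.1 hg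
  have hh := isPos_cut η g
  have hh0 := isPos_iff_nonneg.1 hh
  set h := cut η g
  have hle : h ≤ g := by
    change cfcₙ _ g ≤ _
    conv_rhs => rw [← cfcₙ_id' ℝ g]
    refine cfcₙ_mono (fun t ht => ?_) (hf0 := cutFun_zero hη)
    have ht0 : 0 ≤ t := quasispectrum_nonneg_of_nonneg g hg0 t ht
    exact max_le (by linarith) ht0
  constructor
  · refine (cuntzLE_pow_three hh).trans (cuntzLE_of_le ?_ ?_)
    · simpa [hh.star_eq] using star_left_conjugate_nonneg hh0 h
    · simpa [hh.star_eq] using star_left_conjugate_le_conjugate hle h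
  · refine CuntzLE.trans (cuntzLE_of_le_smul (c := ‖g‖) ?_ (norm_nonneg g) ?_)
      (mul_self_cuntzLE hh)
    · simpa [hh.star_eq] using star_left_conjugate_nonneg hg0 h
    · simpa [hh.star_eq] using CStarAlgebra.star_left_conjugate_le_norm_smul (a := h) (b := g)
        hg0.isSelfAdjoint

namespace Stab

/-- If `c ≾ p` for a projection `p`, then the cut-downs of `c` are dominated by elements of the
corner of `p` that are dominated by `c`. -/
theorem exists_corner_between {p c : M} (hp : star p = p) (hpp : p * p = p) (hc : IsPos c)
    (hcp : CuntzLE c p) {δ : ℝ} (hδ : 0 < δ) :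
    ∃ z, IsPos z ∧ p * z * p = z ∧ CuntzLE z c ∧ CuntzLE (cut δ c) z := by
  obtain ⟨r, hr⟩ := cuntzLE_iff.1 hcp (δ / 2) (half_pos hδ)
  -- With `y = r p`, `g = y y*` is within `δ / 2` of `c`. For `h = (g - δ/2)₊` the element `(h y)*
  -- (h y)` lies in the corner of `p` and is equivalent to `h y y* h = h g h`, hence to `h`.
  set g := r * p * star r
  have hgy : g = (r * p) * star (r * p) := by
    rw [star_mul, hp, mul_assoc r p, ← mul_assoc p p, hpp, ← mul_assoc]
  have hg : IsPos g := by rw [hgy]; exact isPos_mul_star_self _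
  set h := cut (δ / 2) g
  have hh : IsPos h := isPos_cut _ _
  obtain ⟨h1, h2⟩ := cut_conj_cuntz_equiv hg (half_pos hδ).le
  have e1 : (h * (r * p)) * star (h * (r * p)) = h * g * h := by
    rw [hgy, star_mul, hh.star_eq]; noncomm_ring
  refine ⟨star (h * (r * p)) * (h * (r * p)), ⟨_, rfl⟩, ?_, ?_, ?_⟩
  · have e2 : h * (r * p) * p = h * (r * p) := by rw [mul_assoc, mul_assoc, hpp]
    have e3 : p * star (h * (r * p)) = star (h * (r * p)) := by
      rw [← hp, ← star_mul, hp, e2]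
    rw [← mul_assoc, e3, mul_assoc, e2]
  · refine (star_mul_self_cuntzLE _).trans ?_
    rw [e1]
    exact h2.trans (cut_cuntzLE_of_norm_sub_le hg hc hr.le)
  · refine (CuntzLE.trans ?_ h1).trans ?_
    · refine cut_cuntzLE_cut (half_pos hδ).le hc hg ?_
      rw [norm_sub_rev]
      linarith
    · rw [← e1]
      exact mul_star_self_cuntzLE _

end Stab

/-- This turns almost divisibility in the Cuntz semigroup into approximate relations in `M` itself.
For `k ≠ 0` the divisor is below `[u]`, so it has a representative `v* v` in `M`. The same `v`
serves every `ε`; only the `r` and `s` depend on it. -/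
theorem exists_divisor {u : M} (hu : IsUnitElt u)
    (hdiv : AlmostDivisibleElt (Cu.cls u hu.isPos)) {k : ℕ} (hk : k ≠ 0) :
    ∃ v : M, ∀ ε : ℝ, 0 < ε →
      (∃ r : Fin (k + 1) → M, ‖∑ i, r i * (star v * v) * star (r i) - u‖ ≤ ε) ∧
      ∃ s : Fin k → M, ∀ i j, ‖s i * star (s j) - (if i = j then star v * v else 0)‖ ≤ ε := by
  have hus : star u = u := hu.isPos.star_eq
  have huu : u * u = u := (hu u).1
  set p : Stab M := Stab.cornerHom u with hpdef
  have hp : star p = p := by rw [hpdef, ← map_star, hus]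
  have hpp : p * p = p := by rw [hpdef, ← map_mul, huu]
  have hp0 : IsPos p := hu.isPos.map _
  have hpn : ‖(toMult p : 𝓜(ℂ, Stab M))‖ ≤ 1 := by
    rw [norm_toMult]
    have := CStarRing.norm_star_mul_self (x := p)
    rw [hp, hpp] at this
    by_contra hlt
    push Not at hlt
    nlinarith
  -- Compactness of `[u]` permits the choice `x' = [u]`.
  obtain ⟨z, hz1, hz2⟩ := hdiv k _ (Cu.wayBelow_of_proj hp hpp hp0)
  induction z using Cu.ind with | h c hc
  rw [Cu.nsmul_mk] at hz1 hz2
  replace hz1 : CuntzLE (Stab.amp k c) p := hz1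
  replace hz2 : CuntzLE p (Stab.amp (k + 1) c) := hz2
  obtain ⟨δ, h3, hδ⟩ :=
    ((hz2.exists_cut hp0 (hc.map _) one_half_pos).and self_mem_nhdsWithin).exists
  replace hδ : (0 : ℝ) < δ := hδ
  -- The divisor is moved into the corner of `p`. This costs a cut-down by `δ`, chosen so that `k +
  -- 1` copies of `(c - δ)₊` still dominate `(p - 1/2)₊`, and hence `p`.
  obtain ⟨z, hz, hpz, hzc, hcz⟩ := Stab.exists_corner_between hp hpp hc
    ((Stab.cuntzLE_amp hk c).trans hz1) hδ
  have hz3 : CuntzLE (Stab.amp k z) p := (Stab.amp_cuntzLE_amp k hzc).trans hz1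
  have hz4 : CuntzLE p (Stab.amp (k + 1) z) := by
    refine CuntzLE.trans (proj_cuntzLE_of_norm_sub_le hp hpp (isPos_cut (1 / 2) p) ?_)
      (h3.trans ?_)
    · rw [norm_sub_rev]
      exact norm_cut_sub_le one_half_pos.le hp0
    · rw [← map_cut _ hδ.le hc]
      exact Stab.amp_cuntzLE_amp _ hcz
  obtain ⟨a, ha⟩ := Stab.exists_cornerHom_eq hu z
  rw [← hpdef, hpz] at ha
  obtain ⟨v, hv⟩ := isPos_of_map Stab.cornerHom Stab.cornerHom_injective (ha ▸ hz : IsPos _)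
  rw [hv] at ha
  set P : 𝓜(ℂ, Stab M) := toMult p
  have hPs : star P = P := by rw [← map_star, hp]
  have hPz : P * toMult z * P = toMult z := by rw [← map_mul, ← map_mul, hpz]
  have hcomp : ∀ m : 𝓜(ℂ, Stab M), ∀ x : Stab M, m = toMult x →
      ∃ w : M, toMult (Stab.cornerHom w) = P * m * P := by
    rintro m x rfl
    obtain ⟨w, hw⟩ := Stab.exists_cornerHom_eq hu x
    exact ⟨w, by rw [← hw, map_mul, map_mul]⟩
  have hnorm : ∀ w : M, ‖w‖ = ‖(toMult (Stab.cornerHom w) : 𝓜(ℂ, Stab M))‖ := fun w => by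
    rw [norm_toMult, Stab.norm_cornerHom]
  have hPP : P * P = P := by rw [← map_mul, hpp]
  have ha2 : star (toMult (Stab.cornerHom v)) * toMult (Stab.cornerHom v) = toMult z := by
    rw [ha, map_mul, map_mul, map_star, map_star]
  refine ⟨v, fun ε hε => ⟨?_, ?_⟩⟩
  · obtain ⟨R, hR⟩ := cuntzLE_iff.1 hz4 ε hε
    -- The entries of `R` seen as a row: `rᵢ` corresponds to `p R ranᵢ p`. As `p z p = z`,
    -- compressing loses nothing.
    choose r hr using fun i : Fin (k + 1) =>
      hcomp (toMult R * Stab.ran (i : ℕ)) _ (toMult_mul _ _)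
    refine ⟨r, ?_⟩
    have key : toMult (Stab.cornerHom (∑ i, r i * (star v * v) * star (r i) - u)) =
        P * toMult (R * Stab.amp (k + 1) z * star R - p) * P := by
      simp only [map_sub, map_sum, map_mul toMult, map_star toMult, Stab.toMult_amp]
      rw [mul_sub, sub_mul, hPP, hPP, Finset.mul_sum, Finset.sum_mul, Finset.mul_sum,
        Finset.sum_mul]
      congr 1
      refine Finset.sum_congr rfl fun i _ => ?_
      simp only [map_mul, map_star, hr]
      rw [ha2]
      conv_rhs => rw [← hPz]
      rw [star_mul, star_mul, star_mul, hPs]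
      simp only [mul_assoc]
    rw [hnorm, key]
    have hR' := hR.le
    rw [← norm_toMult] at hR'
    calc _ ≤ ‖P‖ * ‖toMult (R * Stab.amp (k + 1) z * star R - p)‖ * ‖P‖ := norm_conj_le _ _ _
      _ ≤ 1 * ε * 1 := by gcongr
      _ = ε := by ring
  · obtain ⟨Q, hQ⟩ := cuntzLE_iff.1 hz3 ε hε
    -- The entries of `Q` seen as a column: `sᵢ` corresponds to `p ranᵢ* Q p`, and `ranᵢ* (amp k z)
    -- ranⱼ = δᵢⱼ z`.
    choose s hs using fun i : Fin k =>
      hcomp (star (Stab.ran (i : ℕ)) * toMult Q) _ (mul_toMult _ _)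
    refine ⟨s, fun i j => ?_⟩
    have key : toMult (Stab.cornerHom (s i * star (s j) - (if i = j then star v * v else 0))) =
        P * (star (Stab.ran (i : ℕ)) * toMult (Q * p * star Q - Stab.amp k z) *
          Stab.ran (j : ℕ)) * P := by
      have e1 : star (Stab.ran (i : ℕ)) * toMult (Stab.amp k z) * Stab.ran (j : ℕ) =
          if i = j then toMult z else 0 := by
        rw [Stab.star_ran_mul_toMult_amp, mul_assoc, Stab.star_ran_mul_ran]
        by_cases hij : i = j
        · rw [if_pos hij, if_pos (congrArg _ hij), mul_one]
        · rw [if_neg hij, if_neg (fun h => hij (Fin.ext h)), mul_zero]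
      have e2 : toMult (Stab.cornerHom (if i = j then star v * v else 0)) =
          (if i = j then toMult z else 0 : 𝓜(ℂ, Stab M)) := by
        split_ifs
        · rw [ha]
        · rw [map_zero, map_zero]
      rw [map_sub, map_sub, e2, map_mul, map_star, map_mul, map_star, hs, hs, map_sub, mul_sub,
        sub_mul, mul_sub, sub_mul, e1]
      congr 1
      · rw [star_mul, star_mul, star_mul, star_star, hPs, map_mul, map_mul, map_star]
        have : toMult p = P * P := hPP.symm
        rw [this]
        simp only [mul_assoc]
      · split_ifs
        · rw [hPz]
        · rw [mul_zero, zero_mul]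
    rw [hnorm, key]
    have hQ' := hQ.le
    rw [← norm_toMult] at hQ'
    calc _ ≤ ‖P‖ * (‖star (Stab.ran (i : ℕ))‖ * ‖toMult (Q * p * star Q - Stab.amp k z)‖ *
          ‖(Stab.ran (j : ℕ) : 𝓜(ℂ, Stab M))‖) * ‖P‖ :=
          (norm_conj_le _ _ _).trans (by gcongr; exact norm_conj_le _ _ _)
      _ ≤ 1 * (1 * ε * 1) * 1 := by
        rw [norm_star]
        have h1 := Stab.norm_ran_le (A := M) (i : ℕ)
        have h2 := Stab.norm_ran_le (A := M) (j : ℕ)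
        gcongr
      _ = ε := by ring

end UnitDivisors
end
end PureCStar

namespace PureCStar
noncomputable section

/-! ### The core argument: a commuting divisor makes `φ` pure -/

section Core

variable {A C : Type*} [NonUnitalCStarAlgebra A] [NonUnitalCStarAlgebra C]

/-- The multiplier `m` commutes with the image of `φ`. -/
def MultComm (φ : A →⋆ₙₐ[ℂ] C) (m : 𝓜(ℂ, C)) : Prop :=
  ∀ a, m * toMult (φ a) = toMult (φ a) * m

theorem MultComm.star {φ : A →⋆ₙₐ[ℂ] C} {m : 𝓜(ℂ, C)} (h : MultComm φ m) :
    MultComm φ (star m) := fun a => by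
  have := congrArg Star.star (h (Star.star a))
  rw [star_mul, star_mul, ← map_star, ← map_star, star_star] at this
  exact this.symm

theorem MultComm.diag {φ : A →⋆ₙₐ[ℂ] C} {m : 𝓜(ℂ, C)} (h : MultComm φ m) :
    MultComm (Stab.map φ) (Stab.diag m) := fun x => by
  rw [mul_toMult, toMult_mul]
  congr 1
  induction x using Stab.induction₁ with
  | hp =>
    exact isClosed_eq ((Stab.diag m).fst.continuous.comp (Stab.continuous_map φ))
      ((Stab.diag m).snd.continuous.comp (Stab.continuous_map φ))
  | h X =>
    rw [Stab.map_coeₗ, Stab.diag_fst, Stab.diag_snd]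
    congr 1
    refine FinMat.ext fun i j => toMult_injective ?_
    have := h (X.entry i j)
    rwa [mul_toMult, toMult_mul] at this

/-- The divisor relations are known only after multiplication by some `φ(a)`. Read entrywise on
finite matrices, and then by density, they hold after multiplication by the elements of `φ(A) ⊗ K`.
-/
theorem toMult_map_mul_diag_eq {φ : A →⋆ₙₐ[ℂ] C} {m n : 𝓜(ℂ, C)}
    (h : ∀ a, toMult (φ a) * m = toMult (φ a) * n) (x : Stab A) :
    toMult (Stab.map φ x) * Stab.diag m = toMult (Stab.map φ x) * Stab.diag n := by
  rw [toMult_mul, toMult_mul]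
  congr 1
  induction x using Stab.induction₁ with
  | hp =>
    exact isClosed_eq ((Stab.diag m).snd.continuous.comp (Stab.continuous_map φ))
      ((Stab.diag n).snd.continuous.comp (Stab.continuous_map φ))
  | h X =>
    rw [Stab.map_coeₗ, Stab.diag_snd, Stab.diag_snd]
    congr 1
    refine FinMat.ext fun i j => toMult_injective ?_
    have := h (X.entry i j)
    rwa [toMult_mul, toMult_mul] at this

/-- There is a positive multiplier `v* v` commuting with the image of `φ` that divides the unit
almost by `k`, approximately on the image of `φ`. -/
def HasDivisor (φ : A →⋆ₙₐ[ℂ] C) (k : ℕ) : Prop :=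
  ∃ v : 𝓜(ℂ, C), MultComm φ v ∧ ∀ ε : ℝ, 0 < ε →
    (∃ (r : Fin (k + 1) → 𝓜(ℂ, C)) (c : 𝓜(ℂ, C)), (∀ i, MultComm φ (r i)) ∧ ‖c‖ ≤ ε ∧
      ∀ a, toMult (φ a) * ∑ i, r i * (star v * v) * star (r i) = toMult (φ a) * (1 + c)) ∧
    ∃ (s : Fin k → 𝓜(ℂ, C)) (d : Fin k → Fin k → 𝓜(ℂ, C)), (∀ i, MultComm φ (s i)) ∧
      (∀ i j, ‖d i j‖ ≤ ε) ∧ ∀ i j a, toMult (φ a) * (s i * star (s j)) =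
        toMult (φ a) * ((if i = j then star v * v else 0) + d i j)

/-- The element `φ(x) v* v` of `C ⊗ K`. -/
def mulDiv (φ : A →⋆ₙₐ[ℂ] C) (v : 𝓜(ℂ, C)) (x : Stab A) : Stab C :=
  multConj (star (Stab.diag v)) (Stab.map φ x)

variable {φ : A →⋆ₙₐ[ℂ] C} {v : 𝓜(ℂ, C)}

theorem isPos_mulDiv {x : Stab A} (hx : IsPos x) : IsPos (mulDiv φ v x) := (hx.map _).multConj _

/-- As the conjugate `v φ(x) v*` with `v` replaced by `v*`, the element is visibly positive;
commutation turns it into a product, the form suited to comparison and to diagonal sums. -/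
theorem toMult_mulDiv (hv : MultComm φ v) (x : Stab A) :
    toMult (mulDiv φ v x) = toMult (Stab.map φ x) * Stab.diag (star v * v) := by
  rw [mulDiv, toMult_multConj, star_star, mul_assoc, ← hv.diag, ← mul_assoc, ← map_star, ← map_mul,
    (by
      intro a
      rw [mul_assoc, hv, ← mul_assoc, hv.star, mul_assoc] : MultComm φ (star v * v)).diag]

theorem mulDiv_amp (hv : MultComm φ v) (n : ℕ) (x : Stab A) :
    mulDiv φ v (Stab.amp n x) = Stab.amp n (mulDiv φ v x) := by
  apply toMult_injective
  rw [toMult_mulDiv hv, Stab.map_amp, Stab.toMult_amp, Stab.toMult_amp, Finset.sum_mul]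
  refine Finset.sum_congr rfl fun i _ => ?_
  have h : Stab.diag (star v * v) * star (Stab.ran (i : ℕ)) =
      star (Stab.ran (i : ℕ)) * Stab.diag (star v * v) := by
    have := congrArg star (Stab.diag_mul_iso (star v * v) (Stab.pairEmb i))
    rw [star_mul, star_mul, ← map_star, star_mul, star_star] at this
    exact this.symm
  rw [toMult_mulDiv hv, mul_assoc, ← h]
  simp only [mul_assoc]

/-- If `r y r*` is close to `x`, multiply by `v* v` on the right: it commutes with `φ(r)*`, so
`φ(r)` conjugates `φ(y) v* v` close to `φ(x) v* v`. -/
theorem mulDiv_cuntzLE (hv : MultComm φ v) {x y : Stab A} (h : CuntzLE x y) :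
    CuntzLE (mulDiv φ v x) (mulDiv φ v y) := by
  have hv2 : MultComm φ (star v * v) := fun a => by
    rw [mul_assoc, hv, ← mul_assoc, hv.star, mul_assoc]
  refine cuntzLE_of_mult fun ε hε => ?_
  set K := ‖Stab.diag (star v * v)‖ + 1
  have hK : 0 < K := by positivity
  obtain ⟨r, hr⟩ := cuntzLE_iff.1 h (ε / K) (div_pos hε hK)
  refine ⟨toMult (Stab.map φ r), ?_⟩
  have key : toMult (Stab.map φ r) * toMult (mulDiv φ v y) * star (toMult (Stab.map φ r)) -
      toMult (mulDiv φ v x) =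
      toMult (Stab.map φ (r * y * star r - x)) * Stab.diag (star v * v) := by
    rw [toMult_mulDiv hv, toMult_mulDiv hv, ← map_star, ← map_star, mul_assoc, mul_assoc,
      hv2.diag, map_sub, map_sub, sub_mul]
    simp only [map_mul, mul_assoc]
  rw [key]
  refine (norm_mul_le _ _).trans ?_
  rw [norm_toMult]
  calc _ ≤ ε / K * K := by
        gcongr
        · exact (NonUnitalStarAlgHom.norm_apply_le _ _).trans hr.le
        · exact le_add_of_nonneg_right zero_le_one
    _ = ε := div_mul_cancel₀ _ hK.ne'

/-- The row `∑ (rᵢ ⊗ 1) ranᵢ*` conjugates the diagonal sum of copies of `φ(x) v* v` to `φ(x) ∑ rᵢ v*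
v rᵢ*`, which is `φ(x)` up to a small error. -/
theorem map_cuntzLE_amp_mulDiv (hv : MultComm φ v) {n : ℕ} (h : ∀ ε : ℝ, 0 < ε →
    ∃ (r : Fin n → 𝓜(ℂ, C)) (c : 𝓜(ℂ, C)), (∀ i, MultComm φ (r i)) ∧ ‖c‖ ≤ ε ∧
      ∀ a, toMult (φ a) * ∑ i, r i * (star v * v) * star (r i) = toMult (φ a) * (1 + c))
    (x : Stab A) : CuntzLE (Stab.map φ x) (Stab.amp n (mulDiv φ v x)) := by
  refine cuntzLE_of_mult fun ε hε => ?_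
  set K := ‖Stab.map φ x‖ + 1
  have hK : 0 < K := by positivity
  obtain ⟨r, c, hr, hc, hrc⟩ := h (ε / K) (div_pos hε hK)
  refine ⟨∑ i, Stab.diag (r i) * star (Stab.ran (i : ℕ)), ?_⟩
  have e1 : (∑ i, Stab.diag (r i) * star (Stab.ran (i : ℕ))) *
      toMult (Stab.amp n (mulDiv φ v x)) *
      star (∑ i, Stab.diag (r i) * star (Stab.ran (i : ℕ))) =
      toMult (Stab.map φ x) * (1 + Stab.diag c) := by
    rw [← Stab.diag_one, ← map_add, ← toMult_map_mul_diag_eq hrc, map_sum, Finset.mul_sum,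
      Finset.sum_mul, Finset.sum_mul]
    refine Finset.sum_congr rfl fun i _ => ?_
    rw [mul_assoc (Stab.diag (r i)), Stab.star_ran_mul_toMult_amp, star_sum, Finset.mul_sum,
      Finset.sum_eq_single i]
    · rw [star_mul, star_star, mul_assoc, mul_assoc, ← mul_assoc (star (Stab.ran (i : ℕ))),
        Stab.star_ran_mul_ran, if_pos rfl, one_mul, toMult_mulDiv hv, ← mul_assoc, ← mul_assoc,
        (hr i).diag]
      simp only [map_mul, map_star, mul_assoc]
    · intro j _ hj
      rw [star_mul, star_star, mul_assoc, mul_assoc, ← mul_assoc (star (Stab.ran (i : ℕ))),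
        Stab.star_ran_mul_ran, if_neg (fun h => hj (Fin.ext h.symm)), zero_mul, mul_zero, mul_zero]
    · simp
  rw [e1, mul_add, mul_one, add_sub_cancel_left]
  refine (norm_mul_le _ _).trans ?_
  rw [norm_toMult]
  calc _ ≤ K * (ε / K) := by
        gcongr
        · exact le_add_of_nonneg_right zero_le_one
        · exact (Stab.norm_diag_le c).trans hc
    _ = ε := mul_div_cancel₀ _ hK.ne'

/-- The column `∑ ranᵢ (sᵢ ⊗ 1)` conjugates `φ(x)` to the block matrix with entries `φ(x) sᵢ sⱼ*`,
which is almost diagonal with entries `φ(x) v* v`. -/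
theorem amp_mulDiv_cuntzLE_map (hv : MultComm φ v) {n : ℕ} (h : ∀ ε : ℝ, 0 < ε →
    ∃ (s : Fin n → 𝓜(ℂ, C)) (d : Fin n → Fin n → 𝓜(ℂ, C)), (∀ i, MultComm φ (s i)) ∧
      (∀ i j, ‖d i j‖ ≤ ε) ∧ ∀ i j a, toMult (φ a) * (s i * star (s j)) =
        toMult (φ a) * ((if i = j then star v * v else 0) + d i j))
    (x : Stab A) : CuntzLE (Stab.amp n (mulDiv φ v x)) (Stab.map φ x) := by
  refine cuntzLE_of_mult fun ε hε => ?_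
  -- There are `n²` blocks, each with an error of at most `‖φ(x)‖` times the tolerance; adding `1`
  -- keeps `K` positive.
  set K := (n : ℝ) * n * ‖Stab.map φ x‖ + 1
  have hK : 0 < K := by positivity
  obtain ⟨s, d, hs, hd, hsd⟩ := h (ε / K) (div_pos hε hK)
  refine ⟨∑ i : Fin n, Stab.ran (i : ℕ) * Stab.diag (s i), ?_⟩
  have e1 : (∑ i : Fin n, Stab.ran (i : ℕ) * Stab.diag (s i)) * toMult (Stab.map φ x) *
      star (∑ i : Fin n, Stab.ran (i : ℕ) * Stab.diag (s i)) - toMult (Stab.amp n (mulDiv φ v x)) =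
      ∑ i : Fin n, ∑ j : Fin n, Stab.ran (i : ℕ) * (toMult (Stab.map φ x) * Stab.diag (d i j)) *
        star (Stab.ran (j : ℕ)) := by
    rw [Stab.toMult_amp, sub_eq_iff_eq_add, Finset.sum_mul, Finset.sum_mul, ← Finset.sum_add_distrib]
    refine Finset.sum_congr rfl fun i _ => ?_
    have e2 : Stab.ran (i : ℕ) * toMult (mulDiv φ v x) * star (Stab.ran (i : ℕ)) =
        ∑ j : Fin n, Stab.ran (i : ℕ) * (toMult (Stab.map φ x) *
          Stab.diag (if i = j then star v * v else 0)) * star (Stab.ran (j : ℕ)) := by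
      rw [Finset.sum_eq_single i]
      · rw [if_pos rfl, toMult_mulDiv hv]
      · intro j _ hj
        rw [if_neg hj.symm, map_zero, mul_zero, mul_zero, zero_mul]
      · simp
    rw [e2, ← Finset.sum_add_distrib, star_sum, Finset.mul_sum]
    refine Finset.sum_congr rfl fun j _ => ?_
    have e3 := toMult_map_mul_diag_eq (hsd i j) x
    rw [map_add, mul_add, add_comm] at e3
    rw [← add_mul, ← mul_add, ← e3, star_mul, mul_assoc (Stab.ran (i : ℕ)), (hs i).diag, map_mul,
      map_star]
    simp only [mul_assoc]
  rw [e1]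
  calc _ ≤ ∑ i : Fin n, ∑ j : Fin n, ‖Stab.map φ x‖ * (ε / K) := by
        refine norm_sum_le_of_le _ fun i _ => norm_sum_le_of_le _ fun j _ => ?_
        have h1 := Stab.norm_ran_le (A := C) (i : ℕ)
        have h2 := Stab.norm_ran_le (A := C) (j : ℕ)
        have h3 : ‖toMult (Stab.map φ x) * Stab.diag (d i j)‖ ≤ ‖Stab.map φ x‖ * (ε / K) := by
          refine (norm_mul_le _ _).trans ?_
          rw [norm_toMult]
          gcongr
          exact (Stab.norm_diag_le _).trans (hd i j)
        refine (norm_conj_le _ _ _).trans ?_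
        rw [norm_star]
        calc _ ≤ 1 * (‖Stab.map φ x‖ * (ε / K)) * 1 := by gcongr
          _ = _ := by ring
    _ = (n : ℝ) * n * ‖Stab.map φ x‖ * (ε / K) := by simp; ring
    _ ≤ K * (ε / K) := by
        gcongr
        exact le_add_of_nonneg_right zero_le_one
    _ = ε := mul_div_cancel₀ _ hK.ne'

/-- Pass from `φ(x)` to `m + 1` copies of `φ(x) h`, apply the hypothesis under `x ↦ φ(x) h`, and
return from `m` copies of `φ(y) h` to `φ(y)`. -/
theorem almostUnperforatedMap_of_hasDivisor (h : ∀ k, k ≠ 0 → HasDivisor φ k) :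
    AlmostUnperforatedMap (Cu.map φ) := by
  rintro x y ⟨m, hm⟩
  induction x using Cu.ind with | h a ha
  induction y using Cu.ind with | h b hb
  rw [Cu.nsmul_mk, Cu.nsmul_mk, Cu.mk_le_mk] at hm
  rw [Cu.map_mk, Cu.map_mk, Cu.mk_le_mk]
  -- Divisors exist only for `k ≠ 0`; for `m = 0` the hypothesis says `x ≤ 0`.
  rcases eq_or_ne m 0 with rfl | hm0
  · have h1 : CuntzLE a b := by
      refine (Stab.cuntzLE_amp (by simp) a).trans (hm.trans ?_)
      rw [Stab.amp_apply, Fin.sum_univ_zero]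
      exact cuntzLE_zero b
    exact Cu.cuntzLE_map _ h1
  · obtain ⟨v, hv, hv2⟩ := h m hm0
    refine (map_cuntzLE_amp_mulDiv hv (fun ε hε => (hv2 ε hε).1) a).trans (.trans ?_
      (amp_mulDiv_cuntzLE_map hv (fun ε hε => (hv2 ε hε).2) b))
    rw [← mulDiv_amp hv, ← mulDiv_amp hv]
    exact mulDiv_cuntzLE hv hm

/-- The witness is `[φ(x) v* v]`, and `[φ(x)]` itself for `k = 0`. No way-below cut-down is needed
at this stage; it enters only through descent and approximation. -/
theorem exists_cu_divisor (h : ∀ k, k ≠ 0 → HasDivisor φ k) (k : ℕ) (x : Cu A) :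
    ∃ z : Cu C, k • z ≤ Cu.map φ x ∧ Cu.map φ x ≤ (k + 1) • z := by
  induction x using Cu.ind with | h a ha
  rcases eq_or_ne k 0 with rfl | hk
  · refine ⟨Cu.map φ (Cu.mk a ha), ?_, ?_⟩
    · rw [zero_nsmul]
      exact cuntzLE_zero _
    · rw [zero_add, one_nsmul]
  · obtain ⟨v, hv, hv2⟩ := h k hk
    refine ⟨Cu.mk (mulDiv φ v a) (isPos_mulDiv ha), ?_, ?_⟩
    · rw [Cu.nsmul_mk, Cu.map_mk, Cu.mk_le_mk]
      exact amp_mulDiv_cuntzLE_map hv (fun ε hε => (hv2 ε hε).2) a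
    · rw [Cu.nsmul_mk, Cu.map_mk, Cu.mk_le_mk]
      exact map_cuntzLE_amp_mulDiv hv (fun ε hε => (hv2 ε hε).1) a

end Core
end
end PureCStar

namespace PureCStar
noncomputable section

/-! ### Lifting norm estimates and Cuntz comparison from a quotient to its coordinates -/

section Lifting

attribute [local instance 50] CStarAlgebra.spectralOrder CStarAlgebra.spectralOrderedRing

/-- Every element in the range of a *-homomorphism has preimages of almost the same norm. -/
theorem exists_map_eq_norm_le {M N : Type*} [NonUnitalCStarAlgebra M] [NonUnitalCStarAlgebra N]
    (f : M →⋆ₙₐ[ℂ] N) (x : M) {ε : ℝ} (hε : 0 < ε) (h : ‖f x‖ ≤ ε) :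
    ∃ y, f y = f x ∧ ‖y‖ ≤ ε := by
  set a := star x * x with ha
  have ha0 : 0 ≤ a := star_mul_self_nonneg x
  have hfa0 : 0 ≤ f a := by rw [ha, map_mul, map_star]; exact star_mul_self_nonneg _
  -- `k` vanishes on `[0, ε²]`, which contains the spectrum of `f(a)`, so `x (1 - k(a))` has the
  -- same image as `x`. It has norm at most `ε` because `t (1 - k(t))² ≤ ε²` for all `t ≥ 0`.
  set k : ℝ → ℝ := fun t => 1 - ε ^ 2 / max t (ε ^ 2) with hk
  have hmax : ∀ t : ℝ, 0 < max t (ε ^ 2) := fun t => lt_max_of_lt_right (by positivity)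
  have hkc : Continuous k :=
    continuous_const.sub (continuous_const.div (by fun_prop) fun t => (hmax t).ne')
  have hk0 : k 0 = 0 := by
    have : max 0 (ε ^ 2) = ε ^ 2 := max_eq_right (by positivity)
    simp only [hk, this]
    rw [div_self (by positivity), sub_self]
  have hfk : f (cfcₙ k a) = 0 := by
    rw [NonUnitalStarAlgHomClass.map_cfcₙ (R := ℝ) (S := ℂ) f k a hkc.continuousOn hk0
      (map_continuous f) ha0.isSelfAdjoint hfa0.isSelfAdjoint]
    rw [cfcₙ_congr (g := fun _ => (0 : ℝ)), cfcₙ_const_zero]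
    intro t ht
    have h1 : t ≤ ‖f a‖ := (le_abs_self t).trans
      (NonUnitalIsometricContinuousFunctionalCalculus.norm_quasispectrum_le (𝕜 := ℝ) (f a) ht
        hfa0.isSelfAdjoint)
    have h2 : ‖f a‖ ≤ ε ^ 2 := by
      rw [ha, map_mul, map_star, CStarRing.norm_star_mul_self, sq]
      gcongr
    have h3 : max t (ε ^ 2) = ε ^ 2 := max_eq_right (h1.trans h2)
    simp only [hk, h3]
    rw [div_self (by positivity), sub_self]
  have hks : star (cfcₙ k a) = cfcₙ k a := (cfcₙ_predicate k a : IsSelfAdjoint _).star_eq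
  refine ⟨x - x * cfcₙ k a, by rw [map_sub, map_mul, hfk, mul_zero, sub_zero], ?_⟩
  have hq : Continuous fun t => t - t * k t := continuous_id.sub (continuous_id.mul hkc)
  have hq0 : (fun t => t - t * k t) 0 = 0 := by simp
  have e1 : star (x - x * cfcₙ k a) * (x - x * cfcₙ k a) =
      cfcₙ (fun t => t - t * k t - k t * (t - t * k t)) a := by
    have e2 : cfcₙ (fun t => t - t * k t) a = a - a * cfcₙ k a := by
      rw [cfcₙ_sub (fun t => t) (fun t => t * k t) a (continuous_id.continuousOn) rfl
        (continuous_id.mul hkc).continuousOn (by simp), cfcₙ_mul (fun t => t) k a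
        continuous_id.continuousOn rfl hkc.continuousOn hk0, cfcₙ_id' ℝ a]
    rw [cfcₙ_sub (fun t => t - t * k t) (fun t => k t * (t - t * k t)) a hq.continuousOn hq0
      (hkc.mul hq).continuousOn (by simp), cfcₙ_mul k (fun t => t - t * k t) a hkc.continuousOn hk0
      hq.continuousOn hq0, e2, star_sub, star_mul, hks, ha]
    simp only [mul_sub, sub_mul, mul_assoc]
    abel
  have e3 : ‖x - x * cfcₙ k a‖ ^ 2 ≤ ε ^ 2 := by
    rw [sq, ← CStarRing.norm_star_mul_self, e1]
    refine norm_cfcₙ_le fun t ht => ?_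
    have ht0 : 0 ≤ t := quasispectrum_nonneg_of_nonneg a ha0 t ht
    have hm := hmax t
    have e4 : t - t * k t - k t * (t - t * k t) = t * (ε ^ 2 / max t (ε ^ 2)) ^ 2 := by
      simp only [hk]; ring
    rw [e4, Real.norm_eq_abs, abs_of_nonneg (by positivity)]
    calc t * (ε ^ 2 / max t (ε ^ 2)) ^ 2
        = (t / max t (ε ^ 2)) * (ε ^ 2 / max t (ε ^ 2)) * ε ^ 2 := by ring
      _ ≤ 1 * 1 * ε ^ 2 := by
          gcongr
          · exact div_le_one_of_le₀ (le_max_left _ _) hm.le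
          · exact div_le_one_of_le₀ (le_max_right _ _) hm.le
      _ = ε ^ 2 := by ring
  exact le_of_sq_le_sq e3 hε.le

variable {L Q B : Type*} [NonUnitalCStarAlgebra L] [NonUnitalCStarAlgebra Q]
  [NonUnitalCStarAlgebra B] {π : L →⋆ₙₐ[ℂ] Q} {ev : ℕ → L →⋆ₙₐ[ℂ] B} {ω : Filter ℕ}

/-- Replace `X` by a matrix `Y` with the same image under `π` and norm at most some `δ < ε`. The
finitely many entries of `X - Y` are killed by `π`, so they vanish along `ω`, and `ev j` is
contractive on `Y`. -/
theorem FinMat.eventually_norm_map_lt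
    (hev : ∀ x, π x = 0 → Tendsto (fun j => ev j x) ω (𝓝 0)) (X : FinMat L) {ε : ℝ}
    (h : ‖map π X‖ < ε) : ∀ᶠ j in ω, ‖map (ev j) X‖ < ε := by
  obtain ⟨n, hn⟩ := X.exists_suppIn
  have hmap' : ∀ j, ‖map (ev j) X‖ = ‖CStarMatrix.mapₙₐ (ev j) (corner n X)‖ := fun j =>
    norm_eq (fun i j hij => by
      change ev _ (X.entry i j) = 0
      rw [hn i j hij, map_zero])
  rw [norm_eq (n := n) (fun i j hij => by
      change π (X.entry i j) = 0
      rw [hn i j hij, map_zero])] at h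
  change ‖CStarMatrix.mapₙₐ π (corner n X)‖ < ε at h
  obtain ⟨δ, hδ, hδε⟩ := exists_between h
  obtain ⟨Y, hY, hYn⟩ := exists_map_eq_norm_le (CStarMatrix.mapₙₐ π) (corner n X)
    ((norm_nonneg _).trans_lt hδ) hδ.le
  have hlim : Tendsto (fun j => CStarMatrix.mapₙₐ (ev j) (corner n X - Y)) ω (𝓝 0) := by
    refine tendsto_pi_nhds.2 fun i => tendsto_pi_nhds.2 fun l => ?_
    refine hev ((corner n X - Y) i l) ?_
    have h1 : CStarMatrix.mapₙₐ π (corner n X - Y) = 0 := by rw [map_sub, hY, sub_self]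
    exact congrFun (congrFun h1 i) l
  filter_upwards [(tendsto_zero_iff_norm_tendsto_zero.1 hlim).eventually
    (gt_mem_nhds (sub_pos.2 hδε))] with j hj
  rw [hmap']
  have h2 : ‖CStarMatrix.mapₙₐ (ev j) Y‖ ≤ δ := (NonUnitalStarAlgHom.norm_apply_le _ _).trans hYn
  have h3 := norm_add_le (CStarMatrix.mapₙₐ (ev j) (corner n X - Y)) (CStarMatrix.mapₙₐ (ev j) Y)
  rw [← map_add, sub_add_cancel] at h3
  linarith

namespace Stab

theorem map_map_of_leftInverse {ψ : L →⋆ₙₐ[ℂ] B} {κ : B →⋆ₙₐ[ℂ] L}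
    (h : Function.LeftInverse ψ κ) (x : Stab B) : map ψ (map κ x) = x := by
  rw [← map_comp]
  induction x using induction₁ with
  | hp => exact isClosed_eq (continuous_map _) continuous_id
  | h X =>
    rw [map_coeₗ]
    congr 1
    ext i l
    exact h _

theorem eventually_norm_map_lt
    (hev : ∀ x, π x = 0 → Tendsto (fun j => ev j x) ω (𝓝 0)) (x : Stab L) {ε : ℝ}
    (h : ‖map π x‖ < ε) : ∀ᶠ j in ω, ‖map (ev j) x‖ < ε := by
  obtain ⟨δ, hδ, hδε⟩ := exists_between h
  obtain ⟨X, hX⟩ := Metric.denseRange_iff.1 denseRange_coeₗ x (min ((δ - ‖map π x‖)) (ε - δ))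
    (lt_min (sub_pos.2 hδ) (sub_pos.2 hδε))
  rw [dist_eq_norm] at hX
  have h1 : ‖FinMat.map π X‖ < δ := by
    rw [← coeₗ.norm_map, ← map_coeₗ]
    have h2 : ‖map π x - map π (coeₗ X)‖ ≤ ‖x - coeₗ X‖ := by
      rw [← map_sub]; exact NonUnitalStarAlgHom.norm_apply_le _ _
    have h3 := norm_sub_norm_le (map π (coeₗ X)) (map π x)
    rw [norm_sub_rev] at h3
    have := hX.trans_le (min_le_left _ _)
    linarith
  filter_upwards [FinMat.eventually_norm_map_lt hev X h1] with j hj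
  rw [← coeₗ.norm_map, ← map_coeₗ] at hj
  have h2 : ‖map (ev j) x - map (ev j) (coeₗ X)‖ ≤ ‖x - coeₗ X‖ := by
    rw [← map_sub]; exact NonUnitalStarAlgHom.norm_apply_le _ _
  have h3 := norm_sub_norm_le (map (ev j) x) (map (ev j) (coeₗ X))
  have := hX.trans_le (min_le_right _ _)
  linarith

theorem exists_map_eq_coeₗ (hπ : Function.Surjective π) (X : FinMat Q) :
    ∃ Y : FinMat L, map π (coeₗ Y) = coeₗ X := by
  obtain ⟨n, hn⟩ := X.exists_suppIn
  choose g hg using hπ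
  refine ⟨.of (fun i j => if i < n ∧ j < n then g (X.entry i j) else 0)
    ⟨n, fun i j h => if_neg (by omega)⟩, ?_⟩
  rw [map_coeₗ]
  congr 1
  ext i j
  change π (if i < n ∧ j < n then g (X.entry i j) else 0) = _
  split_ifs with h
  · exact hg _
  · rw [map_zero, hn i j (by omega)]

/-- Cuntz subequivalence in a reduced product holds approximately in the factors. -/
theorem eventually_cut_cuntzLE (hπ : Function.Surjective π)
    (hev : ∀ x, π x = 0 → Tendsto (fun j => ev j x) ω (𝓝 0)) {x y : Stab L} (hx : IsPos x)
    (hy : IsPos y) (h : CuntzLE (map π x) (map π y)) {ε : ℝ} (hε : 0 < ε) :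
    ∀ᶠ j in ω, CuntzLE (cut ε (map (ev j) x)) (map (ev j) y) := by
  obtain ⟨R, hR⟩ := exists_coeₗ_of_cuntzLE h hε
  obtain ⟨S, hS⟩ := exists_map_eq_coeₗ hπ R
  rw [← hS, ← map_star, ← map_mul, ← map_mul, ← map_sub] at hR
  filter_upwards [eventually_norm_map_lt hev _ hR] with j hj
  rw [map_sub, map_mul, map_mul, map_star, norm_sub_rev] at hj
  exact (cut_cuntzLE_of_norm_sub_le (hx.map _) ((hy.map _).conj _) hj.le).trans (conj_cuntzLE _ _)

end Stab

/-- Approximate divisibility of `φ`, without way-below relations. -/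
def HasApproxDivisors {A C : Type*} [NonUnitalCStarAlgebra A] [NonUnitalCStarAlgebra C]
    (φ : A →⋆ₙₐ[ℂ] C) : Prop :=
  ∀ (k : ℕ) (a : Stab A), IsPos a → ∀ ε : ℝ, 0 < ε → ∃ c : Stab C, IsPos c ∧
    CuntzLE (Stab.amp k c) (Stab.map φ a) ∧
    CuntzLE (cut ε (Stab.map φ a)) (Stab.amp (k + 1) c)

/-- Approximate `c` by `π(c₁)` with `c₁` a positive lift, so that both comparisons hold in the
quotient after small cut-downs of `c₁` and `b`. A single coordinate then satisfies both up to a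
further cut-down, and `c'` is the cut-down of `c₁` there. -/
theorem exists_divisor_descent [ω.NeBot] (hπ : Function.Surjective π)
    (hev : ∀ x, π x = 0 → Tendsto (fun j => ev j x) ω (𝓝 0)) {κ : B →⋆ₙₐ[ℂ] L}
    (hκ : ∀ j b, ev j (κ b) = b) {b : Stab B} (hb : IsPos b) {k l : ℕ} {c : Stab Q} (hc : IsPos c)
    (h1 : CuntzLE (Stab.amp k c) (Stab.map π (Stab.map κ b)))
    (h2 : CuntzLE (Stab.map π (Stab.map κ b)) (Stab.amp l c)) {ε : ℝ} (hε : 0 < ε) :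
    ∃ c' : Stab B, IsPos c' ∧ CuntzLE (Stab.amp k c') b ∧ CuntzLE (cut ε b) (Stab.amp l c') := by
  have hκ' : ∀ j (x : Stab B), Stab.map (ev j) (Stab.map κ x) = x := fun j x =>
    Stab.map_map_of_leftInverse (hκ j) x
  have hb' := (hb.map (Stab.map κ)).map (Stab.map π)
  obtain ⟨δ, hδ2, hδ⟩ := ((h2.exists_cut hb' (hc.map _) (half_pos hε)).and
    self_mem_nhdsWithin).exists
  replace hδ : 0 < δ := hδ
  obtain ⟨g, hg⟩ := hc
  have hcont : Continuous fun g : Stab Q => ‖c - star g * g‖ := by fun_prop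
  -- Approximating a square root by a finite matrix keeps the lift positive. The distance `δ / 4`
  -- leaves room for the cuts: `δ / 4` to get below `c`, another `δ / 4` on passing to a coordinate,
  -- and their sum `δ / 2` is within the `δ` allowed by the upper comparison.
  obtain ⟨G, hG⟩ := Stab.denseRange_coeₗ.exists_mem_open
    (isOpen_Iio.preimage hcont : IsOpen {g : Stab Q | ‖c - star g * g‖ < δ / 4})
    ⟨g, by simp [hg]; positivity⟩
  obtain ⟨H, hH⟩ := Stab.exists_map_eq_coeₗ hπ G
  set c₁ := star (Stab.coeₗ H) * Stab.coeₗ H with hc₁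
  have hc₁p : IsPos c₁ := ⟨_, rfl⟩
  have hc : IsPos c := ⟨g, hg⟩
  have hG' : ‖c - Stab.map π c₁‖ < δ / 4 := by
    rw [hc₁, map_mul, map_star, hH]; exact hG
  have hd4 : (0 : ℝ) ≤ δ / 4 := by positivity
  have hd2 : (0 : ℝ) ≤ δ / 2 := by positivity
  have u1 : CuntzLE (Stab.map π (Stab.amp k (cut (δ / 4) c₁))) (Stab.map π (Stab.map κ b)) := by
    rw [Stab.map_amp, map_cut _ hd4 hc₁p]
    refine (Stab.amp_cuntzLE_amp k ?_).trans h1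
    refine cut_cuntzLE_of_norm_sub_le (hc₁p.map _) hc ?_
    rw [norm_sub_rev]; exact hG'.le
  have u2 : CuntzLE (Stab.map π (Stab.map κ (cut (ε / 2) b)))
      (Stab.map π (Stab.amp l (cut (δ / 2) c₁))) := by
    rw [Stab.map_amp, map_cut _ hd2 hc₁p, map_cut _ (half_pos hε).le hb,
      map_cut _ (half_pos hε).le (hb.map _)]
    refine hδ2.trans ?_
    rw [← map_cut _ hδ.le hc]
    refine Stab.amp_cuntzLE_amp l (cut_cuntzLE_cut hd2 hc (hc₁p.map _) ?_)
    linarith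
  obtain ⟨j, hj1, hj2⟩ := ((Stab.eventually_cut_cuntzLE hπ hev ((isPos_cut _ _).map _) (hb.map _) u1
    (by positivity : 0 < δ / 4)).and (Stab.eventually_cut_cuntzLE hπ hev ((isPos_cut _ _).map _)
      ((isPos_cut _ _).map _) u2 (half_pos hε))).exists
  refine ⟨cut (δ / 2) (Stab.map (ev j) c₁), isPos_cut _ _, ?_, ?_⟩
  · rw [hκ', Stab.map_amp, map_cut _ hd4 hc₁p, ← map_cut _ hd4 (isPos_cut _ _)] at hj1
    refine (Stab.amp_cuntzLE_amp k ?_).trans hj1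
    refine cut_cuntzLE_cut hd4 (hc₁p.map _) (isPos_cut _ _) ?_
    rw [norm_sub_rev]
    linarith [norm_cut_sub_le hd4 (hc₁p.map (Stab.map (ev j)))]
  · rw [hκ', Stab.map_amp, map_cut _ hd2 hc₁p] at hj2
    refine CuntzLE.trans ?_ hj2
    refine cut_cuntzLE_cut (half_pos hε).le hb (isPos_cut _ _) ?_
    rw [norm_sub_rev]
    linarith [norm_cut_sub_le (half_pos hε).le hb]

end Lifting

/-! ### From cut-downs to the way-below relation -/

section Divisibility

variable {A C : Type*} [NonUnitalCStarAlgebra A] [NonUnitalCStarAlgebra C]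

attribute [local instance 50] CStarAlgebra.spectralOrder CStarAlgebra.spectralOrderedRing

/-- Elements way below `[a]` lie below the class of a cut-down of `a`. -/
theorem Cu.exists_le_mk_cut {x : Cu A} {a : Stab A} (ha : IsPos a) (h : WayBelow x (Cu.mk a ha)) :
    ∃ ε : ℝ, 0 < ε ∧ x ≤ Cu.mk (cut ε a) (isPos_cut ε a) := by
  obtain ⟨n, hn⟩ := h (fun n : ℕ => Cu.mk (cut (1 / (n + 1)) a) (isPos_cut _ a)) (fun m n hmn => by
      refine Cu.mk_le_mk.2 (cuntzLE_cut_of_le (by positivity) ?_ a)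
      exact one_div_le_one_div_of_le (by positivity) (by gcongr)) (Cu.mk a ha) ⟨by
        rintro _ ⟨n, rfl⟩
        exact Cu.mk_le_mk.2 (cut_cuntzLE (by positivity) ha), fun y hy => by
        induction y using Cu.ind with | h b hb
        refine Cu.mk_le_mk.2 (cuntzLE_of_forall_cut ha fun ε hε => ?_)
        obtain ⟨n, hn⟩ := exists_nat_one_div_lt hε
        exact (cuntzLE_cut_of_le (by positivity) hn.le a).trans (Cu.mk_le_mk.1 (hy ⟨n, rfl⟩))⟩ le_rfl
  exact ⟨1 / (n + 1), by positivity, hn⟩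

theorem HasApproxDivisors.almostDivisibleMap {φ : A →⋆ₙₐ[ℂ] C} (h : HasApproxDivisors φ) :
    AlmostDivisibleMap (Cu.map φ) := by
  intro k x' x hx
  induction x using Cu.ind with | h a ha
  obtain ⟨ε, hε, hx'⟩ := Cu.exists_le_mk_cut ha hx
  obtain ⟨c, hc, h1, h2⟩ := h k a ha ε hε
  refine ⟨Cu.mk c hc, ?_, ?_⟩
  · rw [Cu.nsmul_mk]; exact Cu.mk_le_mk.2 h1
  · induction x' using Cu.ind with | h a' ha'
    rw [Cu.nsmul_mk]
    refine Cu.mk_le_mk.2 (.trans ?_ h2)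
    rw [← map_cut _ hε.le ha]
    exact Cu.cuntzLE_map _ (Cu.mk_le_mk.1 hx')

end Divisibility
end
end PureCStar

namespace PureCStar
noncomputable section

/-! ### Divisors in relative commutants -/

section RelativeCommutant

variable {D : Type*} [NonUnitalCStarAlgebra D]

/-- The elements `x` with `x e = x` that are annihilated by `Ann(U)`. -/
def Supported (U : Set D) (e x : D) : Prop :=
  x * e = x ∧ ∀ α : D, (∀ t ∈ U ∪ star U, α * t = 0 ∧ t * α = 0) → x * α = 0

/-- Up to `ε`, the element `v* v` divides the supported elements almost by `k`, with witnesses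
in `W`. -/
def ApproxDivides (W U : Set D) (e : D) (k : ℕ) (v : D) (ε : ℝ) : Prop :=
  (∃ (r : Fin (k + 1) → D) (c : D), (∀ i, r i ∈ W) ∧ c ∈ W ∧ ‖c‖ ≤ ε ∧
    ∀ x, Supported U e x → x * ∑ i, r i * (star v * v) * star (r i) = x + x * c) ∧
  ∃ (s : Fin k → D) (d : Fin k → Fin k → D), (∀ i, s i ∈ W) ∧
    (∀ i j, d i j ∈ W ∧ ‖d i j‖ ≤ ε) ∧ ∀ i j x, Supported U e x →
      x * (s i * star (s j)) = x * ((if i = j then star v * v else 0) + d i j)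

/-- Lifting from the quotient by `Ann(U)` leaves errors in `Ann(U)`, which supported elements kill.
So each relation in the quotient becomes an exact identity after multiplication by a supported
element, apart from the small terms `c` and `d i j`. -/
theorem exists_relComm_divisor {U : Set D} (h : UnitAlmostDivisible (RelCommQuot U)) {e : D}
    (he : e ∈ relComm U) {k : ℕ} (hk : k ≠ 0) :
    ∃ v ∈ relComm U, ∀ ε : ℝ, 0 < ε → ApproxDivides (relComm U) U e k v ε := by
  obtain ⟨u, hu, hdiv⟩ := h
  obtain ⟨v, hv⟩ := exists_divisor hu hdiv hk
  have hsurj : Function.Surjective (ann U).quotHom := (ann U).mkₗ_surjective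
  have hker : ∀ {y z : relComm U}, (ann U).quotHom y = (ann U).quotHom z →
      ∀ x, Supported U e x → x * (y : D) = x * (z : D) := fun {y z} hyz x hx => by
    have h1 : y - z ∈ (ann U).toSubmodule := (ann U).mkₗ_eq_iff.1 hyz
    have h2 := hx.2 ((y - z : relComm U) : D) h1
    rwa [NonUnitalStarSubalgebra.coe_sub, mul_sub, sub_eq_zero] at h2
  -- The factor `2` absorbs the fact that the quotient norm need not be attained by a lift.
  have hlift : ∀ (y : RelCommQuot U) {ε : ℝ}, 0 < ε → ‖y‖ ≤ ε / 2 →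
      ∃ c : relComm U, (ann U).quotHom c = y ∧ ‖(c : D)‖ ≤ ε := fun y ε hε hy => by
    obtain ⟨c, hc, hcn⟩ := (ann U).exists_norm_lt y (half_pos hε)
    exact ⟨c, hc, hcn.le.trans (by linarith)⟩
  obtain ⟨w, hw⟩ := hsurj u
  -- The lift `w` of the unit is controlled only against the commutant. Since `e` lies there, `e w -
  -- e ∈ Ann(U)`, and `x = x e` transfers this to `x w = x`.
  have hwx : ∀ x, Supported U e x → x * (w : D) = x := fun x hx => by
    have h1 : (ann U).quotHom (⟨e, he⟩ * w) = (ann U).quotHom ⟨e, he⟩ := by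
      rw [map_mul, hw, (hu _).2]
    have h2 := hker h1 x hx
    rw [NonUnitalStarSubalgebra.coe_mul, ← mul_assoc] at h2
    simpa only [hx.1] using h2
  obtain ⟨V, hV⟩ := hsurj v
  refine ⟨V, V.2, fun ε hε => ?_⟩
  obtain ⟨⟨r, hr⟩, s, hs⟩ := hv (ε / 2) (half_pos hε)
  refine ⟨?_, ?_⟩
  · choose R hR using fun i => hsurj (r i)
    obtain ⟨c, hc, hcn⟩ := hlift _ hε hr
    refine ⟨fun i => R i, c, fun i => (R i).2, c.2, hcn, fun x hx => ?_⟩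
    have h1 : (ann U).quotHom (∑ i, R i * (star V * V) * star (R i)) = (ann U).quotHom (w + c) := by
      rw [map_add, hc, hw, add_sub_cancel, map_sum]
      refine Finset.sum_congr rfl fun i _ => ?_
      simp only [map_mul, map_star, hR, hV]
    have h2 := hker h1 x hx
    rw [NonUnitalStarSubalgebra.coe_add, mul_add, hwx x hx] at h2
    rw [← h2]
    congr 1
    exact (map_sum (NonUnitalStarSubalgebraClass.subtype (relComm U))
      (fun i => R i * (star V * V) * star (R i)) Finset.univ).symm
  · choose S hS using fun i => hsurj (s i)
    choose d hd hdn using fun i j => hlift _ hε (hs i j)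
    refine ⟨fun i => S i, fun i j => d i j, fun i => (S i).2, fun i j => ⟨(d i j).2, hdn i j⟩,
      fun i j x hx => ?_⟩
    have h1 : (ann U).quotHom (S i * star (S j)) =
        (ann U).quotHom ((if i = j then star V * V else 0) + d i j) := by
      rw [map_add, hd, map_mul, map_star, hS, hS]
      split_ifs with hij
      · rw [map_mul, map_star, hV, add_sub_cancel]
      · rw [map_zero, add_sub_cancel]
    have h2 := hker h1 x hx
    have h3 : (((if i = j then star V * V else 0 : relComm U)) : D) =
        if i = j then star (V : D) * V else 0 := by split_ifs <;> rfl
    rw [NonUnitalStarSubalgebra.coe_add, h3] at h2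
    exact h2

theorem mul_comm_of_mem_relComm {U : Set D} {w t : D} (hw : w ∈ relComm U) (ht : t ∈ U) :
    w * t = t * w := (mem_relComm_iff.1 hw t (Or.inl ht)).symm

theorem hasDivisor_of_unitAlmostDivisible {A : Type*} [NonUnitalCStarAlgebra A] {φ : A →⋆ₙₐ[ℂ] D}
    (h : UnitAlmostDivisible (RelCommQuot (Set.range φ))) {e : D}
    (he : ∀ a, e * φ a = φ a ∧ φ a * e = φ a) (k : ℕ) (hk : k ≠ 0) : HasDivisor φ k := by
  have hstar : ∀ t ∈ Set.range φ ∪ star (Set.range φ), t ∈ Set.range φ := by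
    rintro t (ht | ⟨a, ha⟩)
    · exact ht
    · exact ⟨star a, by rw [map_star, ha, star_star]⟩
  have hecomm : e ∈ relComm (Set.range φ) := by
    rw [mem_relComm_iff]
    intro t ht
    obtain ⟨a, rfl⟩ := hstar t ht
    rw [(he a).1, (he a).2]
  have hsupp : ∀ a, Supported (Set.range φ) e (φ a) := fun a =>
    ⟨(he a).2, fun α hα => (hα _ (Or.inl ⟨a, rfl⟩)).2⟩
  have hcomm : ∀ w ∈ relComm (Set.range φ), MultComm φ (toMult w) := fun w hw a => by
    rw [← map_mul, ← map_mul, mul_comm_of_mem_relComm hw ⟨a, rfl⟩]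
  obtain ⟨v, hv, hdiv⟩ := exists_relComm_divisor h hecomm hk
  refine ⟨toMult v, hcomm v hv, fun ε hε => ?_⟩
  obtain ⟨⟨r, c, hr, -, hcn, hrc⟩, s, d, hs, hd, hsd⟩ := hdiv ε hε
  refine ⟨⟨fun i => toMult (r i), toMult c, fun i => hcomm _ (hr i), (norm_toMult c).trans_le hcn,
    fun a => ?_⟩, fun i => toMult (s i), fun i j => toMult (d i j), fun i => hcomm _ (hs i),
    fun i j => (norm_toMult _).trans_le (hd i j).2, fun i j a => ?_⟩
  · rw [mul_add, mul_one, ← map_mul, ← map_add, ← hrc _ (hsupp a), map_mul, map_sum]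
    simp only [map_mul, map_star]
  · have h1 := congrArg toMult (hsd i j _ (hsupp a))
    rw [map_mul, map_mul, map_star, map_mul, map_add] at h1
    rw [h1]
    split_ifs
    · rw [map_mul, map_star]
    · rw [map_zero]

end RelativeCommutant

/-! ### The ultrapower and the purity of `θ` -/

section Ultrapower

variable {A B : Type*} [NonUnitalCStarAlgebra A] [NonUnitalCStarAlgebra B]

/-- Evaluation of bounded sequences. -/
def evalHom (j : ℕ) : lp (fun _ : ℕ => B) ∞ →⋆ₙₐ[ℂ] B where
  toFun x := x j
  map_smul' _ _ := rfl
  map_zero' := rfl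
  map_add' _ _ := rfl
  map_mul' _ _ := rfl
  map_star' _ := rfl

theorem nullIdeal_quotHom_eq_iff {ω : Ultrafilter ℕ} {x y : lp (fun _ : ℕ => B) ∞} :
    (nullIdeal B ω).quotHom x = (nullIdeal B ω).quotHom y ↔
      Tendsto (fun j => x j - y j) ω (𝓝 0) := by
  rw [tendsto_zero_iff_norm_tendsto_zero]
  exact (nullIdeal B ω).mkₗ_eq_iff

theorem tendsto_evalHom {ω : Ultrafilter ℕ} (x : lp (fun _ : ℕ => B) ∞)
    (hx : (nullIdeal B ω).quotHom x = 0) : Tendsto (fun j => evalHom j x) ω (𝓝 0) := by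
  rw [← map_zero (nullIdeal B ω).quotHom, nullIdeal_quotHom_eq_iff] at hx
  exact hx.congr fun j => sub_zero _

/-- The class of `(θ(eₙ))` for a countable approximate unit `(eₙ)`: convergence at infinity gives
convergence along the free ultrafilter. -/
theorem exists_unit_of_isSigmaUnital (hA : IsSigmaUnital A) {ω : Ultrafilter ℕ}
    (hω : (ω : Filter ℕ) ≤ Filter.cofinite) (θ : A →⋆ₙₐ[ℂ] B) :
    ∃ e : Ultrapower B ω, star e = e ∧ ∀ a, e * (diagEmb ω).comp θ a = (diagEmb ω).comp θ a ∧
      (diagEmb ω).comp θ a * e = (diagEmb ω).comp θ a := by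
  obtain ⟨e, he, hea⟩ := hA
  have hθ : Continuous θ := AddMonoidHomClass.continuous_of_bound θ 1 fun x => by
    rw [one_mul]; exact NonUnitalStarAlgHom.norm_apply_le θ x
  rw [Nat.cofinite_eq_atTop] at hω
  set f : lp (fun _ : ℕ => B) ∞ := ⟨fun n => θ (e n), memℓp_infty ⟨1, by
    rintro _ ⟨n, rfl⟩
    exact (NonUnitalStarAlgHom.norm_apply_le θ _).trans (he n).2⟩⟩ with hf
  refine ⟨(nullIdeal B ω).quotHom f, ?_, fun a => ⟨?_, ?_⟩⟩
  · rw [← map_star]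
    congr 1
    ext n
    exact ((he n).1.map θ).star_eq
  · change (nullIdeal B ω).quotHom f * (nullIdeal B ω).quotHom (constHom (θ a)) =
      (nullIdeal B ω).quotHom (constHom (θ a))
    rw [← map_mul, nullIdeal_quotHom_eq_iff]
    have h1 : Tendsto (fun n => θ (e n * a) - θ a) ω (𝓝 (θ a - θ a)) :=
      ((hθ.tendsto a).comp ((hea a).1.mono_left hω)).sub_const _
    rw [sub_self] at h1
    exact h1.congr fun n => by rw [map_mul]; rfl
  · change (nullIdeal B ω).quotHom (constHom (θ a)) * (nullIdeal B ω).quotHom f =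
      (nullIdeal B ω).quotHom (constHom (θ a))
    rw [← map_mul, nullIdeal_quotHom_eq_iff]
    have h1 : Tendsto (fun n => θ (a * e n) - θ a) ω (𝓝 (θ a - θ a)) :=
      ((hθ.tendsto a).comp ((hea a).2.mono_left hω)).sub_const _
    rw [sub_self] at h1
    exact h1.congr fun n => by rw [map_mul]; rfl

theorem map_diagEmb_comp {ω : Ultrafilter ℕ} (θ : A →⋆ₙₐ[ℂ] B) (a : Stab A) :
    Stab.map ((diagEmb ω).comp θ) a =
      Stab.map (nullIdeal B ω).quotHom (Stab.map constHom (Stab.map θ a)) := by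
  rw [Stab.map_comp, diagEmb, Stab.map_comp]

/-- The map from `Cu(B)` to `Cu(B_ω)` reflects the order: up to a cut-down the comparison holds in
some coordinate, and every coordinate of a constant sequence is the original element. -/
theorem cuntzLE_of_map_diagEmb {ω : Ultrafilter ℕ} {x y : Stab B} (hx : IsPos x) (hy : IsPos y)
    (h : CuntzLE (Stab.map (nullIdeal B ω).quotHom (Stab.map constHom x))
      (Stab.map (nullIdeal B ω).quotHom (Stab.map constHom y))) : CuntzLE x y := by
  have hid : ∀ j (x : Stab B), Stab.map (evalHom j) (Stab.map constHom x) = x := fun j x =>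
    Stab.map_map_of_leftInverse (fun _ => rfl) x
  refine cuntzLE_of_forall_cut hx fun ε hε => ?_
  obtain ⟨j, hj⟩ := (Stab.eventually_cut_cuntzLE (nullIdeal B ω).mkₗ_surjective tendsto_evalHom
    (hx.map _) (hy.map _) h hε).exists
  rwa [hid, hid] at hj

theorem isPureHom_of_diagEmb_comp {ω : Ultrafilter ℕ} {θ : A →⋆ₙₐ[ℂ] B}
    (h : ∀ k, k ≠ 0 → HasDivisor ((diagEmb ω).comp θ) k) : IsPureHom θ := by
  refine ⟨fun x y hxy => ?_, HasApproxDivisors.almostDivisibleMap fun k a ha ε hε => ?_⟩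
  · have := almostUnperforatedMap_of_hasDivisor h x y hxy
    induction x using Cu.ind with | h a ha
    induction y using Cu.ind with | h b hb
    rw [Cu.map_mk, Cu.map_mk, Cu.mk_le_mk] at this ⊢
    rw [map_diagEmb_comp, map_diagEmb_comp] at this
    exact cuntzLE_of_map_diagEmb (ha.map _) (hb.map _) this
  · obtain ⟨z, h1, h2⟩ := exists_cu_divisor h k (Cu.mk a ha)
    induction z using Cu.ind with | h c hc
    rw [Cu.nsmul_mk, Cu.map_mk, Cu.mk_le_mk] at h1 h2
    rw [map_diagEmb_comp] at h1 h2
    exact exists_divisor_descent (nullIdeal B ω).mkₗ_surjective tendsto_evalHom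
      (fun _ _ => rfl) (ha.map _) hc h1 h2 hε

end Ultrapower
end
end PureCStar

namespace PureCStar
noncomputable section

/-! ### Purity of a limit of subalgebras whose inclusions have divisors -/

section Limit

attribute [local instance 50] CStarAlgebra.spectralOrder CStarAlgebra.spectralOrderedRing

variable {C : Type*} [NonUnitalCStarAlgebra C] {A : ℕ → Type*}
  [∀ n, NonUnitalCStarAlgebra (A n)] {φ : ∀ n, A n →⋆ₙₐ[ℂ] C}

theorem Stab.map_id (x : Stab C) : map (NonUnitalStarAlgHom.id ℂ C) x = x := by
  induction x using induction₁ with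
  | hp => exact isClosed_eq (continuous_map _) continuous_id
  | h X => rw [map_coeₗ]; rfl

theorem Stab.eventually_exists_map_near
    (h : ∀ c : C, ∃ y : ∀ n, A n, Tendsto (fun n => φ n (y n)) atTop (𝓝 c)) (x : Stab C) {ε : ℝ}
    (hε : 0 < ε) : ∀ᶠ n in atTop, ∃ y : Stab (A n), ‖map (φ n) y - x‖ < ε := by
  obtain ⟨X, hX⟩ := Metric.denseRange_iff.1 denseRange_coeₗ x (ε / 2) (half_pos hε)
  obtain ⟨N, hN⟩ := X.exists_suppIn
  choose y hy using h
  let Y : ∀ n, FinMat (A n) := fun n =>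
    .of (fun i j => if i < N ∧ j < N then y (X.entry i j) n else 0)
      ⟨N, fun i j hij => if_neg (by omega)⟩
  have hsupp : ∀ n, (FinMat.map (φ n) (Y n) - X).SuppIn N := fun n i j hij => by
    change φ n (if i < N ∧ j < N then y (X.entry i j) n else 0) - X.entry i j = 0
    rw [if_neg (by omega), map_zero, hN i j hij, sub_zero]
  have hlim : Tendsto (fun n => FinMat.corner N (FinMat.map (φ n) (Y n) - X)) atTop (𝓝 0) := by
    refine tendsto_pi_nhds.2 fun i => tendsto_pi_nhds.2 fun j => ?_
    have h1 := (hy (X.entry i j)).sub_const (X.entry i j)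
    rw [sub_self] at h1
    refine h1.congr fun n => ?_
    change _ = φ n (if (i : ℕ) < N ∧ (j : ℕ) < N then y (X.entry i j) n else 0) - X.entry i j
    rw [if_pos ⟨i.2, j.2⟩]
  filter_upwards [(tendsto_zero_iff_norm_tendsto_zero.1 hlim).eventually
    (gt_mem_nhds (half_pos hε))] with n hn
  refine ⟨coeₗ (Y n), ?_⟩
  rw [← FinMat.norm_eq (hsupp n), ← coeₗ.norm_map, map_sub] at hn
  rw [dist_eq_norm, norm_sub_rev] at hX
  rw [map_coeₗ]
  have := norm_sub_le_norm_sub_add_norm_sub (coeₗ (FinMat.map (φ n) (Y n))) (coeₗ X) x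
  linarith

theorem Stab.eventually_exists_isPos_map_near
    (h : ∀ c : C, ∃ y : ∀ n, A n, Tendsto (fun n => φ n (y n)) atTop (𝓝 c)) {x : Stab C}
    (hx : IsPos x) {ε : ℝ} (hε : 0 < ε) :
    ∀ᶠ n in atTop, ∃ y : Stab (A n), IsPos y ∧ ‖map (φ n) y - x‖ < ε := by
  obtain ⟨g, rfl⟩ := hx
  have hc : Continuous fun g' : Stab C => ‖star g' * g' - star g * g‖ := by fun_prop
  obtain ⟨δ, hδ, hδε⟩ := Metric.isOpen_iff.1 (isOpen_Iio.preimage hc :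
    IsOpen {g' : Stab C | ‖star g' * g' - star g * g‖ < ε}) g (by simpa)
  filter_upwards [eventually_exists_map_near h g hδ] with n ⟨y, hy⟩
  refine ⟨star y * y, ⟨y, rfl⟩, ?_⟩
  rw [map_mul, map_star]
  exact hδε (mem_ball_iff_norm.2 hy)

/-- A witness of `(m + 1) a ≾ m b` and both elements are approximated at one stage `n`. Injectivity
makes the norm estimate valid in `A n ⊗ K`, so the hypothesis on `φ n` applies to cut-downs there.
-/
theorem almostUnperforated_of_limit (hinj : ∀ n, Function.Injective (φ n))
    (h : ∀ c : C, ∃ y : ∀ n, A n, Tendsto (fun n => φ n (y n)) atTop (𝓝 c))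
    (hφ : ∀ n, AlmostUnperforatedMap (Cu.map (φ n))) : AlmostUnperforated (Cu C) := by
  rintro x y ⟨m, hm⟩
  induction x using Cu.ind with | h a ha
  induction y using Cu.ind with | h b hb
  rw [Cu.nsmul_mk, Cu.nsmul_mk, Cu.mk_le_mk] at hm
  refine Cu.mk_le_mk.2 (cuntzLE_of_forall_cut ha fun ε hε => ?_)
  -- The final comparison of `(a - ε)₊` with `(a' - ε/4)₊` needs `ε / 4` for this cut plus the
  -- distance from `a` to `a'`, which is kept below `ε / 2`. On the other side `b'` is cut by `δ /
  -- 2`, more than its distance to `b`, so that it falls below `b`.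
  obtain ⟨r, hr⟩ := cuntzLE_iff.1 hm (ε / 4) (by positivity)
  have hc : Continuous fun p : Stab C × Stab C × Stab C =>
      ‖p.1 * Stab.amp m p.2.1 * star p.1 - Stab.amp (m + 1) p.2.2‖ := by
    have h1 : ∀ n, Continuous (Stab.amp n : Stab C → Stab C) := fun n =>
      map_continuous (Stab.amp n)
    have := h1 m
    have := h1 (m + 1)
    fun_prop
  obtain ⟨δ, hδ, hδε⟩ := Metric.isOpen_iff.1 (isOpen_Iio.preimage hc :
    IsOpen {p : Stab C × Stab C × Stab C |
      ‖p.1 * Stab.amp m p.2.1 * star p.1 - Stab.amp (m + 1) p.2.2‖ < ε / 4}) (r, b, a) hr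
  obtain ⟨n, ⟨r', hr'⟩, ⟨b', hb', hbb⟩, a', ha', haa⟩ :=
    ((Stab.eventually_exists_map_near h r hδ).and
    ((Stab.eventually_exists_isPos_map_near h hb (half_pos hδ)).and
      (Stab.eventually_exists_isPos_map_near h ha (lt_min hδ (half_pos hε))))).exists
  have h1 : ‖r' * Stab.amp m (cut (δ / 2) b') * star r' - Stab.amp (m + 1) a'‖ < ε / 4 := by
    have e1 : Stab.map (φ n) (r' * Stab.amp m (cut (δ / 2) b') * star r' - Stab.amp (m + 1) a') =
        Stab.map (φ n) r' * Stab.amp m (cut (δ / 2) (Stab.map (φ n) b')) *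
          star (Stab.map (φ n) r') - Stab.amp (m + 1) (Stab.map (φ n) a') := by
      rw [map_sub (Stab.map (φ n)), map_mul (Stab.map (φ n)), map_mul (Stab.map (φ n)),
        map_star (Stab.map (φ n)), Stab.map_amp, Stab.map_amp, map_cut _ (half_pos hδ).le hb']
    rw [← Stab.norm_map (φ n) (hinj n), e1]
    have hmem : (Stab.map (φ n) r', cut (δ / 2) (Stab.map (φ n) b'), Stab.map (φ n) a') ∈
        Metric.ball (r, b, a) δ := by
      have h2 := norm_cut_sub_le (half_pos hδ).le (hb'.map (Stab.map (φ n)))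
      have h3 := norm_sub_le_norm_sub_add_norm_sub (cut (δ / 2) (Stab.map (φ n) b'))
        (Stab.map (φ n) b') b
      rw [Metric.mem_ball, Prod.dist_eq, Prod.dist_eq, max_lt_iff, max_lt_iff]
      refine ⟨?_, ?_, ?_⟩
      · rw [dist_eq_norm]; exact hr'
      · rw [dist_eq_norm]; linarith
      · rw [dist_eq_norm]; exact haa.trans_le (min_le_left _ _)
    have h5 := hδε hmem
    rw [Set.mem_preimage, Set.mem_Iio] at h5
    exact h5
  have hε4 : 0 ≤ ε / 4 := by positivity
  rw [norm_sub_rev] at h1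
  have h2 := (cut_cuntzLE_of_norm_sub_le (ha'.map (Stab.amp (m + 1)))
    (((isPos_cut _ _).map _).conj _) h1.le).trans (conj_cuntzLE _ _)
  rw [← map_cut _ hε4 ha'] at h2
  have h3 := hφ n (Cu.mk _ (isPos_cut (ε / 4) a')) (Cu.mk _ (isPos_cut (δ / 2) b')) ⟨m, by
    rw [Cu.nsmul_mk, Cu.nsmul_mk]; exact Cu.mk_le_mk.2 h2⟩
  rw [Cu.map_mk, Cu.map_mk, Cu.mk_le_mk, map_cut _ hε4 ha', map_cut _ (half_pos hδ).le hb'] at h3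
  refine .trans ?_ (h3.trans (cut_cuntzLE_of_norm_sub_le (hb'.map _) hb hbb.le))
  refine cut_cuntzLE_cut hε4 ha (ha'.map _) ?_
  rw [norm_sub_rev]
  linarith [haa.trans_le (min_le_right _ _)]

/-- A divisor for a slightly cut-down approximant `a'` of `a` at a finite stage serves `a`: the
cut-down lies below `a` and still dominates `(a - ε)₊`. -/
theorem almostDivisible_of_limit
    (h : ∀ c : C, ∃ y : ∀ n, A n, Tendsto (fun n => φ n (y n)) atTop (𝓝 c))
    (hφ : ∀ n k (x : Cu (A n)), ∃ z : Cu C, k • z ≤ Cu.map (φ n) x ∧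
      Cu.map (φ n) x ≤ (k + 1) • z) : AlmostDivisible (Cu C) := by
  have hid : HasApproxDivisors (NonUnitalStarAlgHom.id ℂ C) := by
    intro k a ha ε hε
    obtain ⟨n, a', ha', haa⟩ := (Stab.eventually_exists_isPos_map_near h ha (half_pos hε)).exists
    obtain ⟨z, h1, h2⟩ := hφ n k (Cu.mk _ (isPos_cut (ε / 2) a'))
    induction z using Cu.ind with | h c hc
    rw [Cu.nsmul_mk, Cu.map_mk, Cu.mk_le_mk, map_cut _ (half_pos hε).le ha'] at h1 h2
    rw [Stab.map_id]
    refine ⟨c, hc, h1.trans (cut_cuntzLE_of_norm_sub_le (ha'.map _) ha haa.le), .trans ?_ h2⟩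
    refine cut_cuntzLE_cut (half_pos hε).le ha (ha'.map _) ?_
    rw [norm_sub_rev]
    linarith
  have hmap : ∀ x : Cu C, Cu.map (NonUnitalStarAlgHom.id ℂ C) x = x := fun x => by
    induction x using Cu.ind with | h a ha
    simp only [Cu.map_mk, Stab.map_id]
  intro x k x' hx
  obtain ⟨z, h1, h2⟩ := hid.almostDivisibleMap k x' x hx
  rw [hmap] at h1 h2
  exact ⟨z, h1, h2⟩

theorem isPure_of_limit (hinj : ∀ n, Function.Injective (φ n))
    (h : ∀ c : C, ∃ y : ∀ n, A n, Tendsto (fun n => φ n (y n)) atTop (𝓝 c))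
    (hφ : ∀ n k, k ≠ 0 → HasDivisor (φ n) k) : IsPure C :=
  ⟨almostUnperforated_of_limit hinj h fun n => almostUnperforatedMap_of_hasDivisor (hφ n),
    almostDivisible_of_limit h fun n => exists_cu_divisor (hφ n)⟩

end Limit
end
end PureCStar

namespace PureCStar
noncomputable section

/-! ### Elements of the idealizer as multipliers -/

section Idealizer

variable {D : Type*} [NonUnitalCStarAlgebra D]

/-- The idealizer of a subalgebra. -/
def idealizer (C : NonUnitalStarSubalgebra ℂ D) : NonUnitalStarSubalgebra ℂ D where
  carrier := {w | ∀ c ∈ C, w * c ∈ C ∧ c * w ∈ C}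
  zero_mem' c _ := by simp
  add_mem' {x y} hx hy c hc := by
    rw [add_mul, mul_add]
    exact ⟨add_mem (hx c hc).1 (hy c hc).1, add_mem (hx c hc).2 (hy c hc).2⟩
  smul_mem' z x hx c hc := by
    rw [smul_mul_assoc, mul_smul_comm]
    exact ⟨SMulMemClass.smul_mem z (hx c hc).1, SMulMemClass.smul_mem z (hx c hc).2⟩
  mul_mem' {x y} hx hy c hc := by
    rw [mul_assoc, ← mul_assoc c]
    exact ⟨(hx _ (hy c hc).1).1, (hy _ (hx c hc).2).2⟩
  star_mem' {x} hx c hc := by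
    have h := hx (star c) (star_mem hc)
    exact ⟨by simpa using star_mem h.2, by simpa using star_mem h.1⟩

variable (C : NonUnitalStarSubalgebra ℂ D) [IsClosed (C : Set D)]

/-- Multipliers from elements of the idealizer. -/
def multHom : idealizer C →⋆ₙₐ[ℂ] 𝓜(ℂ, C) where
  toFun w :=
    { fst := LinearMap.mkContinuous
        { toFun := fun x => ⟨w * x, (w.2 x x.2).1⟩
          map_add' := fun _ _ => Subtype.ext (mul_add _ _ _)
          map_smul' := fun _ _ => Subtype.ext (mul_smul_comm _ _ _) } ‖(w : D)‖
        fun x => norm_mul_le (w : D) x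
      snd := LinearMap.mkContinuous
        { toFun := fun x => ⟨x * w, (w.2 x x.2).2⟩
          map_add' := fun _ _ => Subtype.ext (add_mul _ _ _)
          map_smul' := fun _ _ => Subtype.ext (smul_mul_assoc _ _ _) } ‖(w : D)‖
        fun x => (norm_mul_le (x : D) w).trans_eq (mul_comm _ _)
      central := fun _ _ => Subtype.ext (mul_assoc _ _ _) }
  map_smul' _ _ := DoubleCentralizer.ext _ _ _ _ (Prod.ext
    (ContinuousLinearMap.ext fun _ => Subtype.ext (smul_mul_assoc _ _ _))
    (ContinuousLinearMap.ext fun _ => Subtype.ext (mul_smul_comm _ _ _)))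
  map_zero' := DoubleCentralizer.ext _ _ _ _ (Prod.ext
    (ContinuousLinearMap.ext fun _ => Subtype.ext (zero_mul _))
    (ContinuousLinearMap.ext fun _ => Subtype.ext (mul_zero _)))
  map_add' _ _ := DoubleCentralizer.ext _ _ _ _ (Prod.ext
    (ContinuousLinearMap.ext fun _ => Subtype.ext (add_mul _ _ _))
    (ContinuousLinearMap.ext fun _ => Subtype.ext (mul_add _ _ _)))
  map_mul' _ _ := DoubleCentralizer.ext _ _ _ _ (Prod.ext
    (ContinuousLinearMap.ext fun _ => Subtype.ext (mul_assoc _ _ _))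
    (ContinuousLinearMap.ext fun _ => Subtype.ext (mul_assoc _ _ _).symm))
  map_star' w := DoubleCentralizer.ext _ _ _ _ (Prod.ext
    (ContinuousLinearMap.ext fun x => Subtype.ext (star_star_mul (x : D) w).symm)
    (ContinuousLinearMap.ext fun x => Subtype.ext (star_mul_star (w : D) x).symm))

theorem norm_multHom_le (w : idealizer C) : ‖multHom C w‖ ≤ ‖(w : D)‖ := by
  rw [← DoubleCentralizer.norm_fst]
  exact ContinuousLinearMap.opNorm_le_bound _ (norm_nonneg _) fun x => norm_mul_le (w : D) x

theorem toMult_mul_multHom (x : C) (w : idealizer C) :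
    toMult x * multHom C w = toMult ⟨x * w, (w.2 x x.2).2⟩ := toMult_mul _ _

theorem multHom_mul_toMult (x : C) (w : idealizer C) :
    multHom C w * toMult x = toMult ⟨w * x, (w.2 x x.2).1⟩ := mul_toMult _ _

variable {C} {E : NonUnitalStarSubalgebra ℂ D} [IsClosed (E : Set D)]

/-- The witnesses in `W` need not belong to `C`; idealizing `C` is enough for them to act as
multipliers. Commutation and the divisor relations are required only against elements of `E`. -/
theorem hasDivisor_inclusion (h : E ≤ C) {W U : Set D} {e v : D} {k : ℕ}
    (hW : ∀ w ∈ W, w ∈ idealizer C ∧ ∀ x ∈ E, w * x = x * w) (hv : v ∈ W)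
    (hE : ∀ x ∈ E, Supported U e x) (hdiv : ∀ ε : ℝ, 0 < ε → ApproxDivides W U e k v ε) :
    HasDivisor (NonUnitalStarSubalgebra.inclusion h) k := by
  have hcomm : ∀ w (hw : w ∈ W),
      MultComm (NonUnitalStarSubalgebra.inclusion h) (multHom C ⟨w, (hW w hw).1⟩) := fun w hw a => by
    rw [multHom_mul_toMult, toMult_mul_multHom]
    congr 1
    exact Subtype.ext ((hW w hw).2 a a.2)
  have hsub : ∀ y z : idealizer C, ∀ a : E, (a : D) * y = a * z →
      toMult (NonUnitalStarSubalgebra.inclusion h a) * multHom C y =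
        toMult (NonUnitalStarSubalgebra.inclusion h a) * multHom C z := fun y z a hyz => by
    rw [toMult_mul_multHom, toMult_mul_multHom]
    congr 1
    exact Subtype.ext hyz
  set V : idealizer C := ⟨v, (hW v hv).1⟩ with hV
  refine ⟨multHom C V, hcomm v hv, fun ε hε => ?_⟩
  obtain ⟨⟨r, c, hr, hc, hcn, hrc⟩, s, d, hs, hd, hsd⟩ := hdiv ε hε
  set R : Fin (k + 1) → idealizer C := fun i => ⟨r i, (hW _ (hr i)).1⟩ with hR
  set S : Fin k → idealizer C := fun i => ⟨s i, (hW _ (hs i)).1⟩ with hS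
  refine ⟨⟨fun i => multHom C (R i), multHom C ⟨c, (hW c hc).1⟩, fun i => hcomm _ (hr i),
    (norm_multHom_le _ _).trans hcn, fun a => ?_⟩, fun i => multHom C (S i),
    fun i j => multHom C ⟨d i j, (hW _ (hd i j).1).1⟩, fun i => hcomm _ (hs i),
    fun i j => (norm_multHom_le _ _).trans (hd i j).2, fun i j a => ?_⟩
  · have h1 : ∑ i, multHom C (R i) * (star (multHom C V) * multHom C V) * star (multHom C (R i)) =
        multHom C (∑ i, R i * (star V * V) * star (R i)) := by
      simp only [map_sum, map_mul, map_star]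
    rw [h1, mul_add, mul_one, toMult_mul_multHom, toMult_mul_multHom, ← map_add]
    congr 1
    refine Subtype.ext ?_
    have h2 : ((∑ i, R i * (star V * V) * star (R i) : idealizer C) : D) =
        ∑ i, r i * (star v * v) * star (r i) :=
      map_sum (NonUnitalStarSubalgebraClass.subtype (idealizer C))
        (fun i => R i * (star V * V) * star (R i)) Finset.univ
    change (a : D) * _ = a + a * c
    rw [h2]
    exact hrc a (hE a a.2)
  · have h1 : (if i = j then star (multHom C V) * multHom C V else 0) =
        multHom C (if i = j then star V * V else 0) := by
      split_ifs
      · rw [map_mul, map_star]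
      · rw [map_zero]
    rw [h1, ← map_add, ← map_star, ← map_mul]
    refine hsub _ _ _ ?_
    have h2 : ((if i = j then star V * V else 0 : idealizer C) : D) =
        if i = j then star v * v else 0 := by split_ifs <;> rfl
    rw [NonUnitalStarSubalgebra.coe_add, h2]
    exact hsd i j a (hE a a.2)

end Idealizer

/-! ### Countably generated subalgebras, commutants and annihilators -/

section Separable

variable {D : Type*} [NonUnitalCStarAlgebra D]

/-- It is contained in the image of the free semigroup on `s`, whose elements are a head and a
finite list. -/
theorem countable_subsemigroup_closure {M : Type*} [Semigroup M] {s : Set M} (hs : s.Countable) :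
    (Subsemigroup.closure s : Set M).Countable := by
  have : Countable s := hs.to_subtype
  have : Countable (FreeSemigroup s) :=
    Function.Injective.countable (f := fun x : FreeSemigroup s => (x.head, x.tail))
      fun x y h => by
        ext1
        · exact congrArg Prod.fst h
        · exact congrArg Prod.snd h
  have hle : Subsemigroup.closure s ≤ (FreeSemigroup.lift (Subtype.val : s → M)).srange :=
    Subsemigroup.closure_le.2 fun x hx => ⟨FreeSemigroup.of ⟨x, hx⟩, by simp⟩
  exact (Set.countable_range (FreeSemigroup.lift (Subtype.val : s → M))).mono hle

/-- The C*-subalgebra generated by a set. -/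
def genAlg (G : Set D) : NonUnitalStarSubalgebra ℂ D :=
  (NonUnitalStarAlgebra.adjoin ℂ G).topologicalClosure

theorem isClosed_genAlg (G : Set D) : IsClosed (genAlg G : Set D) := isClosed_closure

theorem subset_genAlg (G : Set D) : G ⊆ genAlg G :=
  (NonUnitalStarAlgebra.subset_adjoin ℂ G).trans subset_closure

theorem genAlg_le {G : Set D} {S : NonUnitalStarSubalgebra ℂ D} (hS : IsClosed (S : Set D))
    (h : G ⊆ S) : genAlg G ≤ S :=
  NonUnitalStarSubalgebra.topologicalClosure_minimal _ (NonUnitalStarAlgebra.adjoin_le h) hS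

theorem genAlg_mono {G H : Set D} (h : G ⊆ H) : genAlg G ≤ genAlg H :=
  genAlg_le (isClosed_genAlg H) (h.trans (subset_genAlg H))

theorem isSeparable_genAlg {G : Set D} (hG : G.Countable) :
    TopologicalSpace.IsSeparable (genAlg G : Set D) := by
  have h1 : ((NonUnitalStarAlgebra.adjoin ℂ G : NonUnitalStarSubalgebra ℂ D) : Set D) =
      (Submodule.span ℂ (Subsemigroup.closure (G ∪ star G) : Set D) : Set D) :=
    congrArg (fun S : Submodule ℂ D => (S : Set D)) (NonUnitalStarAlgebra.adjoin_eq_span G)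
  have h2 : (star G).Countable := by rw [← Set.image_star]; exact hG.image _
  have h3 := (countable_subsemigroup_closure (hG.union h2)).isSeparable.span (R := ℂ)
  rw [← h1] at h3
  exact h3.closure

/-- Commutation is symmetric. In this form the right side is containment in a closed subalgebra, so
it passes from generators to generated C*-algebras. -/
theorem mem_relComm_iff_subset {U : Set D} {w : D} : w ∈ relComm U ↔ U ⊆ relComm {w} := by
  constructor
  · intro hw t ht
    refine mem_relComm_iff.2 fun s hs => ?_
    rcases hs with rfl | hs
    · exact mul_comm_of_mem_relComm hw ht
    · rw [Set.mem_star, Set.mem_singleton_iff, star_eq_iff_star_eq] at hs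
      rw [← hs]
      exact mul_comm_of_mem_relComm (star_mem hw) ht
  · intro h
    refine mem_relComm_iff.2 fun t ht => ?_
    have h1 : t ∈ relComm {w} := by
      rcases ht with ht | ht
      · exact h ht
      · simpa using star_mem (h ht)
    exact mul_comm_of_mem_relComm h1 rfl

theorem mem_relComm_singleton {e x : D} (he : star e = e) : x ∈ relComm {e} ↔ x * e = e * x := by
  rw [mem_relComm_iff]
  simp [Set.star_singleton, he, eq_comm]

/-- The elements on which `e` acts as a unit. -/
def unitPart (e : D) (he : star e = e) : NonUnitalStarSubalgebra ℂ D where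
  carrier := {x | e * x = x ∧ x * e = x}
  zero_mem' := by simp
  add_mem' {x y} hx hy := by
    refine ⟨?_, ?_⟩
    · rw [mul_add, hx.1, hy.1]
    · rw [add_mul, hx.2, hy.2]
  smul_mem' z x hx := by
    refine ⟨?_, ?_⟩
    · rw [mul_smul_comm, hx.1]
    · rw [smul_mul_assoc, hx.2]
  mul_mem' {x y} hx hy := by
    refine ⟨?_, ?_⟩
    · rw [← mul_assoc, hx.1]
    · rw [mul_assoc, hy.2]
  star_mem' {x} hx := by
    refine ⟨?_, ?_⟩
    · rw [← he, ← star_mul, hx.2]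
    · rw [← he, ← star_mul, hx.1]

theorem isClosed_unitPart (e : D) (he : star e = e) : IsClosed (unitPart e he : Set D) :=
  (isClosed_eq (by fun_prop) continuous_id).inter (isClosed_eq (by fun_prop) continuous_id)

/-- The elements annihilated by `P`. -/
def annihilated (P : Set D) : NonUnitalStarSubalgebra ℂ D where
  carrier := {x | ∀ α ∈ P ∪ star P, x * α = 0 ∧ α * x = 0}
  zero_mem' α _ := by simp
  add_mem' {x y} hx hy α hα := by
    rw [add_mul, mul_add, (hx α hα).1, (hx α hα).2, (hy α hα).1, (hy α hα).2, add_zero]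
    exact ⟨rfl, rfl⟩
  smul_mem' z x hx α hα := by
    rw [smul_mul_assoc, mul_smul_comm, (hx α hα).1, (hx α hα).2, smul_zero]
    exact ⟨rfl, rfl⟩
  mul_mem' {x y} hx hy α hα := by
    rw [mul_assoc, (hy α hα).1, mul_zero, ← mul_assoc, (hx α hα).2, zero_mul]
    exact ⟨rfl, rfl⟩
  star_mem' {x} hx α hα := by
    have h := hx (star α) (by
      rcases hα with h | h
      · exact Or.inr (by simpa using h)
      · exact Or.inl h)
    refine ⟨?_, ?_⟩
    · simpa using congrArg star h.2
    · simpa using congrArg star h.1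

theorem isClosed_annihilated (P : Set D) : IsClosed (annihilated P : Set D) := by
  have : (annihilated P : Set D) = ⋂ α ∈ P ∪ star P, {x | x * α = 0 ∧ α * x = 0} := by
    ext x
    simp only [Set.mem_iInter]
    rfl
  rw [this]
  exact isClosed_biInter fun α _ =>
    (isClosed_eq (by fun_prop) continuous_const).inter (isClosed_eq (by fun_prop) continuous_const)

/-- An `α` annihilating `T` and `C*(G)` annihilates all of `C*(T ∪ G)`, because the elements
annihilated by `α` and `α*` form a C*-subalgebra. -/
theorem supported_of_mem_genAlg {T G : Set D} {e x : D} (hx : x ∈ genAlg (T ∪ G))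
    (hxe : x * e = x) : Supported (T ∪ genAlg G) e x := by
  refine ⟨hxe, fun α hα => ?_⟩
  have h1 : genAlg (T ∪ G) ≤ annihilated {α} := by
    refine genAlg_le (isClosed_annihilated _) fun t ht => ?_
    have ht' : t ∈ T ∪ (genAlg G : Set D) := ht.imp id fun h => subset_genAlg G h
    rintro β (rfl | hβ)
    · exact ⟨(hα t (Or.inl ht')).2, (hα t (Or.inl ht')).1⟩
    · rw [Set.mem_star, Set.mem_singleton_iff] at hβ
      have h2 := hα (star t) (Or.inr (by rwa [Set.mem_star, star_star]))
      rw [← hβ, ← star_mul, ← star_mul, star_eq_zero, star_eq_zero] at h2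
      exact h2
  exact (h1 hx α (Or.inl rfl)).1

end Separable
end
end PureCStar

namespace PureCStar
noncomputable section

/-! ### The pure subalgebra of the ultrapower -/

section Construction

variable {D : Type*} [NonUnitalCStarAlgebra D]

/-- One tolerance uses finitely many witnesses, so countably many tolerances and divisors can be
adjoined without losing separability. -/
theorem ApproxDivides.exists_finite {W U : Set D} {e v : D} {k : ℕ} {ε : ℝ}
    (h : ApproxDivides W U e k v ε) :
    ∃ F : Set D, F.Finite ∧ F ⊆ W ∧ ApproxDivides F U e k v ε := by
  obtain ⟨⟨r, c, hr, hc, hcn, hrc⟩, s, d, hs, hd, hsd⟩ := h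
  refine ⟨Set.range r ∪ {c} ∪ (Set.range s ∪ Set.range fun p : Fin k × Fin k => d p.1 p.2),
    ((Set.finite_range _).union (Set.finite_singleton c)).union
      ((Set.finite_range _).union (Set.finite_range _)), ?_,
    ⟨r, c, fun i => Or.inl (Or.inl ⟨i, rfl⟩), Or.inl (Or.inr rfl), hcn, hrc⟩,
    s, d, fun i => Or.inr (Or.inl ⟨i, rfl⟩),
    fun i j => ⟨Or.inr (Or.inr ⟨(i, j), rfl⟩), (hd i j).2⟩, hsd⟩
  rintro x ((⟨i, rfl⟩ | rfl) | ⟨i, rfl⟩ | ⟨⟨i, j⟩, rfl⟩)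
  exacts [hr i, hc, hs i, (hd i j).1]

theorem ApproxDivides.mono {W W' U : Set D} {e v : D} {k : ℕ} {ε ε' : ℝ}
    (h : ApproxDivides W U e k v ε) (hW : W ⊆ W') (hε : ε ≤ ε') : ApproxDivides W' U e k v ε' := by
  obtain ⟨⟨r, c, hr, hc, hcn, hrc⟩, s, d, hs, hd, hsd⟩ := h
  exact ⟨⟨r, c, fun i => hW (hr i), hW hc, hcn.trans hε, hrc⟩, s, d, fun i => hW (hs i),
    fun i j => ⟨hW (hd i j).1, (hd i j).2.trans hε⟩, hsd⟩

/-- Countable sets of elements that commute with `T` and with `e`. -/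
structure IsAdmissible (T : Set D) (e : D) (G : Set D) : Prop where
  countable : G.Countable
  subset : G ⊆ relComm T
  comm : G ⊆ relComm {e}
  mem : e ∈ G

variable {T : Set D} {e : D}

theorem mem_relComm_union_genAlg {G : Set D} (hT : e ∈ relComm T) (hG : G ⊆ relComm {e}) :
    e ∈ relComm (T ∪ genAlg G) :=
  mem_relComm_iff_subset.2 (Set.union_subset (mem_relComm_iff_subset.1 hT)
    (genAlg_le (isClosed_relComm _) hG))

/-- Apply the hypothesis to the separable algebra `C*(G)` and adjoin the resulting divisors with
their witnesses, for all `k ≠ 0` and the tolerances `1 / (n + 1)`. -/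
theorem IsAdmissible.exists_extension (he : star e = e) (hT : e ∈ relComm T)
    (h : ∀ S : NonUnitalStarSubalgebra ℂ D, IsClosed (S : Set D) →
      TopologicalSpace.IsSeparable (S : Set D) → S ≤ relComm T →
      UnitAlmostDivisible (RelCommQuot (T ∪ (S : Set D)))) {G : Set D} (hG : IsAdmissible T e G) :
    ∃ G', IsAdmissible T e G' ∧ G ⊆ G' ∧ ∀ k, k ≠ 0 →
      ∃ v ∈ G' ∩ relComm (T ∪ genAlg G), ∀ ε : ℝ, 0 < ε →
        ApproxDivides (G' ∩ relComm (T ∪ genAlg G)) (T ∪ genAlg G) e k v ε := by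
  set U : Set D := T ∪ genAlg G with hU
  have hS := h (genAlg G) (isClosed_genAlg G) (isSeparable_genAlg hG.countable)
    (genAlg_le (isClosed_relComm T) hG.subset)
  have heU : e ∈ relComm U := mem_relComm_union_genAlg hT hG.comm
  choose v hv hdiv using fun k : ℕ => exists_relComm_divisor hS heU k.succ_ne_zero
  choose F hFf hFU hF using fun k n : ℕ => (hdiv k (1 / (n + 1)) (by positivity)).exists_finite
  set W : Set D := Set.range v ∪ ⋃ k, ⋃ n, F k n with hW
  have hWU : W ⊆ relComm U := by
    rintro x (⟨k, rfl⟩ | hx)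
    · exact hv k
    · obtain ⟨k, hx⟩ := Set.mem_iUnion.1 hx
      obtain ⟨n, hx⟩ := Set.mem_iUnion.1 hx
      exact hFU k n hx
  refine ⟨G ∪ W, ⟨?_, ?_, ?_, Or.inl hG.mem⟩, Set.subset_union_left, ?_⟩
  · exact hG.countable.union ((Set.countable_range v).union (Set.countable_iUnion fun k =>
      Set.countable_iUnion fun n => (hFf k n).countable))
  · refine Set.union_subset hG.subset fun w hw => mem_relComm_iff_subset.2 ?_
    exact Set.subset_union_left.trans (mem_relComm_iff_subset.1 (hWU hw))
  -- This is why `e` is kept in `G`: new witnesses commute with `C*(G)`, hence with `e`.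
  · refine Set.union_subset hG.comm fun w hw => (mem_relComm_singleton he).2 ?_
    exact mul_comm_of_mem_relComm (hWU hw) (Or.inr (subset_genAlg G hG.mem))
  · intro k hk
    obtain ⟨k, rfl⟩ := Nat.exists_eq_succ_of_ne_zero hk
    refine ⟨v k, ⟨Or.inr (Or.inl ⟨k, rfl⟩), hv k⟩, fun ε hε => ?_⟩
    obtain ⟨n, hn⟩ := exists_nat_one_div_lt hε
    exact (hF k n).mono (fun x hx => ⟨Or.inr (Or.inr (Set.mem_iUnion₂.2 ⟨k, n, hx⟩)), hFU k n hx⟩)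
      hn.le

theorem exists_admissible_seq (he : star e = e) (hT : e ∈ relComm T)
    (h : ∀ S : NonUnitalStarSubalgebra ℂ D, IsClosed (S : Set D) →
      TopologicalSpace.IsSeparable (S : Set D) → S ≤ relComm T →
      UnitAlmostDivisible (RelCommQuot (T ∪ (S : Set D)))) :
    ∃ G : ℕ → Set D, (∀ n, IsAdmissible T e (G n)) ∧ Monotone G ∧ ∀ n k, k ≠ 0 →
      ∃ v ∈ G (n + 1) ∩ relComm (T ∪ genAlg (G n)), ∀ ε : ℝ, 0 < ε →
        ApproxDivides (G (n + 1) ∩ relComm (T ∪ genAlg (G n))) (T ∪ genAlg (G n)) e k v ε := by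
  choose f hf using fun G : {G : Set D // IsAdmissible T e G} => G.2.exists_extension he hT h
  have h0 : IsAdmissible T e {e} := ⟨Set.countable_singleton e, Set.singleton_subset_iff.2 hT,
    Set.singleton_subset_iff.2 ((mem_relComm_singleton he).2 rfl), rfl⟩
  let G : ℕ → {G : Set D // IsAdmissible T e G} :=
    fun n => Nat.rec ⟨{e}, h0⟩ (fun _ G => ⟨f G, (hf G).1⟩) n
  exact ⟨fun n => (G n).1, fun n => (G n).2, monotone_nat_of_le_succ fun n => (hf (G n)).2.1,
    fun n => (hf (G n)).2.2⟩

/-- Each step's divisors commute with the previous stage and are absorbed by the next, so the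
closure `C` of the union contains divided copies of everything in it, up to approximation. -/
theorem exists_isPure (he : star e = e) (heT : ∀ t ∈ T, e * t = t ∧ t * e = t)
    (h : ∀ S : NonUnitalStarSubalgebra ℂ D, IsClosed (S : Set D) →
      TopologicalSpace.IsSeparable (S : Set D) → S ≤ relComm T →
      UnitAlmostDivisible (RelCommQuot (T ∪ (S : Set D)))) :
    ∃ (C : NonUnitalStarSubalgebra ℂ D) (_ : IsClosed (C : Set D)), T ⊆ C ∧ IsPure C := by
  have hT : e ∈ relComm T := mem_relComm_iff_subset.2 fun t ht =>
    (mem_relComm_singleton he).2 ((heT t ht).2.trans (heT t ht).1.symm)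
  obtain ⟨G, hG, hmono, hdiv⟩ := exists_admissible_seq he hT h
  -- The elements of `G n` need not be fixed by `e`, while the divisor relations hold only against
  -- elements `x` with `x e = x`; hence the restriction to the part where `e` is a unit.
  let E : ℕ → NonUnitalStarSubalgebra ℂ D := fun n => genAlg (T ∪ G n) ⊓ unitPart e he
  have hEclosed : ∀ n, IsClosed (E n : Set D) := fun n =>
    (isClosed_genAlg _).inter (isClosed_unitPart e he)
  have hEmono : Monotone E := fun m n hmn =>
    inf_le_inf_right _ (genAlg_mono (Set.union_subset_union_right T (hmono hmn)))
  let C : NonUnitalStarSubalgebra ℂ D := (⨆ n, E n).topologicalClosure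
  have hC : (C : Set D) = closure (⋃ n, (E n : Set D)) :=
    congrArg closure (NonUnitalStarSubalgebra.coe_iSup_of_directed hEmono.directed_le)
  have hCclosed : IsClosed (C : Set D) := isClosed_closure
  have hEC : ∀ n, E n ≤ C := fun n => (le_iSup E n).trans
    (NonUnitalStarSubalgebra.le_topologicalClosure _)
  have hW : ∀ n, ∀ w ∈ G (n + 1) ∩ relComm (T ∪ genAlg (G n)),
      w ∈ idealizer C ∧ ∀ x ∈ E n, w * x = x * w := by
    intro n w hw
    have hwe : w * e = e * w := (mem_relComm_singleton he).1 ((hG (n + 1)).comm hw.1)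
    refine ⟨?_, fun x hx => ?_⟩
    -- From stage `n + 1` on, `w` lies in the generated algebra, and since it commutes with `e`,
    -- multiplication by it preserves the part on which `e` is a unit.
    · have hmul : ∀ m, n + 1 ≤ m → ∀ x ∈ E m, w * x ∈ E m ∧ x * w ∈ E m := fun m hm x hx => by
        have hwm : w ∈ genAlg (T ∪ G m) := subset_genAlg _ (Or.inr (hmono hm hw.1))
        refine ⟨⟨mul_mem hwm hx.1, ?_, ?_⟩, mul_mem hx.1 hwm, ?_, ?_⟩
        · rw [← mul_assoc, ← hwe, mul_assoc, hx.2.1]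
        · rw [mul_assoc, hx.2.2]
        · rw [← mul_assoc, hx.2.1]
        · rw [mul_assoc, hwe, ← mul_assoc, hx.2.2]
      have hUn : ∀ x ∈ ⋃ n, (E n : Set D), w * x ∈ C ∧ x * w ∈ C := fun x hx => by
        obtain ⟨m, hm⟩ := Set.mem_iUnion.1 hx
        have h1 := hmul (max m (n + 1)) (le_max_right _ _) x (hEmono (le_max_left _ _) hm)
        exact ⟨hEC _ h1.1, hEC _ h1.2⟩
      intro c hc
      rw [← SetLike.mem_coe, hC] at hc
      exact closure_minimal hUn ((hCclosed.preimage (continuous_const_mul w)).inter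
        (hCclosed.preimage (continuous_mul_const w))) hc
    · have h1 : genAlg (T ∪ G n) ≤ relComm {w} :=
        genAlg_le (isClosed_relComm _) ((Set.union_subset_union_right T (subset_genAlg _)).trans
          (mem_relComm_iff_subset.1 hw.2))
      exact (mul_comm_of_mem_relComm (h1 hx.1) rfl).symm
  refine ⟨C, hCclosed, fun t ht => hEC 0 ⟨subset_genAlg _ (Or.inl ht), heT t ht⟩, ?_⟩
  refine isPure_of_limit (A := fun n => E n)
    (φ := fun n => NonUnitalStarSubalgebra.inclusion (hEC n))
    (fun n x y hxy => Subtype.ext (congrArg (fun z : C => (z : D)) hxy)) (fun c => ?_) (fun n k hk => ?_)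
  · have hne : ∀ n, (E n : Set D).Nonempty := fun n => ⟨0, zero_mem _⟩
    -- A nearest point in `E n` need not exist, so the infimum distance is met up to `1 / (n + 1)`.
    choose y hy hyd using fun n : ℕ => (Metric.infDist_lt_iff (hne n)).1
      (lt_add_of_pos_right (Metric.infDist (c : D) (E n)) (Nat.one_div_pos_of_nat (n := n)))
    refine ⟨fun n => ⟨y n, hy n⟩, tendsto_subtype_rng.2 ?_⟩
    refine Metric.tendsto_nhds.2 fun ε hε => ?_
    have hc : (c : D) ∈ closure (⋃ n, (E n : Set D)) := hC ▸ c.2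
    obtain ⟨x, hx, hxc⟩ := Metric.mem_closure_iff.1 hc (ε / 2) (half_pos hε)
    obtain ⟨m, hm⟩ := Set.mem_iUnion.1 hx
    have h1 := (tendsto_one_div_add_atTop_nhds_zero_nat (𝕜 := ℝ)).eventually
      (gt_mem_nhds (half_pos hε))
    filter_upwards [eventually_ge_atTop m, h1] with n hn hn1
    have h2 := Metric.infDist_le_dist_of_mem (x := (c : D)) (hEmono hn hm : x ∈ (E n : Set D))
    change dist (y n) c < ε
    rw [dist_comm]
    linarith [hyd n]
  · obtain ⟨v, hv, hv2⟩ := hdiv n k hk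
    exact hasDivisor_inclusion (hEC n) (hW n) hv
      (fun x hx => supported_of_mem_genAlg hx.1 hx.2.2) hv2

end Construction
end
end PureCStar

theorem mainTheorem3 {A : Type*} {B : Type*} [NonUnitalCStarAlgebra A] [NonUnitalCStarAlgebra B]
    (hA : IsSigmaUnital A) (ω : Ultrafilter ℕ) (hω : (ω : Filter ℕ) ≤ Filter.cofinite)
    (θ : A →⋆ₙₐ[ℂ] B) :
    (UnitAlmostDivisible (RelCommQuot
        (Set.range ((diagEmb ω).comp θ))) →
      IsPureHom θ) ∧
    ((∀ S : NonUnitalStarSubalgebra ℂ (Ultrapower B ω),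
        IsClosed (S : Set (Ultrapower B ω)) →
        TopologicalSpace.IsSeparable (S : Set (Ultrapower B ω)) →
        S ≤ relComm (Set.range ((diagEmb ω).comp θ)) →
        UnitAlmostDivisible (RelCommQuot
          (Set.range ((diagEmb ω).comp θ) ∪ (S : Set (Ultrapower B ω))))) →
      ∃ (C : NonUnitalStarSubalgebra ℂ (Ultrapower B ω))
        (_ : IsClosed (C : Set (Ultrapower B ω))),
        Set.range ((diagEmb ω).comp θ) ⊆ (C : Set (Ultrapower B ω)) ∧
          IsPure C) := by
  obtain ⟨e, he, heθ⟩ := exists_unit_of_isSigmaUnital hA hω θ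
  refine ⟨fun h => isPureHom_of_diagEmb_comp (hasDivisor_of_unitAlmostDivisible h heθ), fun h => ?_⟩
  exact exists_isPure he (by rintro _ ⟨a, rfl⟩; exact heθ a) h
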